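/- All graphs are finite, simple and undirected; $N[v]$ is the closed neighborhood of $v$, and $G^2$ is the square of $G$ (distinct vertices at distance at most $2$ are adjacent). An efficient dominating set of $G=(V,E)$ is a set $D\subseteq V$ such that every vertex lies in $N[d]$ for exactly one $d\in D$. Given $G$, integer vertex weights $w$ (possibly negative) and an integer $k$, the problem Min-WED asks for an efficient dominating set $D$ with $w(D)=\sum_{x\in D}w(x)\le k$, or the answer "No" if there is none; Max-WED is the same with $w(D)\ge k$. For an ordering $\sigma=(v_1,\dots,v_n)$ of $V$ let $G_{\sigma,i}$ be the subgraph induced by $\{v_i,\dots,v_n\}$. A vertex $u\in N[v]$ is a maximum neighbor of $v$ in a graph if $N[x]\subseteq N[u]$ for all $x\in N[v]$; $\sigma$ is a maximum neighborhood ordering if each $v_i$ has a maximum neighbor in $G_{\sigma,i}$, and $G$ is dually chordal if it has such an ordering. Consider the following algorithm on an instance $(G,w,k)$. 1. Let $\mu=\min\{\min_{v} w(v),k\}$. If $\mu<0$, solve the efficient domination problem on $G$; if there is no efficient dominating set, return No; otherwise let $\gamma$ be the size of the one found (all have the same size), and replace $w(v)$ by $w(v)+|\mu|$ for all $v$, and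 $k$ by $k+|\mu|\gamma$. 2. Put $M=\max\{\sum_x w(x),k\}+1$, $k'=M|V|-k$, $D=\emptyset$, and, for all $v$, $\omega(v)=M|N[v]|-w(v)$ and $\omega_p(v)=0$; all vertices are unmarked and not blocked. 3. Find a maximum neighborhood ordering $\sigma=(v_1,\dots,v_n)$ of $G$ that is also a perfect elimination ordering of $G^2$, with maximum neighbors $m_i$ of $v_i$ in $G_{\sigma,i}$ such that $m_i\ne v_i$ whenever $v_i$ has a neighbor in $G_{\sigma,i}$ (for connected $G$: for all $i<n$). 4. For $i=1,\dots,n$: subtract $\omega_p(u)$ from $\omega(v_i)$ for all $u\in N[v_i]$; if now $\omega(v_i)>0$, mark $v_i$ and add $\omega(v_i)$ to $\omega_p(m_i)$. 5. For $i=n,\dots,1$: if $v_i$ is marked and $m_i$ is not blocked, put $v_i$ into $D$ and block all vertices of $N[v_i]$. 6. If $\sum_{v\in D}(M|N[v]|-w(v))\ge k'$ (with the $w$ and $k$ of step 2), return $D$; otherwise return No. **Theorem.** The algorithm solves Min-WED on dually chordal graphs in linear time. That is: for every dually chordal $G$, all $w$ and all $k$, whatever correct answer is used in step 1 and whatever ordering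 and maximum neighbors are chosen in step 3, its result is a correct answer to the Min-WED instance $(G,w,k)$; and the algorithm can be implemented on a random access machine (integer registers and arrays, unit-cost addition, subtraction and comparison) so that, for $G$ dually chordal and given by adjacency lists, it halts with such a result after $O(|V|+|E|+1)$ steps, with an absolute constant. Max-WED is also solvable in linear time on dually chordal graphs, and, in particular, both problems are solvable in linear time on strongly chordal graphs (the graphs that have a strong elimination ordering: an ordering in which $i<j$, $k<l$, $v_k,v_l\in N[v_i]$ and $v_k\in N[v_j]$ imply $v_l\in N[v_j]$). -/

import Mathlib

namespace WED

universe u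

/-! ### Graph notions -/

section Graphs

variable {V : Type u}

/-- The closed neighborhood `N[v]`. -/
def closedNbhd (G : SimpleGraph V) (v : V) : Set V := {x | x = v ∨ G.Adj v x}

/-- `D` is an efficient dominating set: every vertex lies in the closed neighborhood of exactly one
vertex of `D`. -/
def IsEfficientDominatingSet (G : SimpleGraph V) (D : Finset V) : Prop :=
  ∀ v : V, ∃! d : V, d ∈ D ∧ v ∈ closedNbhd G d

/-- The square of a graph. -/
def square (G : SimpleGraph V) : SimpleGraph V where
  Adj x y := x ≠ y ∧ (G.Adj x y ∨ ∃ z, G.Adj x z ∧ G.Adj z y)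
  symm := ⟨fun _ _ h => ⟨h.1.symm, h.2.elim (fun a => Or.inl a.symm)
    (fun ⟨z, a, b⟩ => Or.inr ⟨z, b.symm, a.symm⟩)⟩⟩
  loopless := ⟨fun _ h => h.1 rfl⟩

/-- `x` is a maximum neighbor of `v` in `G`. -/
def IsMaximumNeighbor (G : SimpleGraph V) (x v : V) : Prop :=
  x ∈ closedNbhd G v ∧ ∀ w ∈ closedNbhd G v, closedNbhd G w ⊆ closedNbhd G x

/-- For a vertex ordering `σ = (σ 0, …, σ (n-1))`, the vertices from position `i` on. -/
def suffix {n : ℕ} (σ : Fin n ≃ V) (i : Fin n) : Set V := {v | i ≤ σ.symm v}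

theorem mem_suffix_self {n : ℕ} (σ : Fin n ≃ V) (i : Fin n) : σ i ∈ suffix σ i := by
  simp [suffix]

/-- `x` is a maximum neighbor of the `i`-th vertex in the subgraph induced by the vertices from
position `i` on. -/
def IsMaximumNeighborAt (G : SimpleGraph V) {n : ℕ} (σ : Fin n ≃ V) (i : Fin n) (x : V) : Prop :=
  ∃ hx : x ∈ suffix σ i,
    IsMaximumNeighbor (G.induce (suffix σ i)) ⟨x, hx⟩ ⟨σ i, mem_suffix_self σ i⟩

/-- Maximum neighborhood orderings. -/
def IsMaximumNeighborhoodOrdering (G : SimpleGraph V) {n : ℕ} (σ : Fin n ≃ V) : Prop :=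
  ∀ i : Fin n, ∃ x : V, IsMaximumNeighborAt G σ i x

/-- Dually chordal graphs: the (finite) graphs that admit a maximum neighborhood ordering. -/
def IsDuallyChordal (G : SimpleGraph V) : Prop :=
  ∃ (n : ℕ) (σ : Fin n ≃ V), IsMaximumNeighborhoodOrdering G σ

/-- Strongly chordal graphs: the (finite) graphs that admit a strong elimination ordering, that is,
an ordering in which `i < j`, `k < l`, `v_k, v_l ∈ N[v_i]` and `v_k ∈ N[v_j]` imply
`v_l ∈ N[v_j]`. -/
def IsStronglyChordal (G : SimpleGraph V) : Prop :=
  ∃ (n : ℕ) (σ : Fin n ≃ V), ∀ i j k l : Fin n, i < j → k < l →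
    σ k ∈ closedNbhd G (σ i) → σ l ∈ closedNbhd G (σ i) → σ k ∈ closedNbhd G (σ j) →
    σ l ∈ closedNbhd G (σ j)

/-- Perfect elimination orderings: the later neighbors of each vertex form a clique. -/
def IsPerfectEliminationOrdering (G : SimpleGraph V) {n : ℕ} (σ : Fin n ≃ V) : Prop :=
  ∀ i : Fin n, G.IsClique {v | i < σ.symm v ∧ G.Adj (σ i) v}

/-- The data the algorithm computes before its two loops: a maximum neighborhood ordering `σ` that
is also a perfect elimination ordering of the square, with maximum neighbors `m i` such that a
vertex is its own maximum neighbor only if it has no later neighbor (in a connected graph: only if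
it is the last vertex). -/
structure IsAdmissible (G : SimpleGraph V) {n : ℕ} (σ : Fin n ≃ V) (m : Fin n → V) : Prop where
  maximumNeighbor : ∀ i, IsMaximumNeighborAt G σ i (m i)
  peo : IsPerfectEliminationOrdering (square G) σ
  ne : ∀ i, (∃ j, i < j ∧ G.Adj (σ i) (σ j)) → m i ≠ σ i

/-- A correct answer to the efficient domination problem on `G`: an efficient dominating set, or
`none` if there is none. -/
def IsEDAnswer (G : SimpleGraph V) : Option (Finset V) → Prop
  | some D => IsEfficientDominatingSet G D
  | none => ¬ ∃ D : Finset V, IsEfficientDominatingSet G D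

/-- A correct answer to the instance `(G, w, k)` of the minimum weight efficient dominating set
problem: an efficient dominating set of weight at most `k`, or `none` ("No") if there is none. -/
def IsMinWEDAnswer (G : SimpleGraph V) (w : V → ℤ) (k : ℤ) : Option (Finset V) → Prop
  | some D => IsEfficientDominatingSet G D ∧ ∑ x ∈ D, w x ≤ k
  | none => ¬ ∃ D : Finset V, IsEfficientDominatingSet G D ∧ ∑ x ∈ D, w x ≤ k

/-- The same for the maximum weight efficient dominating set problem. -/
def IsMaxWEDAnswer (G : SimpleGraph V) (w : V → ℤ) (k : ℤ) : Option (Finset V) → Prop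
  | some D => IsEfficientDominatingSet G D ∧ k ≤ ∑ x ∈ D, w x
  | none => ¬ ∃ D : Finset V, IsEfficientDominatingSet G D ∧ k ≤ ∑ x ∈ D, w x

end Graphs

/-! ### The algorithm -/

section Algorithm

variable {V : Type u} [Fintype V] [DecidableEq V]

/-- `N[v]` as a finite set. -/
def nbhd (G : SimpleGraph V) [DecidableRel G.Adj] (v : V) : Finset V :=
  insert v (G.neighborFinset v)

/-- The variables of the first loop: `ω`, `ω_p`, and the set of marked vertices. -/
structure MarkState (V : Type u) where
  omega : V → ℤ
  omegaP : V → ℤ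
  marked : Finset V

/-- One pass of the first loop, for the vertex `v` with maximum neighbor `mv`: subtract
`ω_p(x)` for all `x ∈ N[v]` from `ω(v)`; if `ω(v) > 0`, mark `v` and add `ω(v)` to `ω_p(mv)`. -/
def markStep (G : SimpleGraph V) [DecidableRel G.Adj] (v mv : V) (s : MarkState V) :
    MarkState V :=
  let x : ℤ := s.omega v - ∑ y ∈ nbhd G v, s.omegaP y
  if 0 < x then
    { omega := Function.update s.omega v x
      omegaP := Function.update s.omegaP mv (s.omegaP mv + x)
      marked := insert v s.marked }
  else
    { s with omega := Function.update s.omega v x }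

/-- The variables of the second loop: `D` and the set of blocked vertices. -/
structure SelectState (V : Type u) where
  chosen : Finset V
  blocked : Finset V

/-- One pass of the second loop: if `v` is marked and `mv` is not blocked, put `v` into `D` and
block all of `N[v]`. -/
def selectStep (G : SimpleGraph V) [DecidableRel G.Adj] (marked : Finset V) (v mv : V)
    (s : SelectState V) : SelectState V :=
  if v ∈ marked ∧ mv ∉ s.blocked then
    { chosen := insert v s.chosen
      blocked := s.blocked ∪ nbhd G v }
  else s

/-- The part of the algorithm that follows the transformation to nonnegative weights. -/
def mainPart (G : SimpleGraph V) [DecidableRel G.Adj] {n : ℕ} (σ : Fin n ≃ V) (m : Fin n → V)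
    (w : V → ℤ) (k : ℤ) : Option (Finset V) :=
  let M : ℤ := max (∑ x, w x) k + 1
  let k' : ℤ := M * (Fintype.card V : ℤ) - k
  let omega₀ : V → ℤ := fun v => M * ((nbhd G v).card : ℤ) - w v
  let s₁ : MarkState V := (List.finRange n).foldl (fun s i => markStep G (σ i) (m i) s)
    { omega := omega₀, omegaP := fun _ => 0, marked := ∅ }
  let s₂ : SelectState V :=
    (List.finRange n).reverse.foldl (fun s i => selectStep G s₁.marked (σ i) (m i) s)
      { chosen := ∅, blocked := ∅ }
  if k' ≤ ∑ v ∈ s₂.chosen, omega₀ v then some s₂.chosen else none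

/-- The whole algorithm on the instance `(G, w, k)`, where `ed` is the answer to the efficient
domination problem on `G`, and `σ`, `m` are the ordering and the maximum neighbors it has computed.
`μ` is the minimum of `k` and all weights. -/
def minWEDAlgorithm (G : SimpleGraph V) [DecidableRel G.Adj] (ed : Option (Finset V)) {n : ℕ}
    (σ : Fin n ≃ V) (m : Fin n → V) (w : V → ℤ) (k : ℤ) : Option (Finset V) :=
  let μ : ℤ := Finset.univ.fold min k w
  if μ < 0 then
    match ed with
    | none => none
    | some D₀ => mainPart G σ m (fun v => w v + |μ|) (k + |μ| * (D₀.card : ℤ))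
  else mainPart G σ m w k

/-- `out` is the result of a run of the algorithm on `(G, w, k)`, for some correct answer to the
efficient domination problem and some admissible ordering and maximum neighbors. -/
def IsAlgorithmResult (G : SimpleGraph V) [DecidableRel G.Adj] (w : V → ℤ) (k : ℤ)
    (out : Option (Finset V)) : Prop :=
  ∃ (ed : Option (Finset V)) (n : ℕ) (σ : Fin n ≃ V) (m : Fin n → V),
    IsEDAnswer G ed ∧ IsAdmissible G σ m ∧ out = minWEDAlgorithm G ed σ m w k

end Algorithm

/-! ### The machine model

A random access machine with the uniform cost measure: registers and arrays that hold integers,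
addition, subtraction and comparison with zero as the only arithmetic, programs in structured form.
A fixed program mentions only finitely many registers and arrays. -/

/-- Contents of the memory: register `x` holds `reg x`, cell `i` of array `a` holds `arr a i`. -/
structure Memory where
  reg : ℕ → ℤ
  arr : ℕ → ℤ → ℤ

/-- Elementary instructions. -/
inductive Instr where
  /-- `x := c` -/
  | const (x : ℕ) (c : ℤ)
  /-- `x := y + z` -/
  | add (x y z : ℕ)
  /-- `x := y - z` -/
  | sub (x y z : ℕ)
  /-- `x := a[y]` -/
  | load (x a y : ℕ)
  /-- `a[y] := x` -/
  | store (a y x : ℕ)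

/-- The effect of an elementary instruction. -/
def Instr.apply : Instr → Memory → Memory
  | .const x c, s => { s with reg := Function.update s.reg x c }
  | .add x y z, s => { s with reg := Function.update s.reg x (s.reg y + s.reg z) }
  | .sub x y z, s => { s with reg := Function.update s.reg x (s.reg y - s.reg z) }
  | .load x a y, s => { s with reg := Function.update s.reg x (s.arr a (s.reg y)) }
  | .store a y x, s =>
    { s with arr := Function.update s.arr a (Function.update (s.arr a) (s.reg y) (s.reg x)) }

/-- Programs. -/
inductive Program where
  | skip
  | instr (c : Instr)
  | seq (p q : Program)
  /-- if register `x` is positive then `p` else `q` -/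
  | ite (x : ℕ) (p q : Program)
  /-- while register `x` is positive do `p` -/
  | while (x : ℕ) (p : Program)

/-- `Exec p s t s'`: started in `s`, the program `p` halts in `s'` after `t` steps. Every elementary
instruction and every test is one step. -/
inductive Exec : Program → Memory → ℕ → Memory → Prop where
  | skip (s : Memory) : Exec .skip s 0 s
  | instr (c : Instr) (s : Memory) : Exec (.instr c) s 1 (c.apply s)
  | seq {p q : Program} {s s₁ s₂ : Memory} {t₁ t₂ : ℕ} :
      Exec p s t₁ s₁ → Exec q s₁ t₂ s₂ → Exec (.seq p q) s (t₁ + t₂) s₂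
  | ite_pos {x : ℕ} {p q : Program} {s s' : Memory} {t : ℕ} :
      0 < s.reg x → Exec p s t s' → Exec (.ite x p q) s (t + 1) s'
  | ite_neg {x : ℕ} {p q : Program} {s s' : Memory} {t : ℕ} :
      s.reg x ≤ 0 → Exec q s t s' → Exec (.ite x p q) s (t + 1) s'
  | while_done {x : ℕ} {p : Program} {s : Memory} :
      s.reg x ≤ 0 → Exec (.while x p) s 1 s
  | while_step {x : ℕ} {p : Program} {s s₁ s₂ : Memory} {t₁ t₂ : ℕ} :
      0 < s.reg x → Exec p s t₁ s₁ → Exec (.while x p) s₁ t₂ s₂ →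
      Exec (.while x p) s (t₁ + t₂ + 1) s₂

/-! ### Input, output, linear time -/

/-- `adj v` lists the neighbors of `v`, without repetition and in any order. -/
def IsAdjacencyList {n : ℕ} (G : SimpleGraph (Fin n)) (adj : Fin n → List (Fin n)) : Prop :=
  ∀ v, (adj v).Nodup ∧ ∀ x, x ∈ adj v ↔ G.Adj v x

/-- An array that holds the list `l` from cell `0` on, and zeros elsewhere. -/
def arrayOfList (l : List ℤ) : ℤ → ℤ := fun j => if 0 ≤ j then l.getD j.toNat 0 else 0

/-- The cells in front of the adjacency list of vertex `i`, when the adjacency lists of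
`0, …, n-1` are stored one after the other. -/
def listOffset {n : ℕ} (adj : Fin n → List (Fin n)) (i : ℕ) : ℕ :=
  ((List.ofFn adj).take i).flatten.length

/-- The initial memory: register `0` holds `n`, register `1` holds `k`; array `1` holds the
adjacency lists one after the other, that of vertex `v` occupying the cells from `a₀[v]` up to
`a₀[v+1] - 1`, where `a₀` is array `0`; array `2` holds the weights; all else is zero. -/
def initialMemory {n : ℕ} (adj : Fin n → List (Fin n)) (w : Fin n → ℤ) (k : ℤ) : Memory where
  reg := fun x => if x = 0 then (n : ℤ) else if x = 1 then k else 0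
  arr := fun a =>
    if a = 0 then arrayOfList ((List.range (n + 1)).map fun i => (listOffset adj i : ℤ))
    else if a = 1 then
      arrayOfList ((List.ofFn adj).flatten.map fun v => (((v : Fin n) : ℕ) : ℤ))
    else if a = 2 then arrayOfList (List.ofFn w)
    else fun _ => 0

/-- The output of a halted program: "No" unless register `0` holds `1`, and then the set of
vertices whose cell in array `0` holds `1`. -/
def output (n : ℕ) (s : Memory) : Option (Finset (Fin n)) :=
  if s.reg 0 = 1 then some (Finset.univ.filter fun v => s.arr 0 ((v : ℕ) : ℤ) = 1) else none

/-- There is a program that, on all instances `(G, w, k)` with `G` in the class `C`, given by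
adjacency lists, halts within `c * (|V| + |E| + 1)` steps with an output that satisfies `A`. -/
def SolvableInLinearTime (C : ∀ n : ℕ, SimpleGraph (Fin n) → Prop)
    (A : ∀ (n : ℕ) (G : SimpleGraph (Fin n)) [DecidableRel G.Adj],
      (Fin n → ℤ) → ℤ → Option (Finset (Fin n)) → Prop) : Prop :=
  ∃ (p : Program) (c : ℕ), ∀ (n : ℕ) (G : SimpleGraph (Fin n)) [DecidableRel G.Adj]
    (adj : Fin n → List (Fin n)) (w : Fin n → ℤ) (k : ℤ),
    C n G → IsAdjacencyList G adj →
    ∃ (t : ℕ) (s : Memory), Exec p (initialMemory adj w k) t s ∧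
      t ≤ c * (n + G.edgeFinset.card + 1) ∧ A n G w k (output n s)

end WED

open WED

/-!
Given an admissible ordering, the two loops solve a packing problem by a primal-dual argument. That
such an ordering exists, and is found in linear time, rests on the acyclicity of the hypergraph of
closed neighborhoods.

*Correctness of the two loops.* Let `σ`, `m` be admissible. An earlier vertex at distance at most
`2` from a later one has its maximum neighbor adjacent to the later one
(`IsAdmissible.mem_closedNbhd`). So if the closed neighborhoods of two vertices meet, the earlier
one is charged, through its maximum neighbor, to the later one. The first loop computes a feasible
dual solution of the problem of packing closed neighborhoods of largest weight `ω`
(`markResult_spec`), and the second loop a packing that meets it with equality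
(`selectResult_spec`); hence the packing has largest weight (`sum_le_sum_selectResult`). With
`ω v = M * |N[v]| - w v`, where `w` is nonnegative and `M` exceeds the total weight and `k`, a
packing weighs at least `M * |V| - k` exactly if it covers all vertices and has original weight at
most `k`, which makes it an efficient dominating set of weight at most `k` (`mainPart_correct`).
Negative weights can be raised by a constant, since all efficient dominating sets have the same
size (`minWEDAlgorithm_correct`).

*Finding an admissible ordering in linear time.* The closed neighborhoods of a dually chordal graph
form an acyclic hypergraph, that is, they have a join tree (`IsDuallyChordal.earReducible`, by
induction along a maximum neighborhood ordering). A maximum cardinality search on the closed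
neighborhoods repeatedly processes a vertex `u` whose closed neighborhood has a largest number of
vertices that are covered already, and numbers the new vertices of `N[u]`, from `n - 1` down, with
`u` as their maximum neighbor. An exchange argument in the join tree (`EarReducible.merge`) shows
that the processed vertices always form a connected part of some join tree
(`IsConnectedInJoinTree.insert`), so that `N[u]` contains all covered vertices at distance at most
`2` from a new vertex (`IsConnectedInJoinTree.mem_of_mem_cover`). This is what makes the ordering
admissible, `IsNumbering.isAdmissible`: it is a maximum neighborhood ordering and a perfect
elimination ordering of the square at once.

The machine keeps the vertices that are numbered but not processed in buckets, by their current
counts; an entry whose count has grown stays behind, and by the time it comes up its vertex has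
been processed, so that it is skipped. A potential pays for the passes of the search
(`searchPotential`, `SearchState.runs_step`): every vertex is numbered once and processed once,
each at the cost of its closed neighborhood, and numbering a vertex raises the index of the last
bucket at most in proportion to the size of its closed neighborhood. The two loops then cost one
scan of every closed neighborhood each (`runs_mainPart`). They run first with zero weights, which
solves the efficient domination problem, and then with the raised weights (`runs_minWED`).
Maximization is minimization of the opposite weights. A strongly chordal graph is dually chordal:
in a strong elimination ordering the last neighbor of a vertex in a suffix is a maximum neighbor
(`IsStronglyChordal.isDuallyChordal`).
-/

namespace WED

universe u

/-! ### Ear reductions of hypergraphs -/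

section Ears

variable {ι : Type*} {α : Type*}

/-- The hyperedges `E z`, `z ∈ F`, can be removed one by one, down to the root `r`, such that each
removed hyperedge `E z` is an ear: some remaining `E p` contains everything that `E z` shares with
the remaining hyperedges. Linking every `z` to its `p` gives a join tree, so this is acyclicity of
the hypergraph, with a chosen root of the join tree. -/
inductive EarReducible (E : ι → Set α) (r : ι) : Set ι → Prop
  | root : EarReducible E r {r}
  | ear {F : Set ι} {z p : ι} : EarReducible E r F → z ∉ F → p ∈ F →
      (∀ x ∈ E z, ∀ q ∈ F, x ∈ E q → x ∈ E p) → EarReducible E r (insert z F)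

namespace EarReducible

variable {E E' : ι → Set α} {r u x z : ι} {F : Set ι}

theorem root_mem (h : EarReducible E r F) : r ∈ F := by
  induction h with
  | root => rfl
  | ear _ _ _ _ ih => exact Or.inr ih

/-- A new hyperedge that hangs on the root can become the root. -/
theorem reroot_ear (h : EarReducible E r F) (hz : z ∉ F)
    (hE : ∀ x ∈ E z, ∀ q ∈ F, x ∈ E q → x ∈ E r) : EarReducible E z (insert z F) := by
  induction h with
  | root =>
    rw [Set.pair_comm]
    refine .ear .root (fun h => hz h.symm) rfl ?_
    rintro x _ q rfl hq
    exact hq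
  | @ear F y p h hy hp hyp ih =>
    rw [Set.insert_comm]
    refine .ear (ih (fun h => hz (Or.inr h)) fun x hx q hq => hE x hx q (Or.inr hq))
      (fun h' => h'.elim (fun e => hz (Or.inl e.symm)) hy) (Or.inr hp) ?_
    rintro x hx q (rfl | hq) hxq
    · exact hyp x hx _ h.root_mem (hE x hxq y (Or.inl rfl) hx)
    · exact hyp x hx q hq hxq

/-- A join tree can be rooted anywhere. -/
theorem reroot (h : EarReducible E r F) (hu : u ∈ F) : EarReducible E u F := by
  induction h generalizing u with
  | root => cases hu; exact .root
  | ear h hz hp hE ih =>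
    rcases hu with rfl | hu
    · exact (ih hp).reroot_ear hz hE
    · exact .ear (ih hu) hz hp hE

/-- The hyperedges may grow as long as each of them ends up inside the root hyperedge, or does not
meet what was added. -/
theorem grow (h : EarReducible E r F) (hsub : ∀ z ∈ F, E z ⊆ E' z)
    (hE : ∀ z ∈ F, E' z ⊆ E' r ∨ (E' z = E z ∧ ∀ q ∈ F, E z ∩ E' q ⊆ E q)) :
    EarReducible E' r F := by
  induction h with
  | root => exact .root
  | @ear F z p h hz hp hyp ih =>
    have ih' := ih (fun z hz => hsub z (Or.inr hz)) fun z hz =>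
      (hE z (Or.inr hz)).imp id fun ⟨a, b⟩ => ⟨a, fun q hq => b q (Or.inr hq)⟩
    rcases hE z (Or.inl rfl) with hz' | ⟨hz', hq'⟩
    · exact .ear ih' hz h.root_mem fun x hx _ _ _ => hz' hx
    · refine .ear ih' hz hp fun x hx q hq hxq => hsub p (Or.inr hp) ?_
      rw [hz'] at hx
      exact hyp x hx q hq (hq' q (Or.inr hq) ⟨hx, hxq⟩)

/-- The same with an additional hyperedge, which becomes the root. -/
theorem grow_root (h : EarReducible E r F) (hx : x ∉ F) (hsub : ∀ z ∈ F, E z ⊆ E' z)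
    (hr : E' r ⊆ E' x)
    (hE : ∀ z ∈ F, E' z ⊆ E' x ∨
      (E' z = E z ∧ E z ∩ E' x = ∅ ∧ ∀ q ∈ F, E z ∩ E' q ⊆ E q)) :
    EarReducible E' x (insert x F) := by
  induction h with
  | root =>
    rw [Set.pair_comm]
    refine .ear .root (fun h => hx h.symm) rfl ?_
    rintro y hy q rfl _
    exact hr hy
  | @ear F z p h hz hp hyp ih =>
    have ih' := ih (fun h => hx (Or.inr h)) (fun z hz => hsub z (Or.inr hz)) fun z hz =>
      (hE z (Or.inr hz)).imp id fun ⟨a, b, c⟩ => ⟨a, b, fun q hq => c q (Or.inr hq)⟩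
    have hz2 : z ∉ insert x F := by
      rintro (rfl | h')
      · exact hx (Or.inl rfl)
      · exact hz h'
    rw [Set.insert_comm]
    rcases hE z (Or.inl rfl) with hz' | ⟨hz', hzx, hq'⟩
    · exact .ear ih' hz2 (Or.inl rfl) fun y hy _ _ _ => hz' hy
    · refine .ear ih' hz2 (Or.inr hp) ?_
      rintro y hy q (rfl | hq) hyq
      · rw [hz'] at hy
        exact absurd (show y ∈ E z ∩ E' q from ⟨hy, hyq⟩) (by simp [hzx])
      · rw [hz'] at hy
        exact hsub p (Or.inr hp) (hyp y hy q hq (hq' q (Or.inr hq) ⟨hy, hyq⟩))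

variable [DecidableEq ι]

/-- The root may swallow a set `X` of which it contains everything that is in other hyperedges. -/
theorem root_union {X : Set α} (h : EarReducible E r F)
    (hX : ∀ y ∈ X, ∀ q ∈ F, y ∈ E q → y ∈ E r) :
    EarReducible (Function.update E r (E r ∪ X)) r F := by
  induction h with
  | root => exact .root
  | @ear F z p h hz hp hyp ih =>
    have hzr : z ≠ r := fun e => hz (e ▸ h.root_mem)
    have hmono : ∀ q, E q ⊆ Function.update E r (E r ∪ X) q := by
      intro q
      by_cases hq : q = r
      · subst hq; simp
      · simp [hq]
    refine .ear (ih fun y hy q hq => hX y hy q (Or.inr hq)) hz hp ?_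
    intro y hy q hq hyq
    rw [Function.update_of_ne hzr] at hy
    refine hmono p ?_
    by_cases hqr : q = r
    · subst hqr
      rw [Function.update_self] at hyq
      rcases hyq with hyq | hyq
      · exact hyp y hy _ hq hyq
      · exact hyp y hy _ hq (hX y hyq z (Or.inl rfl) hy)
    · rw [Function.update_of_ne hqr] at hyq
      exact hyp y hy q hq hyq

/-- The exchange step: if no other hyperedge meets `E r` in strictly more than `E u` does, then
`r` hangs on the root `u` in a suitable join tree, so that `E r` and `E u` can be merged. -/
theorem merge (h : EarReducible E u F) (hr : r ∈ F) (hru : r ≠ u)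
    (hmax : ∀ p ∈ F, p ≠ r → E u ∩ E r ⊆ E p → E p ∩ E r ⊆ E u) :
    EarReducible (Function.update E u (E u ∪ E r)) u (F \ {r}) := by
  induction h with
  | root => exact absurd hr hru
  | @ear F z p h hz hp hyp ih =>
    by_cases hzr : z = r
    · -- `r` is an ear that hangs on `p`; by maximality it can hang on the root `u` as well
      subst hzr
      rw [Set.insert_sdiff_of_mem _ (Set.mem_singleton z), Set.sdiff_singleton_eq_self hz]
      refine h.root_union fun y hy q hq hyq => ?_
      refine hmax p (Or.inr hp) (fun e => hz (e ▸ hp)) ?_ ⟨hyp y hy q hq hyq, hy⟩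
      exact fun v hv => hyp v hv.2 u h.root_mem hv.1
    · have hrF : r ∈ F := hr.resolve_left fun e => hzr e.symm
      have hzu : z ≠ u := fun e => hz (e ▸ h.root_mem)
      have key : ∀ y ∈ E z, ∀ q ∈ F, y ∈ Function.update E u (E u ∪ E r) q → y ∈ E p := by
        intro y hy q hq hyq
        by_cases hqu : q = u
        · subst hqu
          rw [Function.update_self] at hyq
          rcases hyq with hyq | hyq
          · exact hyp y hy _ hq hyq
          · exact hyp y hy r hrF hyq
        · rw [Function.update_of_ne hqu] at hyq
          exact hyp y hy q hq hyq
      rw [Set.insert_sdiff_of_notMem _ (show z ∉ ({r} : Set ι) from hzr)]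
      have ih' := ih hrF fun p hp => hmax p (Or.inr hp)
      have hz' : z ∉ F \ {r} := fun h => hz h.1
      by_cases hpr : p = r
      · subst hpr
        refine .ear ih' hz' ⟨h.root_mem, fun e => hru e.symm⟩ fun y hy q hq hyq => ?_
        rw [Function.update_of_ne hzu] at hy
        rw [Function.update_self]
        exact Or.inr (key y hy q hq.1 hyq)
      · refine .ear ih' hz' ⟨hp, hpr⟩ fun y hy q hq hyq => ?_
        rw [Function.update_of_ne hzu] at hy
        by_cases hpu : p = u
        · subst hpu
          rw [Function.update_self]
          exact Or.inl (key y hy q hq.1 hyq)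
        · rw [Function.update_of_ne hpu]
          exact key y hy q hq.1 hyq

/-- In the situation of `merge`, a hyperedge that shares with `E u` something outside `E r` meets
`E r` inside `E u`: its path to `r` in the join tree runs through `u`. -/
theorem inter_subset_of_merge (h : EarReducible E u F) (hr : r ∈ F) (hru : r ≠ u)
    (hmax : ∀ p ∈ F, p ≠ r → E u ∩ E r ⊆ E p → E p ∩ E r ⊆ E u) {x : α} (hxu : x ∈ E u)
    (hxr : x ∉ E r) (hz : z ∈ F) (hxz : x ∈ E z) : E z ∩ E r ⊆ E u := by
  induction h generalizing z with
  | root => exact absurd hr hru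
  | @ear F q p h hq hp hyp ih =>
    by_cases hqr : q = r
    · subst hqr
      rcases hz with rfl | hz
      · exact absurd hxz hxr
      intro y hy
      refine hmax p (Or.inr hp) (fun e => hq (e ▸ hp)) ?_ ⟨hyp y hy.2 z hz hy.1, hy.2⟩
      exact fun v hv => hyp v hv.2 u h.root_mem hv.1
    · have hrF : r ∈ F := hr.resolve_left fun e => hqr e.symm
      have ih' := fun z hz hxz => @ih z hrF (fun p hp => hmax p (Or.inr hp)) hz hxz
      rcases hz with rfl | hz
      · intro y hy
        exact ih' p hp (hyp x hxz u h.root_mem hxu) ⟨hyp y hy.1 r hrF hy.2, hy.2⟩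
      · exact ih' z hz hxz

end EarReducible

end Ears

/-! ### Dually chordal graphs have acyclic neighborhood hypergraphs -/

section MaximumCardinality

variable {V : Type u} {G : SimpleGraph V}

theorem mem_closedNbhd {v x : V} : x ∈ closedNbhd G v ↔ x = v ∨ G.Adj v x := Iff.rfl

theorem mem_closedNbhd_comm {v x : V} : x ∈ closedNbhd G v ↔ v ∈ closedNbhd G x := by
  simp only [mem_closedNbhd, G.adj_comm v x, eq_comm]

theorem self_mem_closedNbhd (v : V) : v ∈ closedNbhd G v := Or.inl rfl

theorem isMaximumNeighborAt_iff {n : ℕ} {σ : Fin n ≃ V} {i : Fin n} {x : V} :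
    IsMaximumNeighborAt G σ i x ↔ i ≤ σ.symm x ∧ x ∈ closedNbhd G (σ i) ∧
      ∀ w ∈ closedNbhd G (σ i), i ≤ σ.symm w → ∀ y ∈ closedNbhd G w, i ≤ σ.symm y →
        y ∈ closedNbhd G x := by
  constructor
  · rintro ⟨hx, hx1, hx2⟩
    refine ⟨hx, hx1.imp (congrArg Subtype.val) id, fun w hw hiw y hy hiy => ?_⟩
    exact (@hx2 ⟨w, hiw⟩ (hw.imp Subtype.ext id) ⟨y, hiy⟩ (hy.imp Subtype.ext id)).imp
      (congrArg Subtype.val) id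
  · rintro ⟨hx, hx1, hx2⟩
    refine ⟨hx, hx1.imp Subtype.ext id, ?_⟩
    rintro ⟨w, hiw⟩ hw ⟨y, hiy⟩ hy
    exact (hx2 w (hw.imp (congrArg Subtype.val) id) hiw y (hy.imp (congrArg Subtype.val) id)
      hiy).imp Subtype.ext id

/-- The induction along the ordering. When the vertex `x` in front of a suffix is added, only the
hyperedges of vertices in `N[x]` grow, and all of these lie in the hyperedge of a maximum neighbor
of `x`. -/
theorem IsMaximumNeighborhoodOrdering.earReducible_suffix {n : ℕ} {σ : Fin n ≃ V}
    (h : IsMaximumNeighborhoodOrdering G σ) (k : ℕ) :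
    ∀ i, i + k = n → ∀ r, i ≤ (σ.symm r : ℕ) →
      EarReducible (fun z => closedNbhd G z ∩ {v | i ≤ (σ.symm v : ℕ)}) r
        {v | i ≤ (σ.symm v : ℕ)} := by
  induction k with
  | zero =>
    intro i hi r hr
    have := (σ.symm r).2
    omega
  | succ k ih =>
    intro i hi
    have hin : i < n := by omega
    obtain ⟨m, hm⟩ := h ⟨i, hin⟩
    obtain ⟨him, hmx, hmax⟩ := isMaximumNeighborAt_iff.1 hm
    set x := σ ⟨i, hin⟩ with hx
    have hxi : (σ.symm x : ℕ) = i := by simp [hx]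
    have hle : ∀ v, i ≤ (σ.symm v : ℕ) ↔ v = x ∨ i + 1 ≤ (σ.symm v : ℕ) := by
      intro v
      have : v = x ↔ (σ.symm v : ℕ) = i := by
        rw [hx, ← Equiv.symm_apply_eq, Fin.ext_iff]
      rw [this]
      omega
    have hF : {v | i ≤ (σ.symm v : ℕ)} = insert x {v | i + 1 ≤ (σ.symm v : ℕ)} := by
      ext v; exact hle v
    have hxF : x ∉ {v | i + 1 ≤ (σ.symm v : ℕ)} := by
      simp [hxi]
    have hmax' : ∀ w ∈ closedNbhd G x, i ≤ (σ.symm w : ℕ) → ∀ y ∈ closedNbhd G w,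
        i ≤ (σ.symm y : ℕ) → y ∈ closedNbhd G m := hmax
    have hcap : ∀ z, z ∉ closedNbhd G x → closedNbhd G z ∩ {v | i ≤ (σ.symm v : ℕ)} =
        closedNbhd G z ∩ {v | i + 1 ≤ (σ.symm v : ℕ)} := by
      intro z hz
      rw [hF]
      ext y
      constructor
      · rintro ⟨h1, rfl | h2⟩
        · exact absurd (mem_closedNbhd_comm.1 h1) hz
        · exact ⟨h1, h2⟩
      · exact fun h => ⟨h.1, Or.inr h.2⟩
    have hsub : ∀ z, closedNbhd G z ∩ {v | i + 1 ≤ (σ.symm v : ℕ)} ⊆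
        closedNbhd G z ∩ {v | i ≤ (σ.symm v : ℕ)} := fun z y hy => ⟨hy.1, (hle y).2 (Or.inr hy.2)⟩
    have hnew : ∀ z q, z ∉ closedNbhd G x →
        (closedNbhd G z ∩ {v | i + 1 ≤ (σ.symm v : ℕ)}) ∩
          (closedNbhd G q ∩ {v | i ≤ (σ.symm v : ℕ)}) ⊆
          closedNbhd G q ∩ {v | i + 1 ≤ (σ.symm v : ℕ)} :=
      fun z q _ y hy => ⟨hy.2.1, hy.1.2⟩
    -- it is enough to find one root
    suffices hex : ∃ r, EarReducible (fun z => closedNbhd G z ∩ {v | i ≤ (σ.symm v : ℕ)}) r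
        {v | i ≤ (σ.symm v : ℕ)} from by
      obtain ⟨r, hr⟩ := hex
      exact fun r' hr' => hr.reroot hr'
    by_cases hmx' : m = x
    · by_cases hN : ∃ r, r ∈ closedNbhd G x ∧ i + 1 ≤ (σ.symm r : ℕ)
      · obtain ⟨r, hrx, hr⟩ := hN
        refine ⟨x, ?_⟩
        have hin' : ∀ z ∈ closedNbhd G x, i ≤ (σ.symm z : ℕ) →
            closedNbhd G z ∩ {v | i ≤ (σ.symm v : ℕ)} ⊆
            closedNbhd G x ∩ {v | i ≤ (σ.symm v : ℕ)} := by
          intro z hz hiz y hy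
          refine ⟨?_, hy.2⟩
          have := hmax' z hz hiz y hy.1 hy.2
          rwa [hmx'] at this
        have hred := (ih (i + 1) (by omega) r hr).grow_root (x := x)
          (E' := fun z => closedNbhd G z ∩ {v | i ≤ (σ.symm v : ℕ)}) hxF
          (fun z _ => hsub z) (hin' r hrx (by omega)) ?_
        · rwa [← hF] at hred
        · intro z hz
          by_cases hzx : z ∈ closedNbhd G x
          · exact Or.inl (hin' z hzx ((hle z).2 (Or.inr hz)))
          · refine Or.inr ⟨hcap z hzx, ?_, fun q _ => hnew z q hzx⟩
            rw [Set.eq_empty_iff_forall_notMem]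
            rintro y ⟨⟨hyz, hy⟩, hyx, hy'⟩
            apply hzx
            have := hmax' y hyx hy' z (mem_closedNbhd_comm.1 hyz) ((hle z).2 (Or.inr hz))
            rwa [hmx'] at this
      · -- an isolated vertex of the suffix
        push Not at hN
        have hcap' : ∀ z, i + 1 ≤ (σ.symm z : ℕ) → z ∉ closedNbhd G x := fun z hz hzx => by
          have := hN z hzx
          omega
        by_cases hne : ∃ r, i + 1 ≤ (σ.symm r : ℕ)
        · obtain ⟨r, hr⟩ := hne
          refine ⟨r, ?_⟩
          have h1 := (ih (i + 1) (by omega) r hr).grow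
            (E' := fun z => closedNbhd G z ∩ {v | i ≤ (σ.symm v : ℕ)}) (fun z _ => hsub z)
            fun z hz => Or.inr ⟨hcap z (hcap' z hz), fun q _ => hnew z q (hcap' z hz)⟩
          have h2 := h1.ear hxF hr ?_
          · rwa [← hF] at h2
          · rintro y ⟨hy, hy'⟩ q hq ⟨hyq, _⟩
            rcases (hle y).1 hy' with rfl | hy'
            · exact absurd (mem_closedNbhd_comm.1 hyq) (hcap' q hq)
            · exact absurd hy (hcap' y hy')
        · refine ⟨x, ?_⟩
          rw [hF, show {v | i + 1 ≤ (σ.symm v : ℕ)} = (∅ : Set V) from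
            Set.eq_empty_iff_forall_notMem.2 fun v hv => hne ⟨v, hv⟩]
          simpa using EarReducible.root
    · have hm1 : i + 1 ≤ (σ.symm m : ℕ) := ((hle m).1 him).resolve_left hmx'
      have hin' : ∀ z ∈ closedNbhd G x, i ≤ (σ.symm z : ℕ) →
          closedNbhd G z ∩ {v | i ≤ (σ.symm v : ℕ)} ⊆
          closedNbhd G m ∩ {v | i ≤ (σ.symm v : ℕ)} :=
        fun z hz hiz y hy => ⟨hmax' z hz hiz y hy.1 hy.2, hy.2⟩
      have h1 := (ih (i + 1) (by omega) m hm1).grow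
        (E' := fun z => closedNbhd G z ∩ {v | i ≤ (σ.symm v : ℕ)}) (fun z _ => hsub z) ?_
      · refine ⟨m, ?_⟩
        have h2 := h1.ear hxF hm1 fun y hy q _ _ =>
          hin' x (self_mem_closedNbhd x) hxi.ge hy
        rwa [← hF] at h2
      · intro z hz
        by_cases hzx : z ∈ closedNbhd G x
        · exact Or.inl (hin' z hzx ((hle z).2 (Or.inr hz)))
        · exact Or.inr ⟨hcap z hzx, fun q _ => hnew z q hzx⟩

/-- The closed neighborhoods of a dually chordal graph form an acyclic hypergraph. -/
theorem IsDuallyChordal.earReducible (h : IsDuallyChordal G) (r : V) :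
    EarReducible (closedNbhd G) r Set.univ := by
  obtain ⟨n, σ, hσ⟩ := h
  simpa using hσ.earReducible_suffix n 0 (by simp) r (Nat.zero_le _)

/-! ### Maximum cardinality search -/

/-- The union of the closed neighborhoods of the vertices in `C`. -/
def cover (G : SimpleGraph V) (C : Set V) : Set V := {x | ∃ c ∈ C, x ∈ closedNbhd G c}

theorem subset_cover (C : Set V) : C ⊆ cover G C := fun c hc => ⟨c, hc, self_mem_closedNbhd c⟩

theorem cover_insert (C : Set V) (u : V) :
    cover G (insert u C) = cover G C ∪ closedNbhd G u := by
  ext x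
  simp only [cover, Set.mem_ofPred_eq, Set.mem_insert_iff, Set.mem_union]
  constructor
  · rintro ⟨c, rfl | hc, hx⟩
    · exact Or.inr hx
    · exact Or.inl ⟨c, hc, hx⟩
  · rintro (⟨c, hc, hx⟩ | hx)
    · exact ⟨c, Or.inr hc, hx⟩
    · exact ⟨u, Or.inl rfl, hx⟩

/-- The closed neighborhood hypergraph has a join tree in which `C` is connected: it stays acyclic
when the hyperedges that belong to `C` are merged into one, which is given to some `r ∈ C`. -/
def IsConnectedInJoinTree [DecidableEq V] (G : SimpleGraph V) (C : Set V) : Prop :=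
  C = ∅ ∨ ∃ r ∈ C,
    EarReducible (Function.update (closedNbhd G) r (cover G C)) r (insert r Cᶜ)

/-- `u ∉ C` is a possible next choice: no other closed neighborhood outside `C` meets the cover of
`C` in strictly more than `N[u]` does. -/
def IsMaximalChoice (G : SimpleGraph V) (C : Set V) (u : V) : Prop :=
  ∀ p ∉ C, closedNbhd G u ∩ cover G C ⊆ closedNbhd G p →
    closedNbhd G p ∩ cover G C ⊆ closedNbhd G u

variable {C : Set V} {u : V}

/-- The set of processed vertices stays connected in a join tree: the hyperedge merged so far hangs
on `u` in a suitable join tree, and both are merged. -/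
theorem IsConnectedInJoinTree.insert [DecidableEq V] (hG : IsDuallyChordal G)
    (h : IsConnectedInJoinTree G C) (hu : u ∉ C) (hmax : IsMaximalChoice G C u) :
    IsConnectedInJoinTree G (insert u C) := by
  refine Or.inr ⟨u, Or.inl rfl, ?_⟩
  rcases h with rfl | ⟨r, hrC, hr⟩
  · have h1 : cover G (Insert.insert u (∅ : Set V)) = closedNbhd G u := by
      rw [cover_insert]; simp [cover]
    have h2 : Insert.insert u (Insert.insert u (∅ : Set V))ᶜ = Set.univ := by
      ext x; simp [em]
    rw [h1, h2, Function.update_eq_self]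
    exact hG.earReducible u
  · have hru : r ≠ u := fun e => hu (e ▸ hrC)
    have hm := (hr.reroot (u := u) (Or.inr hu)).merge (Or.inl rfl) hru ?_
    · have hF : Insert.insert r Cᶜ \ {r} = Insert.insert u (Insert.insert u C)ᶜ := by
        ext x
        simp only [Set.mem_sdiff, Set.mem_insert_iff, Set.mem_compl_iff, Set.mem_singleton_iff]
        by_cases hxu : x = u
        · subst hxu; simp [hu, hru.symm]
        · by_cases hxr : x = r
          · subst hxr; simp [hrC, hru]
          · simp [hxu, hxr]
      rw [hF] at hm
      -- the two families of hyperedges differ only at `r`, which is no longer in use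
      refine hm.grow (fun z hz => ?_) (fun z hz => ?_)
      · by_cases hzu : z = u
        · subst hzu
          simp [hru.symm, cover_insert, Set.union_comm]
        · have hzr : z ≠ r := by
            rintro rfl
            rcases hz with hz | hz
            · exact hzu hz
            · exact hz (Or.inr hrC)
          simp [hzu, hzr]
      · by_cases hzu : z = u
        · subst hzu
          exact Or.inl subset_rfl
        · have hzr : z ≠ r := by
            rintro rfl
            rcases hz with hz | hz
            · exact hzu hz
            · exact hz (Or.inr hrC)
          refine Or.inr ⟨by simp [hzu, hzr], fun q hq y hy => ?_⟩
          by_cases hqu : q = u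
          · subst hqu
            have := hy.2
            simp only [Function.update_self, cover_insert] at this
            simp only [Function.update_self, Function.update_of_ne hru.symm]
            exact this.symm
          · have hqr : q ≠ r := by
              rintro rfl
              rcases hq with hq | hq
              · exact hqu hq
              · exact hq (Or.inr hrC)
            simpa [hqu, hqr] using hy.2
    · rintro p (rfl | hp) hpr
      · exact absurd rfl hpr
      · simpa [hru.symm, hpr] using hmax p hp

/-- A vertex `x` that is covered first by `N[u]` has all covered vertices at distance at most `2`
inside `N[u]`. -/
theorem IsConnectedInJoinTree.mem_of_mem_cover [DecidableEq V] (h : IsConnectedInJoinTree G C)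
    (hu : u ∉ C) (hmax : IsMaximalChoice G C u) {x w y : V} (hxu : x ∈ closedNbhd G u)
    (hx : x ∉ cover G C) (hxw : w ∈ closedNbhd G x) (hy : y ∈ closedNbhd G w)
    (hyC : y ∈ cover G C) : y ∈ closedNbhd G u := by
  rcases h with rfl | ⟨r, hrC, hr⟩
  · simp [cover] at hyC
  · have hru : r ≠ u := fun e => hu (e ▸ hrC)
    have hwC : w ∉ C := fun hw => hx ⟨w, hw, mem_closedNbhd_comm.1 hxw⟩
    have hwr : w ≠ r := fun e => hwC (e ▸ hrC)
    have := (hr.reroot (u := u) (Or.inr hu)).inter_subset_of_merge (z := w) (x := x)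
      (Or.inl rfl) hru ?_ ?_ ?_ (Or.inr hwC) ?_
    · have := @this y
      simp only [Function.update_self, Function.update_of_ne hwr,
        Function.update_of_ne hru.symm] at this
      exact this ⟨hy, hyC⟩
    · rintro p (rfl | hp) hpr
      · exact absurd rfl hpr
      · simpa [hru.symm, hpr] using hmax p hp
    · simpa [hru.symm] using hxu
    · simpa using hx
    · simpa [hwr] using mem_closedNbhd_comm.1 hxw

/-- Among the covered vertices outside `C`, one whose neighborhood contains the largest number of
covered vertices is a possible next choice. -/
theorem isMaximalChoice_of_card [Fintype V] (huC : u ∈ cover G C)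
    (hmax : ∀ p ∈ cover G C, p ∉ C →
      (closedNbhd G p ∩ cover G C).ncard ≤ (closedNbhd G u ∩ cover G C).ncard) :
    IsMaximalChoice G C u := by
  intro p hp hsub
  have hsub' : closedNbhd G u ∩ cover G C ⊆ closedNbhd G p ∩ cover G C :=
    fun y hy => ⟨hsub hy, hy.2⟩
  -- a vertex of `C` next to `u` is also next to `p`
  obtain ⟨c, hc, huc⟩ := huC
  have hpc : p ∈ cover G C :=
    ⟨c, hc, mem_closedNbhd_comm.1 (hsub ⟨mem_closedNbhd_comm.1 huc, subset_cover C hc⟩)⟩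
  have := Set.eq_of_subset_of_ncard_le hsub' (hmax p hpc hp)
  intro y hy
  exact (this ▸ hy : y ∈ closedNbhd G u ∩ cover G C).1

/-- When all covered vertices are in `C`, every vertex is a possible next choice. -/
theorem isMaximalChoice_of_cover_subset (hC : cover G C ⊆ C) : IsMaximalChoice G C u := by
  rintro p hp - y ⟨hy, hyC⟩
  exact absurd (hC ⟨y, hC hyC, mem_closedNbhd_comm.1 hy⟩) hp

end MaximumCardinality

/-! ### Strongly chordal graphs -/

/-- In a strong elimination ordering, the last neighbor of a vertex in a suffix of the ordering is
a maximum neighbor. -/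
theorem IsStronglyChordal.isDuallyChordal {V : Type u} {G : SimpleGraph V}
    (h : IsStronglyChordal G) : IsDuallyChordal G := by
  classical
  obtain ⟨n, σ, h⟩ := h
  refine ⟨n, σ, fun i => ?_⟩
  let S : Finset (Fin n) := Finset.univ.filter fun l => σ l ∈ closedNbhd G (σ i)
  have hi : i ∈ S := by simp [S, self_mem_closedNbhd]
  have hl := S.max'_mem ⟨i, hi⟩
  set l := S.max' ⟨i, hi⟩ with hldef
  have hil : i ≤ l := S.le_max' i hi
  have hl' : σ l ∈ closedNbhd G (σ i) := by simpa [S] using hl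
  refine ⟨σ l, isMaximumNeighborAt_iff.2 ⟨by simpa using hil, hl', ?_⟩⟩
  intro w hw hiw y hy hiy
  obtain ⟨k, rfl⟩ := σ.surjective w
  obtain ⟨j, rfl⟩ := σ.surjective y
  rw [Equiv.symm_apply_apply] at hiw hiy
  have hkl : k ≤ l := S.le_max' k (by simpa [S] using hw)
  rcases hkl.eq_or_lt with rfl | hkl
  · exact hy
  rcases hiy.eq_or_lt with rfl | hij
  · exact mem_closedNbhd_comm.1 hl'
  · exact mem_closedNbhd_comm.1 (h i j k l hij hkl hw hl' (mem_closedNbhd_comm.1 hy))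

/-! ### Numbering lists -/

section Numbering

variable {V : Type u} {G : SimpleGraph V} {m : V → V} {L : List V}

/-- The list `L` numbers its vertices, from the last one to the first one, in such a way that `m x`
is a maximum neighbor of `x` among the vertices numbered up to `x`. The condition speaks of all
vertices at distance at most `2` in `G`, with common neighbors that need not be numbered; this makes
the ordering a perfect elimination ordering of the square. -/
def IsNumbering (G : SimpleGraph V) (m : V → V) : List V → Prop
  | [] => True
  | x :: L => IsNumbering G m L ∧ x ∉ L ∧ m x ∈ x :: L ∧ m x ∈ closedNbhd G x ∧
      (∀ w ∈ closedNbhd G x, ∀ y ∈ closedNbhd G w, y ∈ x :: L → y ∈ closedNbhd G (m x)) ∧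
      (m x = x → ∀ y ∈ L, ¬ G.Adj x y)

theorem IsNumbering.nodup : ∀ {L : List V}, IsNumbering G m L → L.Nodup
  | [], _ => List.nodup_nil
  | _ :: _, h => List.nodup_cons.2 ⟨h.2.1, h.1.nodup⟩

theorem IsNumbering.drop : ∀ {L : List V}, IsNumbering G m L → ∀ i, IsNumbering G m (L.drop i)
  | [], _, i => by simp [IsNumbering]
  | _ :: _, h, 0 => h
  | _ :: _, h, i + 1 => h.1.drop i

theorem IsNumbering.congr {m' : V → V} : ∀ {L : List V}, IsNumbering G m L →
    (∀ x ∈ L, m' x = m x) → IsNumbering G m' L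
  | [], _, _ => trivial
  | x :: L, h, hm => by
    have hx := hm x (by simp)
    refine ⟨h.1.congr fun y hy => hm y (by simp [hy]), ?_⟩
    rw [hx]
    exact h.2

theorem IsNumbering.isAdmissible [DecidableEq V] (h : IsNumbering G m L) (hL : ∀ x, x ∈ L) :
    IsAdmissible G (h.nodup.getEquivOfForallMemList L hL)
      (fun i => m (h.nodup.getEquivOfForallMemList L hL i)) := by
  set σ := h.nodup.getEquivOfForallMemList L hL with hσ
  have hget : ∀ i, σ i = L[(i : ℕ)] := fun i => rfl
  have hmem : ∀ (i : Fin L.length) v, i ≤ σ.symm v ↔ v ∈ L.drop i := by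
    intro i v
    obtain ⟨j, rfl⟩ := σ.surjective v
    rw [Equiv.symm_apply_apply, hget]
    constructor
    · intro hij
      rw [List.mem_drop_iff_getElem]
      exact ⟨j - i, by omega, by congr 1; have : (i : ℕ) ≤ j := hij; omega⟩
    · intro hv
      rw [List.mem_drop_iff_getElem] at hv
      obtain ⟨k, hk, hk'⟩ := hv
      have := (h.nodup.getElem_inj_iff).1 hk'
      exact Fin.le_def.2 (by omega)
  have hdrop : ∀ i : Fin L.length, L.drop i = σ i :: L.drop (i + 1) := fun i => by
    rw [hget, List.cons_getElem_drop_succ]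
  have hcond : ∀ i : Fin L.length, IsNumbering G m (σ i :: L.drop (i + 1)) := fun i => by
    rw [← hdrop]; exact h.drop i
  have hlater : ∀ (i : Fin L.length) v, i < σ.symm v → v ∈ L.drop (i + 1) := by
    intro i v hv
    have h1 := (hmem i v).1 hv.le
    rw [hdrop] at h1
    rcases List.mem_cons.1 h1 with rfl | h1
    · simp at hv
    · exact h1
  refine ⟨fun i => isMaximumNeighborAt_iff.2 ?_, fun i => ?_, fun i => ?_⟩
  · obtain ⟨_, _, h1, h2, h3, _⟩ := hcond i
    rw [← hdrop] at h1 h3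
    exact ⟨(hmem _ _).2 h1, h2, fun w hw _ y hy hiy => h3 w hw y hy ((hmem _ _).1 hiy)⟩
  · obtain ⟨_, _, _, h2, h3, _⟩ := hcond i
    have hsq : ∀ v, i < σ.symm v → (square G).Adj (σ i) v → v ∈ closedNbhd G (m (σ i)) := by
      rintro v hv ⟨_, hadj | ⟨z, hz, hz'⟩⟩
      · exact h3 v (Or.inr hadj) v (Or.inl rfl) (List.mem_cons_of_mem _ (hlater i v hv))
      · exact h3 z (Or.inr hz) v (Or.inr hz') (List.mem_cons_of_mem _ (hlater i v hv))
    intro a ha b hb hab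
    refine ⟨hab, ?_⟩
    rcases hsq a ha.1 ha.2 with ha' | ha'
    · rcases hsq b hb.1 hb.2 with hb' | hb'
      · exact absurd (ha'.trans hb'.symm) hab
      · exact Or.inl (ha' ▸ hb')
    · rcases hsq b hb.1 hb.2 with hb' | hb'
      · exact Or.inl (hb' ▸ ha'.symm)
      · exact Or.inr ⟨_, ha'.symm, hb'⟩
  · rintro ⟨j, hij, hadj⟩ hm
    obtain ⟨_, _, _, _, _, h4⟩ := hcond i
    exact h4 hm (σ j) (hlater i _ (by simpa using hij)) hadj

end Numbering

/-! ### Correctness of the two loops -/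

section Loops

theorem foldl_finRange_induction {α : Type*} {n : ℕ} {f : α → Fin n → α} {a : α}
    (P : ℕ → α → Prop) (h0 : P 0 a) (hs : ∀ (i : Fin n) a, P i a → P (i + 1) (f a i)) :
    P n ((List.finRange n).foldl f a) := by
  have key : ∀ k ≤ n, P k (((List.finRange n).take k).foldl f a) := by
    intro k
    induction k with
    | zero => intro _; simpa using h0
    | succ k ih =>
      intro hk
      rw [List.take_add_one, List.foldl_append]
      have := hs ⟨k, hk⟩ _ (ih (by omega))
      simpa [List.getElem?_eq_getElem (show k < (List.finRange n).length by simpa using hk)]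
        using this
  have := key n le_rfl
  rwa [List.take_of_length_le (by simp)] at this

theorem foldl_finRange_reverse_induction {α : Type*} {n : ℕ} {f : α → Fin n → α} {a : α}
    (P : ℕ → α → Prop) (h0 : P n a) (hs : ∀ (i : Fin n) a, P (i + 1) a → P i (f a i)) :
    P 0 ((List.finRange n).reverse.foldl f a) := by
  rw [List.foldl_reverse]
  have key : ∀ k ≤ n, P (n - k) (((List.finRange n).drop (n - k)).foldr (fun x y => f y x) a) := by
    intro k
    induction k with
    | zero => intro _; simpa [List.drop_of_length_le] using h0
    | succ k ih =>
      intro hk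
      have hlt : n - (k + 1) < (List.finRange n).length := by simp; omega
      have := hs ⟨n - (k + 1), by omega⟩ _
        (by simpa [show n - (k + 1) + 1 = n - k by omega] using ih (by omega))
      rw [List.drop_eq_getElem_cons hlt]
      simpa [show n - (k + 1) + 1 = n - k by omega] using this
  simpa using key n le_rfl

variable {V : Type u} {G : SimpleGraph V} {n : ℕ} {σ : Fin n ≃ V} {m : Fin n → V}

/-- A later vertex at distance at most `2` from `σ i` is adjacent to `m i`: a common neighbor that
precedes `σ i` can be replaced by its own maximum neighbor, which comes later. -/
theorem IsAdmissible.mem_closedNbhd (h : IsAdmissible G σ m) {i l : Fin n} (hil : i < l) {z : V}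
    (hzi : z ∈ closedNbhd G (σ i)) (hzl : z ∈ closedNbhd G (σ l)) :
    m i ∈ closedNbhd G (σ l) := by
  induction hk : n - (σ.symm z : ℕ) using Nat.strong_induction_on generalizing z with
  | _ k ih =>
  by_cases hz : i ≤ σ.symm z
  · have := (isMaximumNeighborAt_iff.1 (h.maximumNeighbor i)).2.2 z hzi hz (σ l)
      (mem_closedNbhd_comm.1 hzl) (by simpa using hil.le)
    exact mem_closedNbhd_comm.1 this
  · push Not at hz
    obtain ⟨q, rfl⟩ := σ.surjective z
    rw [Equiv.symm_apply_apply] at hz hk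
    obtain ⟨hq1, hq2, hq3⟩ := isMaximumNeighborAt_iff.1 (h.maximumNeighbor q)
    have hi := hq3 (σ q) (self_mem_closedNbhd _) (by simp) (σ i) (mem_closedNbhd_comm.1 hzi)
      (by simpa using hz.le)
    have hl := hq3 (σ q) (self_mem_closedNbhd _) (by simp) (σ l) (mem_closedNbhd_comm.1 hzl)
      (by simpa using (hz.trans hil).le)
    have hne : m q ≠ σ q := by
      refine h.ne q ⟨i, hz, ?_⟩
      rcases mem_closedNbhd_comm.1 hzi with e | e
      · exact absurd (σ.injective e) hz.ne'
      · exact e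
    have hlt : q < σ.symm (m q) := lt_of_le_of_ne hq1 fun e => hne (by
      rw [eq_comm, Equiv.symm_apply_eq] at e; exact e)
    refine ih _ ?_ (mem_closedNbhd_comm.1 hi) (mem_closedNbhd_comm.1 hl) rfl
    have := (σ.symm (m q)).2
    have : (q : ℕ) < σ.symm (m q) := hlt
    omega

variable [Fintype V] [DecidableEq V] [DecidableRel G.Adj]

theorem mem_nbhd {v x : V} : x ∈ nbhd G v ↔ x ∈ closedNbhd G v := by
  simp [nbhd, closedNbhd]

/-- The state after the first loop. -/
def markResult (G : SimpleGraph V) [DecidableRel G.Adj] (σ : Fin n ≃ V) (m : Fin n → V)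
    (ω : V → ℤ) : MarkState V :=
  (List.finRange n).foldl (fun s i => markStep G (σ i) (m i) s)
    { omega := ω, omegaP := fun _ => 0, marked := ∅ }

/-- The state after the second loop. -/
def selectResult (G : SimpleGraph V) [DecidableRel G.Adj] (σ : Fin n ≃ V) (m : Fin n → V)
    (marked : Finset V) : SelectState V :=
  (List.finRange n).reverse.foldl (fun s i => selectStep G marked (σ i) (m i) s)
    { chosen := ∅, blocked := ∅ }

/-- The result `y` of the first loop is a feasible dual solution: the weight of each vertex is
`y` of that vertex plus the sum of all positive earlier `y` that are charged to it. -/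
theorem markResult_spec (ω : V → ℤ) :
    (∀ v, v ∈ (markResult G σ m ω).marked ↔ 0 < (markResult G σ m ω).omega v) ∧
    ∀ i, ω (σ i) = (markResult G σ m ω).omega (σ i) +
      ∑ j, if j < i ∧ σ j ∈ (markResult G σ m ω).marked ∧ m j ∈ nbhd G (σ i) then
        (markResult G σ m ω).omega (σ j) else 0 := by
  have key := foldl_finRange_induction (n := n)
    (f := fun s i => markStep G (σ i) (m i) s)
    (a := { omega := ω, omegaP := fun _ => 0, marked := ∅ })
    (fun k s =>
      (∀ j : Fin n, k ≤ j → s.omega (σ j) = ω (σ j) ∧ σ j ∉ s.marked) ∧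
      (∀ j : Fin n, (j : ℕ) < k → (σ j ∈ s.marked ↔ 0 < s.omega (σ j))) ∧
      (∀ u, s.omegaP u = ∑ j, if σ j ∈ s.marked ∧ m j = u then s.omega (σ j) else 0) ∧
      ∀ i : Fin n, (i : ℕ) < k → ω (σ i) = s.omega (σ i) +
        ∑ j, if j < i ∧ σ j ∈ s.marked ∧ m j ∈ nbhd G (σ i) then s.omega (σ j) else 0)
    ?_ ?_
  · obtain ⟨_, h1, _, h2⟩ := key
    refine ⟨fun v => ?_, fun i => h2 i i.2⟩
    obtain ⟨j, rfl⟩ := σ.surjective v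
    exact h1 j j.2
  · simp
  · rintro i s ⟨h1, h2, h3, h4⟩
    set x : ℤ := s.omega (σ i) - ∑ y ∈ nbhd G (σ i), s.omegaP y with hx
    have hom : (markStep G (σ i) (m i) s).omega = Function.update s.omega (σ i) x := by
      unfold markStep; dsimp only; split_ifs <;> rfl
    have hmk : ∀ v, v ∈ (markStep G (σ i) (m i) s).marked ↔
        v ∈ s.marked ∨ (v = σ i ∧ 0 < x) := by
      intro v; unfold markStep
      by_cases hx0 : 0 < x
      · simp only [← hx, if_pos hx0]; simp [hx0, or_comm]
      · simp only [← hx, if_neg hx0]; simp [hx0]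
    have hP : ∀ u, (markStep G (σ i) (m i) s).omegaP u =
        s.omegaP u + if m i = u ∧ 0 < x then x else 0 := by
      intro u; unfold markStep
      by_cases hx0 : 0 < x
      · simp only [← hx, if_pos hx0]
        by_cases hu : m i = u
        · subst hu; simp [hx0]
        · simp [hu, Function.update_of_ne (Ne.symm hu)]
      · simp only [← hx, if_neg hx0]; simp [hx0]
    have hne : ∀ j, j ≠ i → Function.update s.omega (σ i) x (σ j) = s.omega (σ j) :=
      fun j hj => Function.update_of_ne (fun e => hj (σ.injective e)) _ _
    have hmk' : ∀ j, j ≠ i → (σ j ∈ (markStep G (σ i) (m i) s).marked ↔ σ j ∈ s.marked) := by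
      intro j hj; rw [hmk]; simp [hj]
    have hmki : σ i ∈ (markStep G (σ i) (m i) s).marked ↔ 0 < x := by
      rw [hmk]; simp [(h1 i le_rfl).2]
    refine ⟨fun j hj => ?_, fun j hj => ?_, fun u => ?_, fun j hj => ?_⟩
    · have hji : j ≠ i := by rintro rfl; omega
      rw [hom, hne j hji, hmk' j hji]
      exact h1 j (by omega)
    · by_cases hji : j = i
      · subst hji; rw [hmki, hom]; simp
      · rw [hom, hne j hji, hmk' j hji]
        exact h2 j (by have := Fin.val_ne_of_ne hji; omega)
    · rw [hP, h3, ← Finset.add_sum_erase _ _ (Finset.mem_univ i),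
        ← Finset.add_sum_erase (Finset.univ : Finset (Fin n)) (fun j =>
          if σ j ∈ (markStep G (σ i) (m i) s).marked ∧ m j = u then
            (markStep G (σ i) (m i) s).omega (σ j) else 0) (Finset.mem_univ i)]
      have : ∀ j ∈ Finset.univ.erase i,
          (if σ j ∈ (markStep G (σ i) (m i) s).marked ∧ m j = u then
            (markStep G (σ i) (m i) s).omega (σ j) else 0) =
          if σ j ∈ s.marked ∧ m j = u then s.omega (σ j) else 0 := by
        intro j hj
        have hji := Finset.ne_of_mem_erase hj
        rw [hom, hne j hji]
        simp only [hmk' j hji]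
      rw [Finset.sum_congr rfl this]
      simp only [hmki, hom, (h1 i le_rfl).2, false_and, if_false, Function.update_self]
      simp only [and_comm]
      ring
    · have hsum : ∀ j : Fin n, j ≤ i →
          (∑ l, if l < j ∧ σ l ∈ (markStep G (σ i) (m i) s).marked ∧ m l ∈ nbhd G (σ j) then
            (markStep G (σ i) (m i) s).omega (σ l) else 0) =
          ∑ l, if l < j ∧ σ l ∈ s.marked ∧ m l ∈ nbhd G (σ j) then s.omega (σ l) else 0 := by
        intro j hji
        refine Finset.sum_congr rfl fun l _ => ?_
        by_cases hlj : l < j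
        · have hli : l ≠ i := by rintro rfl; exact absurd hlj (not_lt.2 hji)
          rw [hom, hne l hli]
          simp only [hmk' l hli]
        · simp [hlj]
      by_cases hji : j = i
      · subst hji
        rw [hsum j le_rfl, hom, Function.update_self, hx, (h1 j le_rfl).1]
        simp only [h3]
        rw [Finset.sum_comm]
        have : ∀ l, (∑ y ∈ nbhd G (σ j), if σ l ∈ s.marked ∧ m l = y then s.omega (σ l) else 0)
            = if l < j ∧ σ l ∈ s.marked ∧ m l ∈ nbhd G (σ j) then s.omega (σ l) else 0 := by
          intro l
          by_cases hl : σ l ∈ s.marked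
          · have hlj : l < j := by
              by_contra hlj
              exact (h1 l (by simpa using hlj)).2 hl
            simp [hl, hlj]
          · simp [hl]
        simp only [this]
        ring
      · have hlt : j < i := by
          have := Fin.val_ne_of_ne hji
          exact Fin.lt_def.2 (by omega)
        rw [hsum j hlt.le, hom, hne j hji]
        exact h4 j hlt

/-- The second loop picks a packing of closed neighborhoods, and every marked vertex is charged to
one of the chosen ones. -/
theorem selectResult_spec (h : IsAdmissible G σ m) (marked : Finset V) :
    (selectResult G σ m marked).chosen ⊆ marked ∧
    ((selectResult G σ m marked).chosen : Set V).PairwiseDisjoint (nbhd G) ∧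
    ∀ j, σ j ∈ marked → ∃ i, j ≤ i ∧ σ i ∈ (selectResult G σ m marked).chosen ∧
      m j ∈ nbhd G (σ i) := by
  have key := foldl_finRange_reverse_induction (n := n)
    (f := fun s i => selectStep G marked (σ i) (m i) s)
    (a := { chosen := ∅, blocked := ∅ })
    (fun k s => (∀ v ∈ s.chosen, v ∈ marked ∧ k ≤ (σ.symm v : ℕ)) ∧
      (∀ x, x ∈ s.blocked ↔ ∃ d ∈ s.chosen, x ∈ nbhd G d) ∧
      (s.chosen : Set V).PairwiseDisjoint (nbhd G) ∧
      ∀ j : Fin n, k ≤ j → σ j ∈ marked → ∃ i, j ≤ i ∧ σ i ∈ s.chosen ∧ m j ∈ nbhd G (σ i))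
    ?_ ?_
  · obtain ⟨h1, _, h2, h3⟩ := key
    exact ⟨fun v hv => (h1 v hv).1, h2, fun j => h3 j (Nat.zero_le _)⟩
  · refine ⟨by simp, by simp, by simp, fun j hj => ?_⟩
    have := j.2
    omega
  · rintro i s ⟨h1, h2, h3, h4⟩
    have hmi : m i ∈ nbhd G (σ i) :=
      mem_nbhd.2 (isMaximumNeighborAt_iff.1 (h.maximumNeighbor i)).2.1
    unfold selectStep
    split_ifs with hc
    · refine ⟨?_, ?_, ?_, ?_⟩
      · intro v hv
        rcases Finset.mem_insert.1 hv with rfl | hv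
        · simp [hc.1]
        · have := h1 v hv
          exact ⟨this.1, by omega⟩
      · intro x
        simp [h2, or_comm]
      · rw [Finset.coe_insert]
        refine h3.insert fun d hd _ => ?_
        rw [Finset.disjoint_left]
        intro z hz hz'
        apply hc.2
        obtain ⟨l, rfl⟩ := σ.surjective d
        refine (h2 _).2 ⟨σ l, hd, mem_nbhd.2 (h.mem_closedNbhd ?_ (mem_nbhd.1 hz)
          (mem_nbhd.1 hz'))⟩
        have := (h1 _ hd).2
        rw [Equiv.symm_apply_apply] at this
        exact Fin.lt_def.2 this
      · intro j hj hjm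
        by_cases hji : j = i
        · subst hji
          exact ⟨j, le_rfl, by simp, hmi⟩
        · obtain ⟨i', a, b, c⟩ := h4 j (by have := Fin.val_ne_of_ne hji; omega) hjm
          exact ⟨i', a, by simp [b], c⟩
    · refine ⟨fun v hv => ⟨(h1 v hv).1, by have := (h1 v hv).2; omega⟩, h2, h3, ?_⟩
      intro j hj hjm
      by_cases hji : j = i
      · subst hji
        have hb : m j ∈ s.blocked := by
          by_contra hb
          exact hc ⟨hjm, hb⟩
        obtain ⟨d, hd, hd'⟩ := (h2 _).1 hb
        obtain ⟨l, rfl⟩ := σ.surjective d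
        have := (h1 _ hd).2
        rw [Equiv.symm_apply_apply] at this
        exact ⟨l, Fin.le_def.2 (by omega), hd, hd'⟩
      · exact h4 j (by have := Fin.val_ne_of_ne hji; omega) hjm

/-- The two loops find a packing of closed neighborhoods of largest weight. -/
theorem sum_le_sum_selectResult (h : IsAdmissible G σ m) (ω : V → ℤ) {I : Finset V}
    (hI : (I : Set V).PairwiseDisjoint (nbhd G)) :
    ∑ v ∈ I, ω v ≤ ∑ v ∈ (selectResult G σ m (markResult G σ m ω).marked).chosen, ω v := by
  obtain ⟨hM, hω⟩ := markResult_spec (G := G) (σ := σ) (m := m) ω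
  set s := markResult G σ m ω with hs
  obtain ⟨hD1, -, hD3⟩ := selectResult_spec h s.marked
  set D := (selectResult G σ m s.marked).chosen with hD
  have hmi : ∀ i, m i ∈ nbhd G (σ i) := fun i =>
    mem_nbhd.2 (isMaximumNeighborAt_iff.1 (h.maximumNeighbor i)).2.1
  have hsum : ∀ i, (∑ j, if j ≤ i ∧ σ j ∈ s.marked ∧ m j ∈ nbhd G (σ i) then
      s.omega (σ j) else 0) = (if σ i ∈ s.marked then s.omega (σ i) else 0) +
      ∑ j, if j < i ∧ σ j ∈ s.marked ∧ m j ∈ nbhd G (σ i) then s.omega (σ j) else 0 := by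
    intro i
    rw [← Finset.add_sum_erase _ _ (Finset.mem_univ i), ← Finset.add_sum_erase
      (Finset.univ : Finset (Fin n)) (fun j => if j < i ∧ σ j ∈ s.marked ∧ m j ∈ nbhd G (σ i) then
        s.omega (σ j) else 0) (Finset.mem_univ i)]
    have : ∀ j ∈ Finset.univ.erase i,
        (if j ≤ i ∧ σ j ∈ s.marked ∧ m j ∈ nbhd G (σ i) then s.omega (σ j) else 0) =
        if j < i ∧ σ j ∈ s.marked ∧ m j ∈ nbhd G (σ i) then s.omega (σ j) else 0 := by
      intro j hj
      simp only [le_iff_lt_or_eq, Finset.ne_of_mem_erase hj, or_false]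
    rw [Finset.sum_congr rfl this]
    simp [hmi]
  have hsplit : ∀ I : Finset V, ∑ v ∈ I, ω v = ∑ i, if σ i ∈ I then ω (σ i) else 0 := by
    intro I
    rw [Equiv.sum_comp σ (fun v => if v ∈ I then ω v else 0)]
    simp
  -- dual feasibility, and complementary slackness at the marked vertices
  have hle : ∀ i, ω (σ i) ≤ ∑ j, if j ≤ i ∧ σ j ∈ s.marked ∧ m j ∈ nbhd G (σ i) then
      s.omega (σ j) else 0 := by
    intro i
    rw [hsum, hω i]
    by_cases hi : σ i ∈ s.marked
    · simp [hi]
    · have := mt (hM (σ i)).2 hi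
      simp only [hi, if_false]
      linarith
  have heq : ∀ i, σ i ∈ s.marked → ω (σ i) =
      ∑ j, if j ≤ i ∧ σ j ∈ s.marked ∧ m j ∈ nbhd G (σ i) then s.omega (σ j) else 0 := by
    intro i hi
    rw [hsum, hω i, if_pos hi]
  calc ∑ v ∈ I, ω v
      = ∑ i, if σ i ∈ I then ω (σ i) else 0 := hsplit I
    _ ≤ ∑ i, if σ i ∈ I then (∑ j, if j ≤ i ∧ σ j ∈ s.marked ∧ m j ∈ nbhd G (σ i) then
          s.omega (σ j) else 0) else 0 := by
        refine Finset.sum_le_sum fun i _ => ?_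
        split_ifs
        · exact hle i
        · exact le_rfl
    _ = ∑ j, ∑ i, if σ i ∈ I ∧ j ≤ i ∧ σ j ∈ s.marked ∧ m j ∈ nbhd G (σ i) then
          s.omega (σ j) else 0 := by
        rw [Finset.sum_comm]
        refine Finset.sum_congr rfl fun i _ => ?_
        by_cases hi : σ i ∈ I <;> simp [hi]
    _ ≤ ∑ j, if σ j ∈ s.marked then s.omega (σ j) else 0 := by
        refine Finset.sum_le_sum fun j _ => ?_
        by_cases hj : σ j ∈ s.marked
        · rw [if_pos hj]
          by_cases hex : ∃ i, σ i ∈ I ∧ m j ∈ nbhd G (σ i)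
          · -- `m j` lies in at most one of the closed neighborhoods
            obtain ⟨i, hi, hmj⟩ := hex
            rw [Finset.sum_eq_single i]
            · split_ifs
              · exact le_rfl
              · exact ((hM _).1 hj).le
            · intro i' _ hi'
              rw [if_neg]
              rintro ⟨hi'I, _, _, hmj'⟩
              exact Finset.disjoint_left.1 (hI hi'I hi (fun e => hi' (σ.injective e))) hmj' hmj
            · simp
          · push Not at hex
            rw [Finset.sum_eq_zero]
            · exact ((hM _).1 hj).le
            · intro i _
              rw [if_neg]
              rintro ⟨a, _, _, b⟩
              exact hex i a b
        · simp [hj]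
    _ ≤ ∑ j, ∑ i, if σ i ∈ D ∧ j ≤ i ∧ σ j ∈ s.marked ∧ m j ∈ nbhd G (σ i) then
          s.omega (σ j) else 0 := by
        refine Finset.sum_le_sum fun j _ => ?_
        by_cases hj : σ j ∈ s.marked
        · obtain ⟨i, hji, hi, hmj⟩ := hD3 j hj
          rw [if_pos hj]
          have := Finset.single_le_sum (s := (Finset.univ : Finset (Fin n)))
            (f := fun i => if σ i ∈ D ∧ j ≤ i ∧ σ j ∈ s.marked ∧ m j ∈ nbhd G (σ i) then
              s.omega (σ j) else 0) (fun i _ => by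
                split_ifs
                · exact ((hM _).1 hj).le
                · exact le_rfl) (Finset.mem_univ i)
          simpa [hi, hji, hj, hmj] using this
        · simp [hj]
    _ = ∑ i, if σ i ∈ D then ω (σ i) else 0 := by
        rw [Finset.sum_comm]
        refine Finset.sum_congr rfl fun i _ => ?_
        by_cases hi : σ i ∈ D
        · rw [if_pos hi, heq i (hD1 hi)]
          simp [hi]
        · simp [hi]
    _ = ∑ v ∈ D, ω v := (hsplit D).symm

end Loops

/-! ### Correctness of the algorithm -/

section Correctness

variable {V : Type u} {G : SimpleGraph V}

/-- All efficient dominating sets have the same size. -/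
theorem IsEfficientDominatingSet.card_le {D D' : Finset V} (h : IsEfficientDominatingSet G D)
    (h' : IsEfficientDominatingSet G D') : D.card ≤ D'.card := by
  choose f hf _ using fun v => h' v
  refine Finset.card_le_card_of_injOn f (fun v _ => (hf v).1) fun a ha b hb hab => ?_
  obtain ⟨_, _, huniq⟩ := h (f a)
  rw [huniq a ⟨ha, mem_closedNbhd_comm.1 (hf a).2⟩,
    huniq b ⟨hb, hab ▸ mem_closedNbhd_comm.1 (hf b).2⟩]

theorem univ_fold_min_le [Fintype V] (w : V → ℤ) (k : ℤ) :
    Finset.univ.fold min k w ≤ k ∧ ∀ v, Finset.univ.fold min k w ≤ w v := by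
  have := (Finset.le_fold_min (s := (Finset.univ : Finset V)) (f := w) (b := k)
    (Finset.univ.fold min k w)).1 le_rfl
  exact ⟨this.1, fun v => this.2 v (Finset.mem_univ v)⟩

variable [Fintype V] [DecidableEq V] [DecidableRel G.Adj]

theorem isEfficientDominatingSet_iff {D : Finset V} : IsEfficientDominatingSet G D ↔
    (D : Set V).PairwiseDisjoint (nbhd G) ∧ Fintype.card V ≤ ∑ v ∈ D, (nbhd G v).card := by
  constructor
  · intro h
    have hd : (D : Set V).PairwiseDisjoint (nbhd G) := by
      intro a ha b hb hab
      refine Finset.disjoint_left.2 fun x hxa hxb => hab ?_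
      exact (h x).unique ⟨ha, mem_nbhd.1 hxa⟩ ⟨hb, mem_nbhd.1 hxb⟩
    refine ⟨hd, ?_⟩
    rw [← Finset.card_biUnion hd, ← Finset.card_univ]
    refine Finset.card_le_card fun x _ => ?_
    obtain ⟨d, ⟨hd, hx⟩, _⟩ := h x
    exact Finset.mem_biUnion.2 ⟨d, hd, mem_nbhd.2 hx⟩
  · rintro ⟨hd, hc⟩ v
    rw [← Finset.card_biUnion hd] at hc
    have huniv := (Finset.card_eq_iff_eq_univ _).1 (le_antisymm (Finset.card_le_univ _) hc)
    obtain ⟨d, hdD, hv⟩ := Finset.mem_biUnion.1 (huniv ▸ Finset.mem_univ v)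
    refine ⟨d, ⟨hdD, mem_nbhd.1 hv⟩, fun d' hd' => ?_⟩
    by_contra hne
    exact Finset.disjoint_left.1 (hd hd'.1 hdD hne) (mem_nbhd.2 hd'.2) hv

variable {n : ℕ} {σ : Fin n ≃ V} {m : Fin n → V}

theorem mainPart_eq (w : V → ℤ) (k : ℤ) : mainPart G σ m w k =
    if (max (∑ x, w x) k + 1) * (Fintype.card V : ℤ) - k ≤
      ∑ v ∈ (selectResult G σ m (markResult G σ m fun v =>
        (max (∑ x, w x) k + 1) * ((nbhd G v).card : ℤ) - w v).marked).chosen,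
        ((max (∑ x, w x) k + 1) * ((nbhd G v).card : ℤ) - w v)
    then some (selectResult G σ m (markResult G σ m fun v =>
        (max (∑ x, w x) k + 1) * ((nbhd G v).card : ℤ) - w v).marked).chosen
    else none := rfl

/-- For nonnegative weights: as `M` exceeds all weights and `k`, a packing has weight at least
`M * |V| - k` exactly if it covers all vertices and has original weight at most `k`. -/
theorem mainPart_correct (h : IsAdmissible G σ m) {w : V → ℤ} (hw : ∀ v, 0 ≤ w v) (k : ℤ) :
    IsMinWEDAnswer G w k (mainPart G σ m w k) := by
  rw [mainPart_eq]
  set M : ℤ := max (∑ x, w x) k + 1 with hM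
  have hMk : k < M := by have := le_max_right (∑ x, w x) k; omega
  have hMw : ∑ x, w x < M := by have := le_max_left (∑ x, w x) k; omega
  have hM0 : 0 < M := lt_of_le_of_lt (Finset.sum_nonneg fun v _ => hw v) hMw
  set ω : V → ℤ := fun v => M * ((nbhd G v).card : ℤ) - w v with hω
  have hsum : ∀ D : Finset V, ∑ v ∈ D, (M * ((nbhd G v).card : ℤ) - w v) =
      M * ((∑ v ∈ D, (nbhd G v).card : ℕ) : ℤ) - ∑ v ∈ D, w v := by
    intro D
    rw [Finset.sum_sub_distrib, ← Finset.mul_sum]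
    push_cast
    rfl
  set D := (selectResult G σ m (markResult G σ m ω).marked).chosen with hD
  have hdisj := (selectResult_spec h (markResult G σ m ω).marked).2.1
  split_ifs with hc
  · rw [hsum] at hc
    have hcard : Fintype.card V ≤ ∑ v ∈ D, (nbhd G v).card := by
      by_contra hlt
      push Not at hlt
      have h1 : ((∑ v ∈ D, (nbhd G v).card : ℕ) : ℤ) + 1 ≤ (Fintype.card V : ℤ) := by
        exact_mod_cast hlt
      have h2 := mul_le_mul_of_nonneg_left h1 hM0.le
      have h3 := Finset.sum_nonneg fun v (_ : v ∈ D) => hw v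
      linarith
    refine ⟨isEfficientDominatingSet_iff.2 ⟨hdisj, hcard⟩, ?_⟩
    have hle : ∑ v ∈ D, (nbhd G v).card ≤ Fintype.card V := by
      rw [← Finset.card_biUnion hdisj]
      exact Finset.card_le_univ _
    have h1 : ((∑ v ∈ D, (nbhd G v).card : ℕ) : ℤ) ≤ (Fintype.card V : ℤ) := by exact_mod_cast hle
    have h2 := mul_le_mul_of_nonneg_left h1 hM0.le
    linarith
  · rintro ⟨I, hI, hIk⟩
    apply hc
    obtain ⟨hId, hIc⟩ := isEfficientDominatingSet_iff.1 hI
    refine le_trans ?_ (sum_le_sum_selectResult h ω hId)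
    rw [hsum I]
    have h1 : (Fintype.card V : ℤ) ≤ ((∑ v ∈ I, (nbhd G v).card : ℕ) : ℤ) := by exact_mod_cast hIc
    have h2 := mul_le_mul_of_nonneg_left h1 hM0.le
    linarith

/-- Adding a constant to all weights changes the weights of all efficient dominating sets by the
same amount, as these have the same size. -/
theorem minWEDAlgorithm_correct (h : IsAdmissible G σ m) {ed : Option (Finset V)}
    (hed : IsEDAnswer G ed) (w : V → ℤ) (k : ℤ) :
    IsMinWEDAnswer G w k (minWEDAlgorithm G ed σ m w k) := by
  unfold minWEDAlgorithm
  obtain ⟨-, hμ⟩ := univ_fold_min_le w k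
  set μ := Finset.univ.fold min k w
  dsimp only
  split_ifs with hneg
  · cases ed with
    | none => exact fun ⟨D, hD, _⟩ => hed ⟨D, hD⟩
    | some D₀ =>
      have hcorr := mainPart_correct h (w := fun v => w v + |μ|)
        (fun v => by have := hμ v; rw [abs_of_neg hneg]; linarith) (k + |μ| * (D₀.card : ℤ))
      have hsum : ∀ D, IsEfficientDominatingSet G D →
          ∑ v ∈ D, (w v + |μ|) = ∑ v ∈ D, w v + |μ| * (D₀.card : ℤ) := by
        intro D hD
        have hc : D.card = D₀.card :=
          le_antisymm (hD.card_le hed) (IsEfficientDominatingSet.card_le hed hD)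
        rw [Finset.sum_add_distrib, Finset.sum_const, hc, nsmul_eq_mul, mul_comm]
      dsimp only
      cases hres : mainPart G σ m (fun v => w v + |μ|) (k + |μ| * (D₀.card : ℤ)) with
      | none =>
        rw [hres] at hcorr
        rintro ⟨D, hD, hk⟩
        exact hcorr ⟨D, hD, by rw [hsum D hD]; linarith⟩
      | some D =>
        rw [hres] at hcorr
        refine ⟨hcorr.1, ?_⟩
        have := hcorr.2
        rw [hsum D hcorr.1] at this
        linarith
  · exact mainPart_correct h (fun v => by have := hμ v; linarith) k

theorem IsAlgorithmResult.isMinWEDAnswer {w : V → ℤ} {k : ℤ} {out : Option (Finset V)}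
    (h : IsAlgorithmResult G w k out) : IsMinWEDAnswer G w k out := by
  obtain ⟨ed, n, σ, m, hed, hσ, rfl⟩ := h
  exact minWEDAlgorithm_correct hσ hed w k

end Correctness

/-! ### Reasoning about programs -/

/-- Sequential composition of programs. -/
infixr:60 "⨾" => Program.seq

/-- The register that an instruction may change. -/
def Instr.regs : Instr → List ℕ
  | .const x _ => [x]
  | .add x _ _ => [x]
  | .sub x _ _ => [x]
  | .load x _ _ => [x]
  | .store _ _ _ => []

/-- The array that an instruction may change. -/
def Instr.arrs : Instr → List ℕ
  | .store a _ _ => [a]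
  | _ => []

/-- The registers that a program may change. -/
def Program.regs : Program → List ℕ
  | .skip => []
  | .instr c => c.regs
  | .seq p q => p.regs ++ q.regs
  | .ite _ p q => p.regs ++ q.regs
  | .while _ p => p.regs

/-- The arrays that a program may change. -/
def Program.arrs : Program → List ℕ
  | .skip => []
  | .instr c => c.arrs
  | .seq p q => p.arrs ++ q.arrs
  | .ite _ p q => p.arrs ++ q.arrs
  | .while _ p => p.arrs

/-- The memories `s` and `s'` agree outside the registers in `R` and the arrays in `A`. -/
def SameExcept (R A : List ℕ) (s s' : Memory) : Prop :=
  (∀ x ∉ R, s'.reg x = s.reg x) ∧ ∀ a ∉ A, s'.arr a = s.arr a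

theorem SameExcept.refl (R A : List ℕ) (s : Memory) : SameExcept R A s s :=
  ⟨fun _ _ => rfl, fun _ _ => rfl⟩

theorem SameExcept.trans {R A : List ℕ} {s s' s'' : Memory} (h : SameExcept R A s s')
    (h' : SameExcept R A s' s'') : SameExcept R A s s'' :=
  ⟨fun x hx => (h'.1 x hx).trans (h.1 x hx), fun a ha => (h'.2 a ha).trans (h.2 a ha)⟩

theorem SameExcept.mono {R A R' A' : List ℕ} {s s' : Memory} (h : SameExcept R A s s')
    (hR : R ⊆ R') (hA : A ⊆ A') : SameExcept R' A' s s' :=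
  ⟨fun x hx => h.1 x fun h => hx (hR h), fun a ha => h.2 a fun h => ha (hA h)⟩

theorem Instr.sameExcept (c : Instr) (s : Memory) : SameExcept c.regs c.arrs s (c.apply s) := by
  cases c <;> constructor <;> intro x hx <;>
    simp_all [Instr.regs, Instr.arrs, Instr.apply, Function.update_of_ne]

theorem Exec.sameExcept {p : Program} {s s' : Memory} {t : ℕ} (h : Exec p s t s') :
    SameExcept p.regs p.arrs s s' := by
  induction h with
  | skip s => exact .refl _ _ _
  | instr c s => exact c.sameExcept s
  | seq _ _ ih₁ ih₂ =>
    exact (ih₁.mono (List.subset_append_left _ _) (List.subset_append_left _ _)).trans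
      (ih₂.mono (List.subset_append_right _ _) (List.subset_append_right _ _))
  | ite_pos _ _ ih => exact ih.mono (List.subset_append_left _ _) (List.subset_append_left _ _)
  | ite_neg _ _ ih => exact ih.mono (List.subset_append_right _ _) (List.subset_append_right _ _)
  | while_done => exact .refl _ _ _
  | while_step _ _ _ ih₁ ih₂ => exact ih₁.trans ih₂

/-- Started in `s`, the program `p` halts within `B` steps in a memory that satisfies `Q`. -/
def Runs (p : Program) (s : Memory) (B : ℕ) (Q : Memory → Prop) : Prop :=
  ∃ (t : ℕ) (s' : Memory), Exec p s t s' ∧ t ≤ B ∧ Q s'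

namespace Runs

variable {p q : Program} {s : Memory} {B B' B₁ B₂ : ℕ} {Q Q' : Memory → Prop} {x : ℕ}

theorem mono (h : Runs p s B Q) (hB : B ≤ B') (hQ : ∀ s', Q s' → Q' s') : Runs p s B' Q' := by
  obtain ⟨t, s', h, ht, hs⟩ := h
  exact ⟨t, s', h, ht.trans hB, hQ s' hs⟩

theorem frame (h : Runs p s B Q) :
    Runs p s B (fun s' => Q s' ∧ SameExcept p.regs p.arrs s s') := by
  obtain ⟨t, s', h, ht, hs⟩ := h
  exact ⟨t, s', h, ht, hs, h.sameExcept⟩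

theorem seq (h : Runs p s B₁ (fun s' => Runs q s' B₂ Q)) : Runs (p ⨾ q) s (B₁ + B₂) Q := by
  obtain ⟨t, s', h, ht, t', s'', h', ht', hs⟩ := h
  exact ⟨t + t', s'', h.seq h', by omega, hs⟩

theorem instr {c : Instr} (h : Q (c.apply s)) : Runs (.instr c) s 1 Q :=
  ⟨1, _, .instr c s, le_rfl, h⟩

theorem skip (h : Q s) : Runs .skip s 0 Q := ⟨0, _, .skip s, le_rfl, h⟩

theorem ite (hp : 0 < s.reg x → Runs p s B Q) (hq : s.reg x ≤ 0 → Runs q s B Q) :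
    Runs (.ite x p q) s (B + 1) Q := by
  by_cases h : 0 < s.reg x
  · obtain ⟨t, s', h', ht, hs⟩ := hp h
    exact ⟨t + 1, s', .ite_pos h h', by omega, hs⟩
  · obtain ⟨t, s', h', ht, hs⟩ := hq (not_lt.1 h)
    exact ⟨t + 1, s', .ite_neg (not_lt.1 h) h', by omega, hs⟩

/-- A loop whose passes are paid for by a decreasing potential `φ`. -/
theorem whilePos (I : ℕ → Memory → Prop)
    (h : ∀ φ s, I φ s → 0 < s.reg x →
      ∃ B, Runs p s B (fun s' => ∃ φ', B + 1 + φ' ≤ φ ∧ I φ' s')) :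
    ∀ φ s, I φ s → Runs (.while x p) s (φ + 1) (fun s' => (∃ φ', I φ' s') ∧ s'.reg x ≤ 0) := by
  intro φ
  induction φ using Nat.strong_induction_on with
  | _ φ ih =>
    intro s hs
    by_cases hx : 0 < s.reg x
    · obtain ⟨B, t, s', he, ht, φ', hB, hs'⟩ := h φ s hs hx
      obtain ⟨t', s'', he', ht', hs''⟩ := ih φ' (by omega) s' hs'
      exact ⟨t + t' + 1, s'', .while_step hx he he', by omega, hs''⟩
    · exact ⟨1, s, .while_done (not_lt.1 hx), by omega, ⟨φ, hs⟩, not_lt.1 hx⟩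

end Runs

/-! ### Straight-line programs -/

/-- Programs without loops. -/
def Program.IsStraight : Program → Bool
  | .skip => true
  | .instr _ => true
  | .seq p q => p.IsStraight && q.IsStraight
  | .ite _ p q => p.IsStraight && q.IsStraight
  | .while _ _ => false

/-- The effect of a program without loops. -/
def Program.run : Program → Memory → Memory
  | .skip, s => s
  | .instr c, s => c.apply s
  | .seq p q, s => q.run (p.run s)
  | .ite x p q, s => if 0 < s.reg x then p.run s else q.run s
  | .while _ _, s => s

/-- A bound on the running time of a program without loops. -/
def Program.cost : Program → ℕ
  | .skip => 0
  | .instr _ => 1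
  | .seq p q => p.cost + q.cost
  | .ite _ p q => max p.cost q.cost + 1
  | .while _ _ => 0

theorem Program.exec_run : ∀ {p : Program}, p.IsStraight = true → ∀ s,
    ∃ t ≤ p.cost, Exec p s t (p.run s)
  | .skip, _, s => ⟨0, le_rfl, .skip s⟩
  | .instr c, _, s => ⟨1, le_rfl, .instr c s⟩
  | .seq p q, h, s => by
    simp only [Program.IsStraight, Bool.and_eq_true] at h
    obtain ⟨t, ht, he⟩ := exec_run h.1 s
    obtain ⟨t', ht', he'⟩ := exec_run h.2 (p.run s)
    exact ⟨t + t', by simp only [Program.cost]; omega, he.seq he'⟩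
  | .ite x p q, h, s => by
    simp only [Program.IsStraight, Bool.and_eq_true] at h
    simp only [Program.run, Program.cost]
    split_ifs with hx
    · obtain ⟨t, ht, he⟩ := exec_run h.1 s
      exact ⟨t + 1, by omega, .ite_pos hx he⟩
    · obtain ⟨t, ht, he⟩ := exec_run h.2 s
      exact ⟨t + 1, by omega, .ite_neg (not_lt.1 hx) he⟩

theorem Runs.straight {p : Program} {s : Memory} {B : ℕ} {Q : Memory → Prop}
    (h : p.IsStraight = true) (hB : p.cost ≤ B) (hQ : Q (p.run s)) : Runs p s B Q := by
  obtain ⟨t, ht, he⟩ := Program.exec_run h s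
  exact ⟨t, _, he, ht.trans hB, hQ⟩

/-! ### Counting loops -/

/-- While `j < e` do `body` and increase `j`. Register `2` is used as scratch. -/
def Program.forLoop (j e : ℕ) (body : Program) : Program :=
  .instr (.sub 2 e j) ⨾
  .while 2 (body ⨾ .instr (.const 2 1) ⨾ .instr (.add j j 2) ⨾ .instr (.sub 2 e j))

/-- `P` does not depend on the registers in `R`. -/
def Ignores (R : List ℕ) (P : Memory → Prop) : Prop :=
  ∀ s s' : Memory, SameExcept R [] s s' → P s → P s'

theorem sum_Ico_eq_add {c : ℕ → ℕ} {k N : ℕ} (hk : k < N) :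
    ∑ i ∈ Finset.Ico k N, c i = c k + ∑ i ∈ Finset.Ico (k + 1) N, c i :=
  Finset.sum_eq_sum_Ico_succ_bot hk c

theorem Runs.forLoop {j e : ℕ} {body : Program} {s₀ : Memory} {a : ℤ} {N : ℕ}
    (I : ℕ → Memory → Prop) (c : ℕ → ℕ) (hne : [2, j, e].Nodup)
    (hj : j ∉ body.regs) (he : e ∉ body.regs) (hI : ∀ k, Ignores [2, j] (I k))
    (hj0 : s₀.reg j = a) (he0 : s₀.reg e = a + N) (h0 : I 0 s₀)
    (hbody : ∀ k < N, ∀ s, SameExcept (Program.forLoop j e body).regs body.arrs s₀ s →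
      s.reg j = a + k → I k s → Runs body s (c k) (I (k + 1))) :
    Runs (.forLoop j e body) s₀ (∑ k ∈ Finset.range N, (c k + 4) + 2) (I N) := by
  simp only [List.nodup_cons, List.mem_cons, List.not_mem_nil, or_false, not_or,
    List.nodup_nil, and_true, not_false_eq_true] at hne
  obtain ⟨⟨h2j, h2e⟩, hje⟩ := hne
  have hregs : (Program.forLoop j e body).regs = 2 :: (body.regs ++ [2, j, 2]) := rfl
  have hloop := Runs.whilePos (x := 2)
    (p := body ⨾ .instr (.const 2 1) ⨾ .instr (.add j j 2) ⨾ .instr (.sub 2 e j))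
    (fun φ s => ∃ k ≤ N, SameExcept (Program.forLoop j e body).regs body.arrs s₀ s ∧
      s.reg j = a + k ∧ s.reg 2 = N - k ∧ I k s ∧ φ = ∑ i ∈ Finset.Ico k N, (c i + 4)) ?_
  · refine (Runs.seq (B₁ := 1) (B₂ := ∑ k ∈ Finset.range N, (c k + 4) + 1)
      (Runs.instr ?_)).mono (by omega) fun _ h => h
    refine (hloop (∑ k ∈ Finset.range N, (c k + 4)) _ ⟨0, Nat.zero_le _, ?_, ?_, ?_, ?_, ?_⟩).mono
      le_rfl ?_
    · constructor
      · intro x hx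
        have : x ≠ 2 := by rintro rfl; exact hx (by simp [hregs])
        simp [Instr.apply, this]
      · intro x _; simp [Instr.apply]
    · simp [Instr.apply, Ne.symm h2j, hj0]
    · simp [Instr.apply, hj0, he0]
    · refine hI 0 s₀ _ ⟨fun x hx => ?_, fun _ _ => rfl⟩ h0
      simp only [List.mem_cons, not_or] at hx
      simp [Instr.apply, hx.1]
    · rw [Finset.range_eq_Ico]
    · rintro s ⟨⟨φ, k, hk, _, _, h2, hIk, _⟩, hs⟩
      have : k = N := by omega
      exact this ▸ hIk
  · rintro φ s ⟨k, hk, hsame, hsj, hs2, hIk, rfl⟩ hpos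
    have hkN : k < N := by omega
    refine ⟨c k + 3, ?_⟩
    · refine Runs.seq (B₂ := 3) ((hbody k hkN s hsame hsj hIk).frame.mono le_rfl ?_)
      rintro s' ⟨hI', hfr⟩
      refine Runs.straight (by rfl) (by simp [Program.cost]) ?_
      have hj' : s'.reg j = a + k := (hfr.1 j hj).trans hsj
      have he' : s'.reg e = a + N := by
        have := hsame.1 e (by simp [hregs, Ne.symm h2e, he, Ne.symm hje])
        rw [hfr.1 e he, this, he0]
      refine ⟨∑ i ∈ Finset.Ico (k + 1) N, (c i + 4),
        (sum_Ico_eq_add (c := fun i => c i + 4) hkN).ge, k + 1, hkN,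
        ?_, ?_, ?_, ?_, rfl⟩
      · have h1 : SameExcept (Program.forLoop j e body).regs body.arrs s s' :=
          hfr.mono (by rw [hregs]; intro x hx; simp [hx]) (fun x hx => hx)
        refine hsame.trans (h1.trans ⟨fun x hx => ?_, fun x _ => by
          simp [Program.run, Instr.apply]⟩)
        simp only [hregs, List.mem_cons, List.mem_append, not_or] at hx
        simp [Program.run, Instr.apply, hx.1, hx.2.2.2.1]
      · simp [Program.run, Instr.apply, Ne.symm h2j, hj']
        ring
      · simp [Program.run, Instr.apply, Ne.symm h2j, hj', Ne.symm h2e, he', Ne.symm hje]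
        ring
      · refine hI (k + 1) s' _ ⟨fun x hx => ?_, fun _ _ => by simp [Program.run, Instr.apply]⟩ hI'
        simp only [List.mem_cons, not_or] at hx
        simp [Program.run, Instr.apply, hx.1, hx.2.1]

/-- For `i = 0, …, (register `lim`) - 1` do `body`. -/
def Program.forUp (i lim : ℕ) (body : Program) : Program :=
  .instr (.const i 0) ⨾ .forLoop i lim body

theorem Runs.forUp {i lim : ℕ} {body : Program} {s₀ : Memory} {N : ℕ}
    (I : ℕ → Memory → Prop) (c : ℕ → ℕ) (hne : [2, i, lim].Nodup)
    (hi : i ∉ body.regs) (hlim : lim ∉ body.regs) (hI : ∀ k, Ignores [2, i] (I k))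
    (hN : s₀.reg lim = N) (h0 : I 0 s₀)
    (hbody : ∀ k < N, ∀ s, SameExcept (Program.forUp i lim body).regs body.arrs s₀ s →
      s.reg i = k → I k s → Runs body s (c k) (I (k + 1))) :
    Runs (.forUp i lim body) s₀ (∑ k ∈ Finset.range N, (c k + 4) + 3) (I N) := by
  have hne' := hne
  simp only [List.nodup_cons, List.mem_cons, List.not_mem_nil, or_false, not_or,
    List.nodup_nil, and_true, not_false_eq_true] at hne'
  obtain ⟨⟨h2i, h2l⟩, hil⟩ := hne'
  have hs : SameExcept [i] [] s₀ ((Instr.const i 0).apply s₀) := (Instr.const i 0).sameExcept s₀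
  refine (Runs.seq (B₁ := 1) (B₂ := ∑ k ∈ Finset.range N, (c k + 4) + 2)
    (Runs.instr ?_)).mono (by omega) fun _ h => h
  refine Runs.forLoop (a := 0) I c hne hi hlim hI (by simp [Instr.apply]) ?_ ?_ ?_
  · rw [hs.1 lim (by simpa using Ne.symm hil), hN]; simp
  · exact hI 0 _ _ (hs.mono (by simp) (by simp)) h0
  · intro k hk s hsame hsi
    refine hbody k hk s ?_ (by simpa using hsi)
    exact (hs.mono (by simp [Program.forUp, Program.regs, Instr.regs]) (by simp)).trans
      (hsame.mono (by simp [Program.forUp, Program.regs]) (fun x hx => hx))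

/-! ### Loops over neighborhoods -/

/-- Arrays `0` and `1` hold the adjacency lists `adj`. -/
def HasGraph {n : ℕ} (adj : Fin n → List (Fin n)) (s : Memory) : Prop :=
  (∀ i ≤ n, s.arr 0 (i : ℤ) = (listOffset adj i : ℤ)) ∧
  ∀ (v : Fin n) (k : ℕ) (hk : k < (adj v).length),
    s.arr 1 ((listOffset adj v : ℤ) + k) = (((adj v)[k] : Fin n) : ℕ)

theorem HasGraph.congr {n : ℕ} {adj : Fin n → List (Fin n)} {s s' : Memory} (h : HasGraph adj s)
    (h0 : s'.arr 0 = s.arr 0) (h1 : s'.arr 1 = s.arr 1) : HasGraph adj s' := by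
  unfold HasGraph
  rw [h0, h1]
  exact h

theorem listOffset_succ {n : ℕ} (adj : Fin n → List (Fin n)) (v : Fin n) :
    listOffset adj (v + 1) = listOffset adj v + (adj v).length := by
  unfold listOffset
  rw [List.take_add_one, List.flatten_append, List.length_append]
  simp

/-- Execute `body` for the vertex in register `v` and then for all its neighbors, with the current
vertex in register `y`. Registers `j`, `e` and `2` are used as scratch. -/
def Program.forClosed (v j e y : ℕ) (body : Program) : Program :=
  (.instr (.const 2 0) ⨾ .instr (.add y v 2)) ⨾ body ⨾
  (.instr (.load j 0 v) ⨾ .instr (.const 2 1) ⨾ .instr (.add 2 v 2) ⨾ .instr (.load e 0 2)) ⨾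
  .forLoop j e (.instr (.load y 1 j) ⨾ body)

theorem sum_range_getElem_eq {α : Type*} (l : List α) (d : α → ℕ) (f : ℕ → ℕ)
    (h : ∀ k (hk : k < l.length), f k = d l[k]) :
    ∑ k ∈ Finset.range l.length, f k = (l.map d).sum := by
  rw [Finset.sum_range]
  have : ∀ i : Fin l.length, f i = (l.map d)[(i : ℕ)]'(by simp) := fun i => by
    simp [h i i.2]
  rw [← Fin.sum_univ_getElem]
  refine Finset.sum_bij (fun i _ => i.cast (by simp)) (by simp) ?_ ?_ ?_
  · intro a _ b _ hab
    simpa [Fin.ext_iff] using hab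
  · intro b _
    exact ⟨b.cast (by simp), by simp, by simp⟩
  · intro i _
    rw [this]
    rfl

theorem Runs.forClosed {n : ℕ} {adj : Fin n → List (Fin n)} {v j e y : ℕ} {body : Program}
    {s₀ : Memory} {x : Fin n} (I : List (Fin n) → Memory → Prop) (c : Fin n → ℕ)
    (hne : [2, v, j, e, y].Nodup) (hv : v ∉ body.regs) (hj : j ∉ body.regs) (he : e ∉ body.regs)
    (h0 : 0 ∉ body.arrs) (h1 : 1 ∉ body.arrs) (hI : ∀ l, Ignores [2, j, e, y] (I l))
    (hG : HasGraph adj s₀) (hx : s₀.reg v = ((x : ℕ) : ℤ)) (hI0 : I [] s₀)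
    (hbody : ∀ (pre : List (Fin n)) (z : Fin n), pre ++ [z] <+: x :: adj x → ∀ s,
      SameExcept (Program.forClosed v j e y body).regs body.arrs s₀ s →
      s.reg y = ((z : ℕ) : ℤ) → I pre s → Runs body s (c z) (I (pre ++ [z]))) :
    Runs (.forClosed v j e y body) s₀ (((x :: adj x).map fun z => c z + 5).sum + 8)
      (I (x :: adj x)) := by
  have hne' := hne
  simp only [List.nodup_cons, List.mem_cons, List.not_mem_nil, or_false, not_or,
    List.nodup_nil, and_true, not_false_eq_true] at hne'
  obtain ⟨⟨h2v, h2j, h2e, h2y⟩, ⟨hvj, hve, hvy⟩, ⟨hje, hjy⟩, hey⟩ := hne'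
  set R := (Program.forClosed v j e y body).regs with hR
  have hRmem : ∀ r, r ∈ R ↔ r = 2 ∨ r = j ∨ r = e ∨ r = y ∨ r ∈ body.regs := by
    intro r
    simp [R, Program.forClosed, Program.forLoop, Program.regs, Instr.regs]
    tauto
  have hstart : SameExcept [2, y] [] s₀
      ((Program.instr (.const 2 0) ⨾ .instr (.add y v 2)).run s₀) := by
    constructor
    · intro r hr
      simp only [List.mem_cons, not_or, List.not_mem_nil, not_false_eq_true, and_true] at hr
      simp [Program.run, Instr.apply, hr.1, hr.2]
    · intro r _; simp [Program.run, Instr.apply]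
  have hbodyR : body.regs ⊆ R := fun r hr => (hRmem r).2 (by tauto)
  have key : Runs ((.instr (.const 2 0) ⨾ .instr (.add y v 2)) ⨾ body ⨾
      (.instr (.load j 0 v) ⨾ .instr (.const 2 1) ⨾ .instr (.add 2 v 2) ⨾
        .instr (.load e 0 2)) ⨾
      .forLoop j e (.instr (.load y 1 j) ⨾ body)) s₀
      (2 + (c x + (4 + (∑ k ∈ Finset.range (adj x).length,
        ((if h : k < (adj x).length then c (adj x)[k] + 1 else 0) + 4) + 2))))
      (I (x :: adj x)) := by
    refine Runs.seq (Runs.straight (by rfl) (by simp [Program.cost]) (Runs.seq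
      ((hbody [] x (by simp) _ (hstart.mono ?_ (by simp)) ?_ ?_).frame.mono le_rfl ?_)))
    · intro r hr
      simp only [List.mem_cons, List.not_mem_nil, or_false] at hr
      exact (hRmem r).2 (by tauto)
    · simp [Program.run, Instr.apply, hx, Ne.symm h2v]
    · exact hI _ _ _ (hstart.mono (by simp) (by simp)) hI0
    rintro s₁ ⟨hI1, hfr1⟩
    have hs1 : SameExcept R body.arrs s₀ s₁ :=
      (hstart.mono (by
        intro r hr
        simp only [List.mem_cons, List.not_mem_nil, or_false] at hr
        exact (hRmem r).2 (by tauto)) (by simp)).trans (hfr1.mono hbodyR (fun r hr => hr))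
    have hv1 : s₁.reg v = ((x : ℕ) : ℤ) := by
      rw [hs1.1 v (by rw [hRmem]; tauto), hx]
    have hG1 : HasGraph adj s₁ := hG.congr (hs1.2 0 h0) (hs1.2 1 h1)
    refine Runs.seq (Runs.straight (by rfl) (by simp [Program.cost]) ?_)
    set s₂ := (Program.instr (.load j 0 v) ⨾ .instr (.const 2 1) ⨾ .instr (.add 2 v 2) ⨾
        .instr (.load e 0 2)).run s₁ with hs2def
    have hs12 : SameExcept [2, j, e] [] s₁ s₂ := by
      constructor
      · intro r hr
        simp only [List.mem_cons, not_or, List.not_mem_nil, not_false_eq_true, and_true] at hr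
        simp [s₂, Program.run, Instr.apply, hr.1, hr.2.1, hr.2.2]
      · intro r _; simp [s₂, Program.run, Instr.apply]
    have hs2 : SameExcept R body.arrs s₀ s₂ := hs1.trans (hs12.mono (by
        intro r hr
        simp only [List.mem_cons, List.not_mem_nil, or_false] at hr
        exact (hRmem r).2 (by tauto)) (by simp))
    have hj2 : s₂.reg j = (listOffset adj x : ℤ) := by
      simp [s₂, Program.run, Instr.apply, Ne.symm h2j, hje, hv1, hG1.1 x x.2.le]
    have he2 : s₂.reg e = (listOffset adj x : ℤ) + ((adj x).length : ℕ) := by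
      have := hG1.1 (x + 1) x.2
      rw [listOffset_succ] at this
      push_cast at this
      simp [s₂, Program.run, Instr.apply, hvj, Ne.symm h2v, hv1, this]
    refine (Runs.forLoop (a := (listOffset adj x : ℤ)) (N := (adj x).length)
      (fun k s => I (x :: (adj x).take k) s)
      (fun k => if h : k < (adj x).length then c (adj x)[k] + 1 else 0)
      ?_ ?_ ?_ (fun k => ?_) hj2 he2 ?_ ?_).mono le_rfl ?_
    · simp [h2j, h2e, hje]
    · simp [Program.regs, Instr.regs, hjy, hj]
    · simp [Program.regs, Instr.regs, hey, he]
    · intro s s' hs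
      exact hI _ _ _ (hs.mono (by simp) (by simp))
    · exact hI _ _ _ (hs12.mono (by simp) (by simp)) (by simpa using hI1)
    · intro k hk s hsame hsj hIk
      have hs02 : SameExcept R body.arrs s₀ s := hs2.trans (hsame.mono (by
        intro r hr
        rw [hRmem]
        simp [Program.forLoop, Program.regs, Instr.regs] at hr
        tauto) (by simp [Program.arrs, Instr.arrs]))
      have hGs : HasGraph adj s := hG.congr (hs02.2 0 h0) (hs02.2 1 h1)
      have hload : SameExcept [y] [] s ((Instr.load y 1 j).apply s) :=
        (Instr.load y 1 j).sameExcept s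
      have hpre : x :: (adj x).take k ++ [(adj x)[k]] = x :: (adj x).take (k + 1) := by
        rw [List.take_add_one, List.getElem?_eq_getElem hk]
        simp
      simp only [dif_pos hk]
      rw [add_comm]
      refine Runs.seq (Runs.instr ?_)
      rw [← hpre]
      refine hbody (x :: (adj x).take k) (adj x)[k] ?_ _ (hs02.trans (hload.mono ?_ (by simp)))
        ?_ ?_
      · rw [hpre, List.cons_prefix_cons]
        exact ⟨rfl, List.take_prefix _ _⟩
      · intro r hr
        simp only [List.mem_cons, List.not_mem_nil, or_false] at hr
        exact (hRmem r).2 (by tauto)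
      · simp only [Instr.apply, Function.update_self, hsj]
        exact hGs.2 x k hk
      · exact hI _ _ _ (hload.mono (by simp) (by simp)) hIk
    · intro s hs
      simpa using hs
  obtain ⟨t, s', hex, ht, hQ⟩ := key
  refine ⟨t, s', hex, ht.trans ?_, hQ⟩
  · have hsum : ∑ k ∈ Finset.range (adj x).length,
        ((if h : k < (adj x).length then c (adj x)[k] + 1 else 0) + 4) =
        ((adj x).map fun z => c z + 5).sum :=
      sum_range_getElem_eq _ _ _ fun k hk => by simp [hk]
    rw [hsum]
    simp only [List.map_cons, List.sum_cons]
    omega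

/-! ### The bucket queue -/

section Queue

variable {n : ℕ}

/-- The linked list that starts at node `p` contains the vertices in `l`; all its nodes are in
`1, …, K`, and `0` is the end of the list. -/
def Chain (next val : ℤ → ℤ) (K : ℕ) : ℤ → List (Fin n) → Prop
  | p, [] => p = 0
  | p, v :: l => 0 < p ∧ p ≤ K ∧ val p = ((v : ℕ) : ℤ) ∧ Chain next val K (next p) l

theorem Chain.update {next val : ℤ → ℤ} {K : ℕ} {a b : ℤ} : ∀ {p : ℤ} {l : List (Fin n)},
    Chain next val K p l →
    Chain (Function.update next (K + 1) a) (Function.update val (K + 1) b) (K + 1) p l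
  | _, [], h => h
  | p, v :: l, ⟨h1, h2, h3, h4⟩ => by
    have : p ≠ K + 1 := by omega
    exact ⟨h1, by push_cast; omega, by rw [Function.update_of_ne this, h3],
      by rw [Function.update_of_ne this]; exact h4.update⟩

/-- The state of the bucket queue: every vertex `y` in `A` is in the bucket of its current count,
all other entries are outdated; the nonempty buckets are `1, …, J`, there are at most `E` entries
altogether, and all of them belong to `N`. -/
structure QueueInv (A N : Set (Fin n)) (cnt : Fin n → ℕ) (B : ℕ → List (Fin n)) (J E : ℕ) :
    Prop where
  mem : ∀ y ∈ A, y ∈ B (cnt y)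
  le : ∀ b, ∀ y ∈ B b, b ≤ J
  ent : ∀ b, ∀ y ∈ B b, y ∈ N ∧ 1 ≤ b ∧ b ≤ cnt y
  size : ∀ S : Finset ℕ, ∑ b ∈ S, (B b).length ≤ E

variable {A N : Set (Fin n)} {cnt : Fin n → ℕ} {B : ℕ → List (Fin n)} {J E : ℕ} {y : Fin n}

theorem QueueInv.mono {A' N' : Set (Fin n)} (h : QueueInv A N cnt B J E) (hA : A' ⊆ A)
    (hN : N ⊆ N') : QueueInv A' N' cnt B J E :=
  ⟨fun y hy => h.mem y (hA hy), h.le,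
    fun b y hy => ⟨hN (h.ent b y hy).1, (h.ent b y hy).2⟩, h.size⟩

theorem QueueInv.increase (h : QueueInv A N cnt B J E) (hy : y ∉ A) :
    QueueInv A N (Function.update cnt y (cnt y + 1)) B J E := by
  refine ⟨fun z hz => ?_, h.le, fun b z hz => ?_, h.size⟩
  · rw [Function.update_of_ne (show z ≠ y from fun e => hy (e ▸ hz))]
    exact h.mem z hz
  · obtain ⟨h1, h2, h3⟩ := h.ent b z hz
    refine ⟨h1, h2, ?_⟩
    by_cases hzy : z = y
    · subst hzy; rw [Function.update_self]; omega
    · rwa [Function.update_of_ne hzy]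

theorem QueueInv.push (h : QueueInv A N cnt B J E) (hy : y ∈ N) :
    QueueInv (insert y A) N (Function.update cnt y (cnt y + 1))
      (Function.update B (cnt y + 1) (y :: B (cnt y + 1))) (max J (cnt y + 1)) (E + 1) := by
  have hsub : ∀ b z, z ∈ B b → z ∈ Function.update B (cnt y + 1) (y :: B (cnt y + 1)) b := by
    intro b z hz
    by_cases hb : b = cnt y + 1
    · subst hb; simp [hz]
    · rwa [Function.update_of_ne hb]
  have hsub' : ∀ b z, z ∈ Function.update B (cnt y + 1) (y :: B (cnt y + 1)) b →
      (b = cnt y + 1 ∧ z = y) ∨ z ∈ B b := by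
    intro b z hz
    by_cases hb : b = cnt y + 1
    · subst hb; simpa using hz
    · rw [Function.update_of_ne hb] at hz
      exact Or.inr hz
  refine ⟨fun z hz => ?_, fun b z hz => ?_, fun b z hz => ?_, fun S => ?_⟩
  · by_cases hzy : z = y
    · subst hzy; simp
    · rw [Function.update_of_ne hzy]
      exact hsub _ _ (h.mem z (hz.resolve_left hzy))
  · rcases hsub' b z hz with ⟨rfl, _⟩ | hz
    · exact le_max_right _ _
    · exact (h.le b z hz).trans (le_max_left _ _)
  · rcases hsub' b z hz with ⟨rfl, rfl⟩ | hz
    · exact ⟨hy, by omega, by simp⟩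
    · obtain ⟨h1, h2, h3⟩ := h.ent b z hz
      refine ⟨h1, h2, ?_⟩
      by_cases hzy : z = y
      · subst hzy; rw [Function.update_self]; omega
      · rwa [Function.update_of_ne hzy]
  · have h1 := h.size S
    have h2 : ∀ b ∈ S, (Function.update B (cnt y + 1) (y :: B (cnt y + 1)) b).length =
        (B b).length + if b = cnt y + 1 then 1 else 0 := by
      intro b _
      by_cases hb : b = cnt y + 1
      · subst hb; simp
      · simp [hb]
    rw [Finset.sum_congr rfl h2, Finset.sum_add_distrib, Finset.sum_ite_eq' S]
    split_ifs <;> omega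

/-- Removing an entry of the last bucket. -/
theorem QueueInv.pop {l : List (Fin n)} (h : QueueInv A N cnt B J E) (hB : B J = y :: l) :
    QueueInv (A \ {y}) N cnt (Function.update B J l) J (E - 1) ∧ 1 ≤ E := by
  have hsub' : ∀ b z, z ∈ Function.update B J l b → z ∈ B b := by
    intro b z hz
    by_cases hb : b = J
    · subst hb
      rw [Function.update_self] at hz
      rw [hB]; exact List.mem_cons_of_mem _ hz
    · rwa [Function.update_of_ne hb] at hz
  have hsize : ∀ S : Finset ℕ, J ∈ S →
      ∑ b ∈ S, (Function.update B J l b).length + 1 ≤ E := by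
    intro S hS
    have h1 := h.size S
    rw [← Finset.add_sum_erase _ _ hS] at h1 ⊢
    have h2 : ∀ b ∈ S.erase J, (Function.update B J l b).length = (B b).length := fun b hb => by
      rw [Function.update_of_ne (Finset.ne_of_mem_erase hb)]
    rw [Finset.sum_congr rfl h2, Function.update_self]
    rw [hB, List.length_cons] at h1
    omega
  refine ⟨⟨fun z hz => ?_, fun b z hz => h.le b z (hsub' b z hz),
    fun b z hz => h.ent b z (hsub' b z hz), fun S => ?_⟩, ?_⟩
  · have hzB := h.mem z hz.1
    by_cases hb : cnt z = J
    · rw [hb, Function.update_self]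
      rw [hb, hB] at hzB
      exact (List.mem_cons.1 hzB).resolve_left hz.2
    · rwa [Function.update_of_ne hb]
  · have h1 := hsize (insert J S) (Finset.mem_insert_self _ _)
    have h2 := Finset.sum_le_sum_of_subset (f := fun b => (Function.update B J l b).length)
      (Finset.subset_insert J S)
    omega
  · have := hsize {J} (by simp)
    omega

/-- If the last bucket is empty, the next one becomes the last. -/
theorem QueueInv.lower (h : QueueInv A N cnt B J E) (hB : B J = []) :
    QueueInv A N cnt B (J - 1) E := by
  refine ⟨h.mem, fun b y hy => ?_, h.ent, h.size⟩
  have := h.le b y hy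
  have hb : b ≠ J := by
    rintro rfl
    rw [hB] at hy
    simp at hy
  omega

theorem QueueInv.cnt_le (h : QueueInv A N cnt B J E) (hy : y ∈ A) : cnt y ≤ J :=
  h.le _ y (h.mem y hy)

end Queue

/-! ### The program for maximum cardinality search -/

namespace Prog

/-- Increase the count of the vertex in register `10`; if it is numbered and not done, enter it
into the queue. Arrays: `3` numbered, `4` done, `5` counts, `6` heads of the buckets, `7` next
nodes, `8` entries of the nodes; register `4` is the number of nodes, register `5` the last
bucket. -/
def count : Program :=
  .instr (.load 15 5 10) ⨾ .instr (.const 16 1) ⨾ .instr (.add 15 15 16) ⨾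
  .instr (.store 5 10 15) ⨾ .instr (.load 16 3 10) ⨾ .instr (.load 17 4 10) ⨾
  .instr (.sub 16 16 17) ⨾
  .ite 16
    (.instr (.const 16 1) ⨾ .instr (.add 4 4 16) ⨾ .instr (.store 8 4 10) ⨾
      .instr (.load 17 6 15) ⨾ .instr (.store 7 4 17) ⨾ .instr (.store 6 15 4) ⨾
      .instr (.sub 16 15 5) ⨾ .ite 16 (.instr (.const 16 0) ⨾ .instr (.add 5 15 16)) .skip)
    .skip

/-- Number the vertex in register `9`, with the vertex in register `8` as its maximum neighbor.
Register `3` is the number of the vertex numbered last, array `9` holds the vertex with a given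
number, array `10` the maximum neighbors. -/
def number : Program :=
  (.instr (.const 15 1) ⨾ .instr (.store 3 9 15) ⨾ .instr (.sub 3 3 15) ⨾
    .instr (.store 9 3 9) ⨾ .instr (.store 10 9 8)) ⨾
  .forClosed 9 13 14 10 count

/-- Number the vertex in register `9` unless it is numbered. -/
def numberNew : Program :=
  (.instr (.load 15 3 9) ⨾ .instr (.const 16 1) ⨾ .instr (.sub 15 16 15)) ⨾
  .ite 15 number .skip

/-- Mark the vertex in register `8` as done and number its closed neighborhood. -/
def process : Program :=
  (.instr (.const 15 1) ⨾ .instr (.store 4 8 15)) ⨾ .forClosed 8 11 12 9 numberNew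

end Prog

/-- The memory during the search: `L` is the list of the numbered vertices, the last one first,
`m` are the maximum neighbors, `C` is the set of the vertices that are done, `B` are the buckets,
`J` is the last bucket, and `K` is the number of nodes used. -/
structure SearchRep {n : ℕ} (s : Memory) (L : List (Fin n)) (m : Fin n → Fin n)
    (C : Finset (Fin n)) (cnt : Fin n → ℕ) (B : ℕ → List (Fin n)) (J K : ℕ) : Prop where
  pos : s.reg 3 = (n : ℤ) - (L.length : ℤ)
  ctr : s.reg 4 = (K : ℤ)
  top : s.reg 5 = (J : ℤ)
  numbered : ∀ v : Fin n, s.arr 3 ((v : ℕ) : ℤ) = if v ∈ L then 1 else 0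
  done : ∀ v : Fin n, s.arr 4 ((v : ℕ) : ℤ) = if v ∈ C then 1 else 0
  count : ∀ v : Fin n, s.arr 5 ((v : ℕ) : ℤ) = (cnt v : ℤ)
  chain : ∀ b : ℕ, Chain (s.arr 7) (s.arr 8) K (s.arr 6 (b : ℤ)) (B b)
  sig : ∀ (i : ℕ) (hi : i < L.length),
    s.arr 9 ((n : ℤ) - (L.length : ℤ) + i) = ((L[i] : ℕ) : ℤ)
  mv : ∀ v ∈ L, s.arr 10 ((v : ℕ) : ℤ) = ((m v : ℕ) : ℤ)

section Search

variable {n : ℕ} {s s' : Memory} {L : List (Fin n)} {m : Fin n → Fin n} {C : Finset (Fin n)}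
  {cnt : Fin n → ℕ} {B : ℕ → List (Fin n)} {J K : ℕ}

theorem SearchRep.congr (h : SearchRep s L m C cnt B J K) (ha : s'.arr = s.arr)
    (h3 : s'.reg 3 = s.reg 3) (h4 : s'.reg 4 = s.reg 4) (h5 : s'.reg 5 = s.reg 5) :
    SearchRep s' L m C cnt B J K := by
  obtain ⟨a, b, c, d, e, f, g, i, j⟩ := h
  constructor <;> simp only [ha, h3, h4, h5] <;> assumption

theorem SearchRep.of_sameExcept {R : List ℕ} (h : SearchRep s L m C cnt B J K)
    (hs : SameExcept R [] s s') (h3 : 3 ∉ R) (h4 : 4 ∉ R) (h5 : 5 ∉ R) :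
    SearchRep s' L m C cnt B J K :=
  h.congr (funext fun a => hs.2 a (by simp)) (hs.1 3 h3) (hs.1 4 h4) (hs.1 5 h5)

theorem SearchRep.runs_count (h : SearchRep s L m C cnt B J K) {y : Fin n}
    (hy : s.reg 10 = ((y : ℕ) : ℤ)) :
    Runs Prog.count s 20 (fun s' =>
      if y ∈ L ∧ y ∉ C then
        SearchRep s' L m C (Function.update cnt y (cnt y + 1))
          (Function.update B (cnt y + 1) (y :: B (cnt y + 1))) (max J (cnt y + 1)) (K + 1)
      else SearchRep s' L m C (Function.update cnt y (cnt y + 1)) B J K) := by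
  refine Runs.straight (by rfl) (by decide) ?_
  split_ifs with hLC
  · obtain ⟨hL, hC⟩ := hLC
    have hch : ∀ b : ℕ, Chain (Function.update (s.arr 7) (K + 1) (s.arr 6 (cnt y + 1)))
        (Function.update (s.arr 8) (K + 1) ((y : ℕ) : ℤ)) (K + 1)
        (if (b : ℤ) = cnt y + 1 then K + 1 else s.arr 6 b)
        (Function.update B (cnt y + 1) (y :: B (cnt y + 1)) b) := by
      intro b
      by_cases hb : b = cnt y + 1
      · subst hb
        have := (h.chain (cnt y + 1)).update (a := s.arr 6 (cnt y + 1)) (b := ((y : ℕ) : ℤ))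
        push_cast at this ⊢
        simp only [if_true, Function.update_self]
        exact ⟨by omega, by push_cast; omega, by simp, by simpa using this⟩
      · have : ¬ (b : ℤ) = cnt y + 1 := by exact_mod_cast hb
        rw [if_neg this, Function.update_of_ne hb]
        exact (h.chain b).update
    by_cases hJ : J ≤ cnt y
    · constructor <;>
        simp [Prog.count, Program.run, Instr.apply, hy, h.pos, h.ctr, Function.update_apply,
          h.top, h.numbered, h.done, h.count, hL, hC, hJ, Fin.val_inj]
      · omega
      · intro b
        have := hch b
        simpa [Function.update_apply] using this
      · exact h.sig
      · exact h.mv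
    · constructor <;>
        simp [Prog.count, Program.run, Instr.apply, hy, h.pos, h.ctr, Function.update_apply,
          h.top, h.numbered, h.done, h.count, hL, hC, hJ, Fin.val_inj]
      · omega
      · intro b
        have := hch b
        simpa [Function.update_apply] using this
      · exact h.sig
      · exact h.mv
  · have hcond : ¬ (if y ∈ C then (1 : ℤ) else 0) < if y ∈ L then 1 else 0 := by
      by_cases hL : y ∈ L
      · simp [hL, show y ∈ C from by_contra fun hC => hLC ⟨hL, hC⟩]
      · simp only [hL, if_false]; split_ifs <;> simp
    constructor <;>
        simp [Prog.count, Program.run, Instr.apply, hy, h.pos, h.ctr, Function.update_apply,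
          h.top, h.numbered, h.done, h.count, h.chain, hcond, Fin.val_inj]
    · exact h.sig
    · exact h.mv

end Search

/-! ### Numbering a closed neighborhood -/

section Search

variable {n : ℕ} {G : SimpleGraph (Fin n)} {adj : Fin n → List (Fin n)} {s s' : Memory}
  {L : List (Fin n)} {m : Fin n → Fin n} {C : Finset (Fin n)}
  {cnt : Fin n → ℕ} {B : ℕ → List (Fin n)} {J K E : ℕ} {x u : Fin n}

/-- The number of vertices of `L` in the closed neighborhood of `v`. -/
noncomputable def numCount (G : SimpleGraph (Fin n)) (L : List (Fin n)) (v : Fin n) : ℕ :=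
  (closedNbhd G v ∩ {y | y ∈ L}).ncard

theorem IsAdjacencyList.nodup_cons (h : IsAdjacencyList G adj) (x : Fin n) :
    (x :: adj x).Nodup :=
  List.nodup_cons.2 ⟨fun hx => G.loopless.irrefl x (((h x).2 x).1 hx), (h x).1⟩

theorem IsAdjacencyList.mem_cons (h : IsAdjacencyList G adj) {x z : Fin n} :
    z ∈ x :: adj x ↔ z ∈ closedNbhd G x := by
  rw [List.mem_cons, (h x).2 z, mem_closedNbhd]

theorem numCount_cons (hadj : IsAdjacencyList G adj) (hx : x ∉ L) (v : Fin n) :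
    numCount G (x :: L) v = numCount G L v + if v ∈ x :: adj x then 1 else 0 := by
  unfold numCount
  split_ifs with hv
  all_goals rw [hadj.mem_cons] at hv
  · rw [← Set.ncard_insert_of_notMem (a := x) (fun h => hx h.2)]
    congr 1
    ext y
    simp only [Set.mem_inter_iff, Set.mem_insert_iff, Set.mem_ofPred_eq, List.mem_cons]
    constructor
    · rintro ⟨h1, rfl | h2⟩
      · exact Or.inl rfl
      · exact Or.inr ⟨h1, h2⟩
    · rintro (rfl | h)
      · exact ⟨mem_closedNbhd_comm.1 hv, Or.inl rfl⟩
      · exact ⟨h.1, Or.inr h.2⟩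
  · rw [add_zero]
    congr 1
    ext y
    simp only [Set.mem_inter_iff, Set.mem_ofPred_eq, List.mem_cons]
    constructor
    · rintro ⟨h1, rfl | h2⟩
      · exact absurd (mem_closedNbhd_comm.1 h1) hv
      · exact ⟨h1, h2⟩
    · exact fun h => ⟨h.1, Or.inr h.2⟩

theorem numCount_le (h : IsAdjacencyList G adj) (L : List (Fin n)) (v : Fin n) :
    numCount G L v ≤ (adj v).length + 1 := by
  unfold numCount
  calc _ ≤ ((v :: adj v).toFinset : Set (Fin n)).ncard := by
        refine Set.ncard_le_ncard (fun y hy => ?_) (Finset.finite_toSet _)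
        rw [Finset.mem_coe, List.mem_toFinset]
        exact h.mem_cons.2 hy.1
    _ = (v :: adj v).toFinset.card := Set.ncard_coe_finset _
    _ ≤ (v :: adj v).length := List.toFinset_card_le _
    _ = _ := by simp

theorem notMem_of_prefix {α : Type*} {l pre : List α} {z : α} (hl : l.Nodup)
    (h : pre ++ [z] <+: l) : z ∉ pre := by
  have := h.sublist.nodup hl
  rw [List.nodup_append] at this
  intro hz
  exact this.2.2 z hz z (by simp) rfl

theorem SearchRep.runs_number (hadj : IsAdjacencyList G adj) (hG : HasGraph adj s)
    (h : SearchRep s L m C (numCount G L) B J K)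
    (hQ : QueueInv {y | y ∈ L ∧ y ∉ C} {y | y ∈ L} (numCount G L) B J E) (hx : x ∉ L)
    (hx9 : s.reg 9 = ((x : ℕ) : ℤ)) (hu8 : s.reg 8 = ((u : ℕ) : ℤ)) :
    Runs Prog.number s (25 * ((adj x).length + 1) + 13) (fun s' => ∃ B' J' K' E',
      SearchRep s' (x :: L) (Function.update m x u) C (numCount G (x :: L)) B' J' K' ∧
      QueueInv {y | y ∈ x :: L ∧ y ∉ C} {y | y ∈ x :: L} (numCount G (x :: L)) B' J' E' ∧
      E' ≤ E + ((adj x).length + 1) ∧ J' ≤ J + 3 * ((adj x).length + 1)) := by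
  refine (Runs.seq (B₁ := 5) (B₂ := 25 * ((adj x).length + 1) + 8)
    (Runs.straight (by rfl) (by decide) ?_)).mono (by omega) fun _ h => h
  set s₁ := Program.run _ s with hs₁
  have hfr : SameExcept [3, 15] [3, 9, 10] s s₁ := by
    constructor <;> intro r hr <;>
      simp only [List.mem_cons, not_or, List.not_mem_nil, not_false_eq_true, and_true] at hr <;>
      simp [s₁, Program.run, Instr.apply, hr]
  have h1 : SearchRep s₁ (x :: L) (Function.update m x u) C (numCount G L) B J K := by
    constructor
    · simp [s₁, Program.run, Instr.apply, h.pos]; ring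
    · rw [hfr.1 4 (by decide), h.ctr]
    · rw [hfr.1 5 (by decide), h.top]
    · intro v
      simp [s₁, Program.run, Instr.apply, hx9, Function.update_apply, Fin.val_inj, h.numbered]
      by_cases hv : v = x <;> simp [hv]
    · intro v; rw [hfr.2 4 (by decide), h.done]
    · intro v; rw [hfr.2 5 (by decide), h.count]
    · intro b; rw [hfr.2 7 (by decide), hfr.2 8 (by decide), hfr.2 6 (by decide)]; exact h.chain b
    · intro i hi
      cases i with
      | zero =>
        have : (n : ℤ) - ((x :: L).length : ℕ) + (0 : ℕ) = n - L.length - 1 := by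
          simp only [List.length_cons]; push_cast; ring
        rw [this]
        simp [s₁, Program.run, Instr.apply, h.pos, hx9]
      | succ i =>
        have : (n : ℤ) - ((x :: L).length : ℕ) + (i + 1 : ℕ) = n - L.length + i := by
          simp only [List.length_cons]; push_cast; ring
        rw [this]
        have hne : (n : ℤ) - L.length + i ≠ n - L.length - 1 := by omega
        simp only [List.getElem_cons_succ]
        rw [← h.sig i (by simpa using hi)]
        simp [s₁, Program.run, Instr.apply, h.pos, hx9, Function.update_of_ne hne]
    · intro v hv
      by_cases hvx : v = x
      · subst hvx
        simp [s₁, Program.run, Instr.apply, hx9, hu8]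
      · rw [Function.update_of_ne hvx, ← h.mv v ((List.mem_cons.1 hv).resolve_left hvx)]
        simp [s₁, Program.run, Instr.apply, hx9, hu8, Fin.val_inj, hvx]
  have hG1 : HasGraph adj s₁ := hG.congr (hfr.2 0 (by decide)) (hfr.2 1 (by decide))
  have hx1 : s₁.reg 9 = ((x : ℕ) : ℤ) := by rw [hfr.1 9 (by decide), hx9]
  refine (Runs.forClosed (adj := adj) (x := x) (fun pre s => ∃ B' J' K' E',
      SearchRep s (x :: L) (Function.update m x u) C
        (fun v => numCount G L v + if v ∈ pre then 1 else 0) B' J' K' ∧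
      QueueInv {y | (y ∈ L ∨ (y = x ∧ y ∈ pre)) ∧ y ∉ C} {y | y ∈ x :: L}
        (fun v => numCount G L v + if v ∈ pre then 1 else 0) B' J' E' ∧
      E' ≤ E + pre.length ∧ J' ≤ J + ((adj x).length + 1) + 1 + pre.length)
    (fun _ => 20) (by decide) (by decide) (by decide) (by decide) (by decide) (by decide)
    ?_ hG1 hx1 ?_ ?_).mono ?_ ?_
  · rintro pre s s' hs ⟨B', J', K', E', hr, hrest⟩
    exact ⟨B', J', K', E', hr.of_sameExcept hs (by decide) (by decide) (by decide), hrest⟩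
  · refine ⟨B, J, K, E, by simpa using h1, ?_, by simp, by omega⟩
    simpa using hQ.mono (A' := {y | y ∈ L ∧ y ∉ C}) (N' := {y | y ∈ x :: L}) subset_rfl
      (fun y hy => List.mem_cons_of_mem _ hy)
  · rintro pre z hpre s₂ - hz ⟨B', J', K', E', hr, hq, hE, hJ⟩
    have hzpre : z ∉ pre := notMem_of_prefix (hadj.nodup_cons x) hpre
    have hcnt : Function.update (fun v => numCount G L v + if v ∈ pre then 1 else 0) z
        ((fun v => numCount G L v + if v ∈ pre then 1 else 0) z + 1) =
        fun v => numCount G L v + if v ∈ pre ++ [z] then 1 else 0 := by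
      funext v
      by_cases hv : v = z
      · subst hv; simp [hzpre]
      · simp [hv]
    refine (hr.runs_count hz).mono le_rfl fun s₃ hs₃ => ?_
    rw [hcnt] at hs₃
    by_cases hzL : z ∈ x :: L ∧ z ∉ C
    · rw [if_pos hzL] at hs₃
      refine ⟨_, _, _, E' + 1, hs₃, ?_, ?_, ?_⟩
      · have := hq.push (y := z) hzL.1
        rw [hcnt] at this
        refine this.mono ?_ subset_rfl
        rintro y ⟨hy, hyC⟩
        rcases hy with hy | ⟨hy, hy'⟩
        · exact Or.inr ⟨Or.inl hy, hyC⟩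
        · rcases List.mem_append.1 hy' with hy' | hy'
          · exact Or.inr ⟨Or.inr ⟨hy, hy'⟩, hyC⟩
          · exact Or.inl (by simpa using hy')
      · simp only [List.length_append, List.length_singleton]
        omega
      · simp only [List.length_append, List.length_singleton, if_neg hzpre]
        rcases List.mem_cons.1 hzL.1 with rfl | hz'
        · have := numCount_le hadj L z
          omega
        · have := hq.cnt_le (y := z) ⟨Or.inl hz', hzL.2⟩
          simp only [if_neg hzpre] at this
          omega
    · rw [if_neg hzL] at hs₃
      have hlen : (pre ++ [z]).length = pre.length + 1 := by simp
      refine ⟨_, _, _, E', hs₃, ?_, by omega, by omega⟩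
      have := hq.increase (y := z) ?_
      · rw [hcnt] at this
        refine this.mono ?_ subset_rfl
        rintro y ⟨hy, hyC⟩
        rcases hy with hy | ⟨hy, hy'⟩
        · exact ⟨Or.inl hy, hyC⟩
        · rcases List.mem_append.1 hy' with hy' | hy'
          · exact ⟨Or.inr ⟨hy, hy'⟩, hyC⟩
          · have hyz : y = z := by simpa using hy'
            exact absurd ⟨by rw [← hyz, hy]; simp, hyz ▸ hyC⟩ hzL
      · rintro ⟨hz1, hz2⟩
        exact hzL ⟨hz1.elim (List.mem_cons_of_mem _) fun h => by simp [h.1], hz2⟩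
  · simp; omega
  · rintro s₂ ⟨B', J', K', E', hr, hq, hE, hJ⟩
    have hcnt : (fun v => numCount G L v + if v ∈ x :: adj x then 1 else 0) =
        numCount G (x :: L) := by
      funext v
      rw [numCount_cons hadj hx]
    rw [hcnt] at hr hq
    refine ⟨B', J', K', E', hr, hq.mono ?_ subset_rfl, by simpa using hE, ?_⟩
    · rintro y ⟨hy, hyC⟩
      rcases List.mem_cons.1 hy with rfl | hy
      · exact ⟨Or.inr ⟨rfl, by simp⟩, hyC⟩
      · exact ⟨Or.inl hy, hyC⟩
    · simp only [List.length_cons] at hJ; omega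

/-- The total size of the closed neighborhoods of the vertices outside `L`. -/
def restSize (adj : Fin n → List (Fin n)) (L : List (Fin n)) : ℕ :=
  ∑ v, if v ∈ L then 0 else ((adj v).length + 1)

theorem restSize_cons (hx : x ∉ L) :
    restSize adj (x :: L) + ((adj x).length + 1) = restSize adj L := by
  unfold restSize
  rw [← Finset.add_sum_erase _ _ (Finset.mem_univ x),
    ← Finset.add_sum_erase Finset.univ (fun v => if v ∈ L then 0 else ((adj v).length + 1))
      (Finset.mem_univ x)]
  have : ∀ v ∈ Finset.univ.erase x, (if v ∈ x :: L then 0 else ((adj v).length + 1)) =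
      if v ∈ L then 0 else ((adj v).length + 1) := by
    intro v hv
    simp [Finset.ne_of_mem_erase hv]
  rw [Finset.sum_congr rfl this]
  simp [hx]
  omega

/-- The total size of the closed neighborhoods of those vertices in `l` that are not in `L`. -/
def newSize (adj : Fin n → List (Fin n)) (L l : List (Fin n)) : ℕ :=
  (l.map fun z => if z ∈ L then 0 else ((adj z).length + 1)).sum

/-- The memory between two passes of the search. -/
structure SearchInv (G : SimpleGraph (Fin n)) (s : Memory) (L : List (Fin n)) (m : Fin n → Fin n)
    (C : Finset (Fin n)) (B : ℕ → List (Fin n)) (J K E : ℕ) : Prop where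
  rep : SearchRep s L m C (numCount G L) B J K
  queue : QueueInv {y | y ∈ L ∧ y ∉ C} {y | y ∈ L} (numCount G L) B J E
  numbering : IsNumbering G m L

theorem SearchInv.of_sameExcept {R : List ℕ} (h : SearchInv G s L m C B J K E)
    (hs : SameExcept R [] s s') (h3 : 3 ∉ R) (h4 : 4 ∉ R) (h5 : 5 ∉ R) :
    SearchInv G s' L m C B J K E :=
  ⟨h.rep.of_sameExcept hs h3 h4 h5, h.queue, h.numbering⟩

/-- Processing `u` numbers its closed neighborhood, with `u` as the maximum neighbor of the new
vertices. If `u` itself is new, then it starts a new component, and is the only new vertex that is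
its own maximum neighbor. -/
theorem SearchInv.runs_process (hadj : IsAdjacencyList G adj)
    (hG : HasGraph adj s) (hrep : SearchRep s L m C (numCount G L) B J K)
    (hQ : QueueInv {y | y ∈ L ∧ y ∉ insert u C} {y | y ∈ L} (numCount G L) B J E)
    (hnum : IsNumbering G m L) (hcov : ∀ y, y ∈ L ↔ y ∈ cover G (C : Set (Fin n)))
    (htree : IsConnectedInJoinTree G (C : Set (Fin n))) (huC : u ∉ C)
    (hmax : IsMaximalChoice G (C : Set (Fin n)) u)
    (huL : u ∈ L ∨ cover G (C : Set (Fin n)) ⊆ C) (hu8 : s.reg 8 = ((u : ℕ) : ℤ)) :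
    Runs Prog.process s (15 * ((adj u).length + 1) + 50 * newSize adj L (u :: adj u) + 10)
      (fun s' => ∃ L' m' B' J' K' E', SearchInv G s' L' m' (insert u C) B' J' K' E' ∧
        (∀ y, y ∈ L' ↔ y ∈ L ∨ y ∈ closedNbhd G u) ∧
        restSize adj L' + newSize adj L (u :: adj u) = restSize adj L ∧
        E' + restSize adj L' ≤ E + restSize adj L ∧
        J' + 3 * restSize adj L' ≤ J + 3 * restSize adj L) := by
  refine (Runs.seq (B₁ := 2) (B₂ := 15 * ((adj u).length + 1) +
    50 * newSize adj L (u :: adj u) + 8)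
    (Runs.straight (by rfl) (by decide) ?_)).mono (by omega) fun _ h => h
  set s₁ := Program.run _ s with hs₁
  have hfr : SameExcept [15] [4] s s₁ := by
    constructor <;> intro r hr <;>
      simp only [List.mem_cons, not_or, List.not_mem_nil, not_false_eq_true, and_true] at hr <;>
      simp [s₁, Program.run, Instr.apply, hr]
  have h1 : SearchRep s₁ L m (insert u C) (numCount G L) B J K := by
    constructor
    · rw [hfr.1 3 (by decide), hrep.pos]
    · rw [hfr.1 4 (by decide), hrep.ctr]
    · rw [hfr.1 5 (by decide), hrep.top]
    · intro v; rw [hfr.2 3 (by decide), hrep.numbered]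
    · intro v
      simp [s₁, Program.run, Instr.apply, hu8, Function.update_apply, Fin.val_inj, hrep.done]
      by_cases hv : v = u <;> simp [hv]
    · intro v; rw [hfr.2 5 (by decide), hrep.count]
    · intro b; rw [hfr.2 7 (by decide), hfr.2 8 (by decide), hfr.2 6 (by decide)]
      exact hrep.chain b
    · rw [hfr.2 9 (by decide)]; exact hrep.sig
    · rw [hfr.2 10 (by decide)]; exact hrep.mv
  have hG1 : HasGraph adj s₁ := hG.congr (hfr.2 0 (by decide)) (hfr.2 1 (by decide))
  have hu1 : s₁.reg 8 = ((u : ℕ) : ℤ) := by rw [hfr.1 8 (by decide), hu8]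
  refine (Runs.forClosed (adj := adj) (x := u) (fun pre s => ∃ L' m' B' J' K' E',
      SearchInv G s L' m' (insert u C) B' J' K' E' ∧
        (∀ y, y ∈ L' ↔ y ∈ L ∨ y ∈ pre) ∧
        restSize adj L' + newSize adj L pre = restSize adj L ∧
        E' + restSize adj L' ≤ E + restSize adj L ∧
        J' + 3 * restSize adj L' ≤ J + 3 * restSize adj L)
    (fun z => 10 + 50 * if z ∈ L then 0 else ((adj z).length + 1))
    (by decide) (by decide) (by decide) (by decide) (by decide) (by decide)
    ?_ hG1 hu1 ?_ ?_).mono ?_ ?_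
  · rintro pre s s' hs ⟨L', m', B', J', K', E', hr, hrest⟩
    exact ⟨L', m', B', J', K', E', hr.of_sameExcept hs (by decide) (by decide) (by decide), hrest⟩
  · exact ⟨L, m, B, J, K, E, ⟨h1, hQ, hnum⟩, by simp, by simp [newSize], le_rfl, le_rfl⟩
  · rintro pre z hpre s₂ hsame hz ⟨L', m', B', J', K', E', hr, hL', hsz, hE, hJ⟩
    have hzpre : z ∉ pre := notMem_of_prefix (hadj.nodup_cons u) hpre
    have hG2 : HasGraph adj s₂ := hG1.congr (hsame.2 0 (by decide)) (hsame.2 1 (by decide))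
    have hu2 : s₂.reg 8 = ((u : ℕ) : ℤ) := by rw [hsame.1 8 (by decide), hu1]
    have hzu : z ∈ closedNbhd G u := hadj.mem_cons.1 (hpre.subset (by simp))
    have hpreu : ∀ y ∈ pre, y ∈ closedNbhd G u := fun y hy =>
      hadj.mem_cons.1 (hpre.subset (by simp [hy]))
    have huL' : u ∈ L' ∨ (pre = [] ∧ z = u) := by
      cases pre with
      | nil => exact Or.inr ⟨rfl, by simpa using hpre⟩
      | cons a pre =>
        rw [List.cons_append, List.cons_prefix_cons] at hpre
        exact Or.inl ((hL' u).2 (Or.inr (by simp [hpre.1])))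
    refine (Runs.seq (B₁ := 3) (B₂ := (1 + 5 + 50 * if z ∈ L then 0 else ((adj z).length + 1)))
      (Runs.straight (by rfl) (by decide) ?_)).mono (by omega) fun _ h => h
    set s₃ := Program.run _ s₂ with hs₃
    have hfr3 : SameExcept [15, 16] [] s₂ s₃ := by
      constructor <;> intro r hr <;>
        simp only [List.mem_cons, not_or, List.not_mem_nil, not_false_eq_true, and_true] at hr <;>
        simp [s₃, Program.run, Instr.apply, hr]
    have h15 : s₃.reg 15 = 1 - if z ∈ L' then 1 else 0 := by
      simp [s₃, Program.run, Instr.apply, hz, hr.rep.numbered]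
    have hr3 := hr.of_sameExcept hfr3 (by decide) (by decide) (by decide)
    have hsize : newSize adj L (pre ++ [z]) =
        newSize adj L pre + if z ∈ L then 0 else ((adj z).length + 1) := by
      simp [newSize]
    refine (Runs.ite (B := 5 + 50 * if z ∈ L then 0 else ((adj z).length + 1))
      (fun hpos => ?_) (fun hneg => ?_)).mono (by omega) fun _ h => h
    · have hzL' : z ∉ L' := by
        intro hzL'
        rw [h15, if_pos hzL'] at hpos
        simp at hpos
      have hzL : z ∉ L := fun h => hzL' ((hL' z).2 (Or.inl h))
      refine (SearchRep.runs_number (adj := adj) (E := E') hadj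
        (hG2.congr (hfr3.2 0 (by decide)) (hfr3.2 1 (by decide))) hr3.rep hr3.queue hzL'
        (x := z) (u := u) ?_ ?_).mono ?_ ?_
      · rw [hfr3.1 9 (by decide), hz]
      · rw [hfr3.1 8 (by decide), hu2]
      · rw [if_neg hzL]; omega
      rintro s₄ ⟨B₂, J₂, K₂, E₂, hr4, hq4, hE4, hJ4⟩
      have hrs := restSize_cons (adj := adj) hzL'
      refine ⟨z :: L', Function.update m' z u, B₂, J₂, K₂, E₂, ⟨hr4, hq4, ?_⟩, ?_, ?_, ?_, ?_⟩
      · refine ⟨hr.numbering.congr fun y hy => Function.update_of_ne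
          (show y ≠ z from fun e => hzL' (e ▸ hy)) _ _, hzL', ?_⟩
        rw [Function.update_self]
        refine ⟨?_, mem_closedNbhd_comm.1 hzu, ?_, ?_⟩
        · rcases huL' with h | ⟨_, h⟩
          · exact List.mem_cons_of_mem _ h
          · simp [h]
        · -- a numbered vertex at distance at most `2` was numbered before `u` was taken up, or
          -- belongs to `N[u]`
          intro w hw y hy hyL
          rcases List.mem_cons.1 hyL with rfl | hyL
          · exact hzu
          rcases (hL' y).1 hyL with hyL | hyp
          · exact htree.mem_of_mem_cover (by simpa using huC) hmax hzu
              (fun h => hzL ((hcov z).2 h)) hw hy ((hcov y).1 hyL)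
          · exact hpreu y hyp
        · -- `u` is the first vertex of its component to be numbered
          rintro rfl y hyL hadjy
          have huL2 : u ∉ L := hzL
          have hsub := huL.resolve_left huL2
          rcases (hL' y).1 hyL with hyL | hyp
          · exact huL2 ((hcov u).2 ⟨y, hsub ((hcov y).1 hyL), Or.inr hadjy.symm⟩)
          · rcases huL' with h | ⟨h, _⟩
            · exact hzL' h
            · simp [h] at hyp
      · intro y
        simp only [List.mem_cons, List.mem_append, hL', List.not_mem_nil, or_false]
        tauto
      · rw [hsize, if_neg hzL]; omega
      · omega
      · omega
    · have hzL' : z ∈ L' := by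
        by_contra hzL'
        rw [h15, if_neg hzL'] at hneg
        simp at hneg
      have hzL : z ∈ L := ((hL' z).1 hzL').resolve_right hzpre
      refine (Runs.skip ?_).mono (by omega) fun _ h => h
      refine ⟨L', m', B', J', K', E', hr3, ?_, ?_, hE, hJ⟩
      · intro y
        rw [hL' y, List.mem_append, List.mem_singleton]
        constructor
        · rintro (h | h)
          · exact Or.inl h
          · exact Or.inr (Or.inl h)
        · rintro (h | h | rfl)
          · exact Or.inl h
          · exact Or.inr h
          · exact Or.inl hzL
      · rw [hsize, if_pos hzL]; omega
  · have : ((u :: adj u).map fun z =>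
        10 + (50 * if z ∈ L then 0 else ((adj z).length + 1)) + 5).sum =
        15 * ((adj u).length + 1) + 50 * newSize adj L (u :: adj u) := by
      unfold newSize
      have : ∀ l : List (Fin n), (l.map fun z =>
          10 + (50 * if z ∈ L then 0 else ((adj z).length + 1)) + 5).sum = 15 * l.length +
          50 * (l.map fun z => if z ∈ L then 0 else ((adj z).length + 1)).sum := by
        intro l
        induction l with
        | nil => simp
        | cons a l ih =>
          simp only [List.map_cons, List.sum_cons, List.length_cons, ih]
          omega
      rw [this]
      simp
    rw [this]
  · rintro s₂ ⟨L', m', B', J', K', E', hr, hL', hrest⟩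
    exact ⟨L', m', B', J', K', E', hr, fun y => by rw [hL', hadj.mem_cons], hrest⟩

end Search

/-! ### The search -/

namespace Prog

/-- One pass of the search: if the queue may be nonempty, take a vertex from the last bucket, or
lower the bound on the last bucket; otherwise look at the next candidate for the start of a new
component, which is in register `6`. Register `7` is positive as long as there is something to
do. -/
def searchStep : Program :=
  .ite 5
    (.instr (.load 15 6 5) ⨾
      .ite 15
        ((.instr (.load 16 7 15) ⨾ .instr (.store 6 5 16) ⨾ .instr (.load 8 8 15) ⨾
            .instr (.load 16 4 8) ⨾ .instr (.const 17 1) ⨾ .instr (.sub 16 17 16)) ⨾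
          .ite 16 process .skip)
        (.instr (.const 16 1) ⨾ .instr (.sub 5 5 16)))
    ((.instr (.load 15 3 6) ⨾ .instr (.const 16 0) ⨾ .instr (.add 8 6 16) ⨾
        .instr (.const 16 1) ⨾ .instr (.sub 15 16 15) ⨾ .instr (.add 6 6 16)) ⨾
      .ite 15 process .skip) ⨾
  (.instr (.sub 7 0 6) ⨾ .instr (.add 7 7 5))

/-- Maximum cardinality search on the closed neighborhoods. -/
def search : Program :=
  (.instr (.const 16 0) ⨾ .instr (.add 3 0 16) ⨾ .instr (.const 4 0) ⨾ .instr (.const 5 0) ⨾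
    .instr (.const 6 0) ⨾ .instr (.sub 7 0 6)) ⨾
  .while 7 searchStep

end Prog

section Search

variable {n : ℕ} {G : SimpleGraph (Fin n)} {adj : Fin n → List (Fin n)} {s s' s₀ : Memory}
  {L : List (Fin n)} {m : Fin n → Fin n} {C : Finset (Fin n)}
  {cnt : Fin n → ℕ} {B : ℕ → List (Fin n)} {J K E : ℕ} {x u : Fin n}

/-- The total size of the closed neighborhoods of the vertices outside `C`. -/
def openSize (adj : Fin n → List (Fin n)) (C : Finset (Fin n)) : ℕ :=
  ∑ v ∈ Cᶜ, ((adj v).length + 1)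

theorem openSize_insert (hu : u ∉ C) :
    openSize adj (insert u C) + ((adj u).length + 1) = openSize adj C := by
  unfold openSize
  rw [Finset.compl_insert, Finset.sum_erase_add _ _ (by simpa using hu)]

/-- The total size of all closed neighborhoods. -/
def totalSize (adj : Fin n → List (Fin n)) : ℕ := ∑ v, ((adj v).length + 1)

/-- The invariants of the search that relate it to the acyclicity of the closed neighborhoods. All
vertices before `R` are numbered. -/
structure SearchState (G : SimpleGraph (Fin n)) (s : Memory) (L : List (Fin n))
    (m : Fin n → Fin n) (C : Finset (Fin n)) (B : ℕ → List (Fin n)) (J K E R : ℕ) : Prop where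
  inv : SearchInv G s L m C B J K E
  cov : ∀ y, y ∈ L ↔ y ∈ cover G (C : Set (Fin n))
  tree : IsConnectedInJoinTree G (C : Set (Fin n))
  cand : s.reg 6 = (R : ℤ)
  cand_le : R ≤ n
  mem : ∀ v : Fin n, (v : ℕ) < R → v ∈ L

/-- Everything that the search still has to pay for. -/
def searchPotential (adj : Fin n → List (Fin n)) (L : List (Fin n)) (C : Finset (Fin n))
    (J E R : ℕ) : ℕ :=
  110 * restSize adj L + 15 * openSize adj C + 30 * E + 10 * J + 30 * (n - R)

/-- The effect of the processing of `u`, for all variants of the pass. -/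
theorem SearchInv.runs_process' (hadj : IsAdjacencyList G adj) (hdc : IsDuallyChordal G)
    (hG : HasGraph adj s) (hrep : SearchRep s L m C (numCount G L) B J K)
    (hQ : QueueInv {y | y ∈ L ∧ y ∉ insert u C} {y | y ∈ L} (numCount G L) B J E)
    (hnum : IsNumbering G m L) (hcov : ∀ y, y ∈ L ↔ y ∈ cover G (C : Set (Fin n)))
    (htree : IsConnectedInJoinTree G (C : Set (Fin n))) (huC : u ∉ C)
    (hmax : IsMaximalChoice G (C : Set (Fin n)) u)
    (huL : u ∈ L ∨ cover G (C : Set (Fin n)) ⊆ C) (hu8 : s.reg 8 = ((u : ℕ) : ℤ)) {R : ℕ}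
    (hR : s.reg 6 = (R : ℤ)) (hRn : R ≤ n) (hmem : ∀ v : Fin n, (v : ℕ) < R → v ∈ L ∨ v = u) :
    ∃ D, Runs Prog.process s (D + 10) (fun s' => ∃ L' m' B' J' K' E',
      SearchState G s' L' m' (insert u C) B' J' K' E' R ∧
      searchPotential adj L' (insert u C) J' E' R + D ≤ searchPotential adj L C J E R) := by
  refine ⟨15 * ((adj u).length + 1) + 50 * newSize adj L (u :: adj u), ?_⟩
  refine (SearchInv.runs_process hadj hG hrep hQ hnum hcov htree huC hmax huL hu8).frame.mono
    le_rfl ?_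
  rintro s' ⟨⟨L', m', B', J', K', E', hinv, hL', hsz, hE, hJ⟩, hfr⟩
  refine ⟨L', m', B', J', K', E', ⟨hinv, ?_, ?_, ?_, hRn, ?_⟩, ?_⟩
  · intro y
    rw [hL', hcov, Finset.coe_insert, cover_insert, Set.mem_union]
  · rw [Finset.coe_insert]
    exact htree.insert hdc (by simpa using huC) hmax
  · rw [hfr.1 6 (by decide), hR]
  · intro v hv
    rw [hL']
    rcases hmem v hv with h | rfl
    · exact Or.inl h
    · exact Or.inr (self_mem_closedNbhd v)
  · have := openSize_insert (adj := adj) huC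
    unfold searchPotential
    omega

/-- Every branch of a pass ends in a state in which the potential has dropped by more than the time
that was needed. -/
theorem SearchState.runs_step (hadj : IsAdjacencyList G adj) (hdc : IsDuallyChordal G)
    (hG : HasGraph adj s) (hn : s.reg 0 = (n : ℤ)) {R : ℕ}
    (h : SearchState G s L m C B J K E R) (hpos : R < n ∨ 0 < J) :
    ∃ D, Runs Prog.searchStep s D (fun s' => ∃ L' m' C' B' J' K' E' R',
        SearchState G s' L' m' C' B' J' K' E' R' ∧ s'.reg 7 = (n : ℤ) - R' + J' ∧
        D + 1 + searchPotential adj L' C' J' E' R' ≤ searchPotential adj L C J E R) := by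
  have hcover : cover G (C : Set (Fin n)) = {y | y ∈ L} := Set.ext fun y => (h.cov y).symm
  suffices hmain : ∃ D, Runs (.ite 5
    (.instr (.load 15 6 5) ⨾
      .ite 15
        ((.instr (.load 16 7 15) ⨾ .instr (.store 6 5 16) ⨾ .instr (.load 8 8 15) ⨾
            .instr (.load 16 4 8) ⨾ .instr (.const 17 1) ⨾ .instr (.sub 16 17 16)) ⨾
          .ite 16 Prog.process .skip)
        (.instr (.const 16 1) ⨾ .instr (.sub 5 5 16)))
    ((.instr (.load 15 3 6) ⨾ .instr (.const 16 0) ⨾ .instr (.add 8 6 16) ⨾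
        .instr (.const 16 1) ⨾ .instr (.sub 15 16 15) ⨾ .instr (.add 6 6 16)) ⨾
      .ite 15 Prog.process .skip)) s (D + 1) (fun s' => ∃ L' m' C' B' J' K' E' R',
        SearchState G s' L' m' C' B' J' K' E' R' ∧
        D + 4 + searchPotential adj L' C' J' E' R' ≤ searchPotential adj L C J E R) by
    obtain ⟨D, hD⟩ := hmain
    refine ⟨D + 1 + 2, Runs.seq (hD.frame.mono le_rfl ?_)⟩
    rintro s' ⟨⟨L', m', C', B', J', K', E', R', hs', hpot⟩, hfr⟩
    refine Runs.straight (by rfl) (by decide) ?_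
    set s₁ := Program.run _ s' with hs₁
    have hfr1 : SameExcept [7] [] s' s₁ := by
      constructor <;> intro r hr <;>
        simp only [List.mem_cons, not_or, List.not_mem_nil, not_false_eq_true, and_true] at hr <;>
        simp [s₁, Program.run, Instr.apply, hr]
    refine ⟨L', m', C', B', J', K', E', R', ⟨hs'.inv.of_sameExcept hfr1 (by decide) (by decide)
      (by decide), hs'.cov, hs'.tree, ?_, hs'.cand_le, hs'.mem⟩, ?_, by omega⟩
    · rw [hfr1.1 6 (by decide), hs'.cand]
    · have h0 : s'.reg 0 = (n : ℤ) := by rw [hfr.1 0 (by decide), hn]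
      simp [s₁, Program.run, Instr.apply, h0, hs'.cand, hs'.inv.rep.top]
  by_cases hJ : 0 < J
  · cases hB : B J with
    | nil =>
      -- the last bucket is empty
      have hp : s.arr 6 (J : ℤ) = 0 := by
        have := h.inv.rep.chain J
        rwa [hB] at this
      refine ⟨4, Runs.ite (fun _ => ?_) (fun hle => ?_)⟩
      · refine (Runs.seq (B₁ := 1) (B₂ := 3) (Runs.instr ?_)).mono (by omega) fun _ h => h
        refine Runs.ite (fun h15 => ?_) fun _ => ?_
        · simp [Instr.apply, h.inv.rep.top, hp] at h15
        refine Runs.straight (by rfl) (by decide) ?_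
        set s₁ := Program.run _ _ with hs₁
        have hfr1 : SameExcept [5, 15, 16] [] s s₁ := by
          constructor <;> intro r hr <;>
            simp only [List.mem_cons, not_or, List.not_mem_nil, not_false_eq_true,
              and_true] at hr <;>
            simp [s₁, Program.run, Instr.apply, hr]
        refine ⟨L, m, C, B, J - 1, K, E, R, ⟨⟨?_, h.inv.queue.lower hB, h.inv.numbering⟩, h.cov,
          h.tree, by rw [hfr1.1 6 (by decide), h.cand], h.cand_le, h.mem⟩, ?_⟩
        · have ha : s₁.arr = s.arr := funext fun a => hfr1.2 a (by simp)
          obtain ⟨a1, a2, a3, a4, a5, a6, a7, a8, a9⟩ := h.inv.rep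
          constructor <;> (try rw [ha]) <;> try assumption
          · simp [s₁, Program.run, Instr.apply, a3]
            omega
        · unfold searchPotential
          omega
      · rw [h.inv.rep.top] at hle
        omega
    | cons v l =>
      have hch := h.inv.rep.chain J
      rw [hB] at hch
      obtain ⟨hp0, hpK, hval, hnext⟩ := hch
      obtain ⟨hq, hE1⟩ := h.inv.queue.pop hB
      obtain ⟨hvL, hJ1, hJv⟩ := h.inv.queue.ent J v (by simp [hB])
      -- the memory after the removal of the entry
      have key : ∀ s₁ : Memory, SameExcept [8, 15, 16, 17] [6] s s₁ →
          s₁.arr 6 = Function.update (s.arr 6) (J : ℤ) (s.arr 7 (s.arr 6 (J : ℤ))) →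
          SearchRep s₁ L m C (numCount G L) (Function.update B J l) J K := by
        intro s₁ hfr1 h6
        obtain ⟨a1, a2, a3, a4, a5, a6, a7, a8, a9⟩ := h.inv.rep
        constructor
        · rw [hfr1.1 3 (by decide), a1]
        · rw [hfr1.1 4 (by decide), a2]
        · rw [hfr1.1 5 (by decide), a3]
        · rw [hfr1.2 3 (by decide)]; exact a4
        · rw [hfr1.2 4 (by decide)]; exact a5
        · rw [hfr1.2 5 (by decide)]; exact a6
        · intro b
          rw [hfr1.2 7 (by decide), hfr1.2 8 (by decide), h6]
          by_cases hb : b = J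
          · subst hb
            simpa using hnext
          · rw [Function.update_of_ne hb, Function.update_of_ne (by exact_mod_cast hb)]
            exact a7 b
        · rw [hfr1.2 9 (by decide)]; exact a8
        · rw [hfr1.2 10 (by decide)]; exact a9
      by_cases hvC : v ∈ C
      · refine ⟨9, Runs.ite (fun _ => ?_) (fun hle => ?_)⟩
        · refine (Runs.seq (B₁ := 1) (B₂ := 8) (Runs.instr ?_)).mono (by omega) fun _ h => h
          refine Runs.ite (fun _ => ?_) fun h15 => ?_
          · refine (Runs.seq (B₁ := 6) (B₂ := 1)
              (Runs.straight (by rfl) (by decide) ?_)).mono (by omega) fun _ h => h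
            set s₁ := Program.run _ _ with hs₁
            have hfr1 : SameExcept [8, 15, 16, 17] [6] s s₁ := by
              constructor <;> intro r hr <;>
                simp only [List.mem_cons, not_or, List.not_mem_nil, not_false_eq_true,
                  and_true] at hr <;>
                simp [s₁, Program.run, Instr.apply, hr]
            have hrep := key s₁ hfr1 (by simp [s₁, Program.run, Instr.apply, h.inv.rep.top])
            refine Runs.ite (B := 0) (fun h16 => ?_) fun _ => ?_
            · simp [s₁, Program.run, Instr.apply, h.inv.rep.top, hval, h.inv.rep.done, hvC] at h16
            · refine Runs.skip ⟨L, m, C, _, J, K, E - 1, R, ⟨⟨hrep, hq.mono ?_ subset_rfl,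
                h.inv.numbering⟩, h.cov, h.tree, by rw [hfr1.1 6 (by decide), h.cand],
                h.cand_le, h.mem⟩, ?_⟩
              · rintro y ⟨hy, hyC⟩
                exact ⟨⟨hy, hyC⟩, fun e => hyC (by rw [Set.mem_singleton_iff.1 e]; exact hvC)⟩
              · unfold searchPotential
                omega
          · simp [Instr.apply, h.inv.rep.top] at h15
            omega
        · rw [h.inv.rep.top] at hle
          omega
      · obtain ⟨s₁, hs₁⟩ : ∃ s₁, s₁ = (Program.instr (.load 16 7 15) ⨾ .instr (.store 6 5 16) ⨾
            .instr (.load 8 8 15) ⨾ .instr (.load 16 4 8) ⨾ .instr (.const 17 1) ⨾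
            .instr (.sub 16 17 16)).run ((Instr.load 15 6 5).apply s) := ⟨_, rfl⟩
        have hfr1 : SameExcept [8, 15, 16, 17] [6] s s₁ := by
          constructor <;> intro r hr <;>
            simp only [List.mem_cons, not_or, List.not_mem_nil, not_false_eq_true,
              and_true] at hr <;>
            simp [hs₁, Program.run, Instr.apply, hr]
        have hrep := key s₁ hfr1 (by simp [hs₁, Program.run, Instr.apply, h.inv.rep.top])
        have h8 : s₁.reg 8 = ((v : ℕ) : ℤ) := by
          simp [hs₁, Program.run, Instr.apply, h.inv.rep.top, hval]
        obtain ⟨D, hD⟩ := SearchInv.runs_process' (u := v) (R := R) (E := E - 1) hadj hdc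
          (hG.congr (hfr1.2 0 (by decide)) (hfr1.2 1 (by decide))) hrep
          (hq.mono (by
            rintro y ⟨hy, hyC⟩
            rw [Finset.mem_insert, not_or] at hyC
            exact ⟨⟨hy, hyC.2⟩, hyC.1⟩) subset_rfl) h.inv.numbering h.cov h.tree hvC (by
            -- the entry is up to date, so that the count of `v` is the largest one
            refine isMaximalChoice_of_card ((h.cov v).1 hvL) fun p hp hpC => ?_
            rw [hcover]
            exact (h.inv.queue.cnt_le (y := p) ⟨(h.cov p).2 hp, by simpa using hpC⟩).trans hJv)
          (Or.inl hvL) h8 (by rw [hfr1.1 6 (by decide), h.cand]) h.cand_le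
          fun y hy => Or.inl (h.mem y hy)
        refine ⟨D + 10 + 9, Runs.ite (fun _ => ?_) (fun hle => ?_)⟩
        · refine (Runs.seq (B₁ := 1) (B₂ := D + 10 + 8) (Runs.instr ?_)).mono (by omega)
            fun _ h => h
          refine Runs.ite (fun _ => ?_) fun h15 => ?_
          · refine (Runs.seq (B₁ := 6) (B₂ := D + 10 + 1)
              (Runs.straight (by rfl) (by decide) ?_)).mono (by omega) fun _ h => h
            rw [← hs₁]
            refine Runs.ite (fun _ => ?_) fun h16 => ?_
            · refine hD.mono le_rfl ?_
              rintro s' ⟨L', m', B', J', K', E', hst, hpot⟩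
              refine ⟨L', m', _, B', J', K', E', R, hst, ?_⟩
              have : searchPotential adj L C J (E - 1) R + 30 = searchPotential adj L C J E R := by
                unfold searchPotential
                omega
              omega
            · simp [hs₁, Program.run, Instr.apply, h.inv.rep.top, hval, h.inv.rep.done, hvC] at h16
          · simp [Instr.apply, h.inv.rep.top] at h15
            omega
        · rw [h.inv.rep.top] at hle
          omega
  · have hJ0 : J = 0 := by omega
    have hRn : R < n := by omega
    set r : Fin n := ⟨R, hRn⟩ with hr
    -- all buckets are empty, so that all numbered vertices are done
    have hLC : ∀ y ∈ L, y ∈ C := by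
      intro y hy
      by_contra hyC
      have h1 := h.inv.queue.mem y ⟨hy, hyC⟩
      have h2 := h.inv.queue.le _ y h1
      have h3 := (h.inv.queue.ent _ y h1).2.1
      omega
    have hsub : cover G (C : Set (Fin n)) ⊆ C := fun y hy => hLC y ((h.cov y).2 hy)
    obtain ⟨s₁, hs₁⟩ : ∃ s₁, s₁ = (Program.instr (.load 15 3 6) ⨾ .instr (.const 16 0) ⨾
        .instr (.add 8 6 16) ⨾ .instr (.const 16 1) ⨾ .instr (.sub 15 16 15) ⨾
        .instr (.add 6 6 16)).run s := ⟨_, rfl⟩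
    have hfr1 : SameExcept [6, 8, 15, 16] [] s s₁ := by
      constructor <;> intro i hi <;>
        simp only [List.mem_cons, not_or, List.not_mem_nil, not_false_eq_true,
          and_true] at hi <;>
        simp [hs₁, Program.run, Instr.apply, hi]
    have hinv := h.inv.of_sameExcept hfr1 (by decide) (by decide) (by decide)
    have h6 : s₁.reg 6 = ((R + 1 : ℕ) : ℤ) := by
      simp [hs₁, Program.run, Instr.apply, h.cand]
    have h8 : s₁.reg 8 = ((r : ℕ) : ℤ) := by
      simp [hs₁, Program.run, Instr.apply, h.cand, hr]
    have h15 : s₁.reg 15 = 1 - if r ∈ L then 1 else 0 := by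
      rw [← h.inv.rep.numbered r]
      simp [hs₁, Program.run, Instr.apply, h.cand, hr]
    have hmem : ∀ v : Fin n, (v : ℕ) < R + 1 → v ∈ L ∨ v = r := by
      intro v hv
      by_cases hvR : (v : ℕ) < R
      · exact Or.inl (h.mem v hvR)
      · exact Or.inr (Fin.ext (by simp only [hr]; omega))
    have hpot : searchPotential adj L C J E (R + 1) + 30 = searchPotential adj L C J E R := by
      unfold searchPotential
      omega
    by_cases hrL : r ∈ L
    · refine ⟨7, Runs.ite (fun h5 => ?_) fun _ => ?_⟩
      · rw [h.inv.rep.top] at h5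
        omega
      · refine (Runs.seq (B₁ := 6) (B₂ := 1)
          (Runs.straight (by rfl) (by decide) ?_)).mono (by omega) fun _ h => h
        rw [← hs₁]
        refine Runs.ite (B := 0) (fun hp => ?_) fun _ => ?_
        · rw [h15, if_pos hrL] at hp
          simp at hp
        · exact Runs.skip ⟨L, m, C, B, J, K, E, R + 1, ⟨hinv, h.cov, h.tree, h6, hRn,
            fun v hv => (hmem v hv).elim id fun e => e ▸ hrL⟩, by omega⟩
    · have hrC : r ∉ C := fun hC => hrL ((h.cov r).2 (subset_cover _ (by simpa using hC)))
      obtain ⟨D, hD⟩ := SearchInv.runs_process' (u := r) (R := R + 1) (E := E) hadj hdc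
        (hG.congr (hfr1.2 0 (by decide)) (hfr1.2 1 (by decide))) hinv.rep
        (hinv.queue.mono (by
          rintro y ⟨hy, hyC⟩
          rw [Finset.mem_insert, not_or] at hyC
          exact ⟨hy, hyC.2⟩) subset_rfl) h.inv.numbering h.cov h.tree hrC
        (isMaximalChoice_of_cover_subset hsub) (Or.inr hsub) h8 h6 hRn hmem
      refine ⟨D + 10 + 7, Runs.ite (fun h5 => ?_) fun _ => ?_⟩
      · rw [h.inv.rep.top] at h5
        omega
      · refine (Runs.seq (B₁ := 6) (B₂ := D + 10 + 1)
          (Runs.straight (by rfl) (by decide) ?_)).mono (by omega) fun _ h => h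
        rw [← hs₁]
        refine Runs.ite (fun _ => ?_) fun hneg => ?_
        · refine hD.mono le_rfl ?_
          rintro s' ⟨L', m', B', J', K', E', hst, hpot'⟩
          exact ⟨L', m', _, B', J', K', E', R + 1, hst, by omega⟩
        · rw [h15, if_neg hrL] at hneg
          simp at hneg

/-- The search numbers all vertices, within linear time. -/
theorem runs_search (hadj : IsAdjacencyList G adj) (hdc : IsDuallyChordal G)
    (hG : HasGraph adj s₀) (hn : s₀.reg 0 = (n : ℤ))
    (hz : ∀ a, 3 ≤ a → ∀ i, s₀.arr a i = 0) :
    Runs Prog.search s₀ (155 * totalSize adj + 7) (fun s => ∃ (L : List (Fin n))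
      (m : Fin n → Fin n),
      IsNumbering G m L ∧ (∀ v, v ∈ L) ∧ L.length = n ∧
      (∀ (i : ℕ) (hi : i < L.length), s.arr 9 (i : ℤ) = ((L[i] : ℕ) : ℤ)) ∧
      ∀ v : Fin n, s.arr 10 ((v : ℕ) : ℤ) = ((m v : ℕ) : ℤ)) := by
  refine (Runs.seq (B₁ := 6) (B₂ := 155 * totalSize adj + 1)
    (Runs.straight (by rfl) (by decide) ?_)).mono (by omega) fun _ h => h
  set s₁ := Program.run _ s₀ with hs₁
  have hfr1 : SameExcept [3, 4, 5, 6, 7, 16] [] s₀ s₁ := by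
    constructor <;> intro r hr <;>
      simp only [List.mem_cons, not_or, List.not_mem_nil, not_false_eq_true, and_true] at hr <;>
      simp [s₁, Program.run, Instr.apply, hr]
  have hz1 : ∀ a, 3 ≤ a → ∀ i, s₁.arr a i = 0 := fun a ha i => by
    rw [hfr1.2 a (by simp), hz a ha]
  have hcnt0 : ∀ v, numCount G [] v = 0 := fun v => by simp [numCount]
  have hinit : SearchState G s₁ [] id ∅ (fun _ => []) 0 0 0 0 := by
    refine ⟨⟨⟨?_, ?_, ?_, ?_, ?_, ?_, ?_, ?_, ?_⟩, ⟨?_, ?_, ?_, ?_⟩, trivial⟩, ?_, Or.inl (by simp),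
      ?_, Nat.zero_le _, ?_⟩
    · simp [s₁, Program.run, Instr.apply, hn]
    · simp [s₁, Program.run, Instr.apply]
    · simp [s₁, Program.run, Instr.apply]
    · intro v; simp [hz1]
    · intro v; simp [hz1]
    · intro v; simp [hz1, hcnt0]
    · intro b; exact hz1 6 (by omega) _
    · simp
    · simp
    · simp
    · simp
    · simp
    · simp
    · intro y; simp [cover]
    · simp [s₁, Program.run, Instr.apply]
    · intro v hv; omega
  have hsum : n ≤ totalSize adj := by
    unfold totalSize
    rw [Finset.sum_add_distrib]
    simp
  have hpot : searchPotential adj [] ∅ 0 0 0 ≤ 155 * totalSize adj := by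
    have h1 : restSize adj [] = totalSize adj := by simp [restSize, totalSize]
    have h2 : openSize adj ∅ = totalSize adj := by simp [openSize, totalSize]
    unfold searchPotential
    rw [h1, h2]
    omega
  refine (Runs.whilePos (fun φ s => ∃ L m C B J K E R, SearchState G s L m C B J K E R ∧
      s.reg 7 = (n : ℤ) - R + J ∧ SameExcept Prog.search.regs Prog.search.arrs s₀ s ∧
      searchPotential adj L C J E R = φ) ?_ _ s₁ ⟨[], id, ∅, _, 0, 0, 0, 0, hinit, ?_, ?_,
      rfl⟩).mono (by omega) ?_
  · rintro φ s ⟨L, m, C, B, J, K, E, R, hst, h7, hfr, rfl⟩ hpos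
    have hRn := hst.cand_le
    obtain ⟨D, hD⟩ := hst.runs_step (adj := adj) hadj hdc
      (hG.congr (hfr.2 0 (by decide)) (hfr.2 1 (by decide)))
      (by rw [hfr.1 0 (by decide), hn]) (by omega)
    refine ⟨D, hD.frame.mono le_rfl ?_⟩
    rintro s' ⟨⟨L', m', C', B', J', K', E', R', hst', h7', hpot'⟩, hfr'⟩
    refine ⟨_, hpot', L', m', C', B', J', K', E', R', hst', h7', hfr.trans (hfr'.mono ?_ ?_), rfl⟩
    · exact List.subset_append_right _ _
    · exact List.subset_append_right _ _
  · simp [s₁, Program.run, Instr.apply, hn]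
  · exact hfr1.mono (by decide) (by simp)
  · rintro s ⟨⟨φ, L, m, C, B, J, K, E, R, hst, h7, hfr, -⟩, hle⟩
    have hRn := hst.cand_le
    have hall : ∀ v, v ∈ L := fun v => hst.mem v (by have := v.2; omega)
    have hlen : L.length = n := by
      have h1 := List.toFinset_card_of_nodup hst.inv.numbering.nodup
      rw [← h1, Finset.eq_univ_iff_forall.2 fun v => List.mem_toFinset.2 (hall v)]
      simp
    refine ⟨L, m, hst.inv.numbering, hall, hlen, fun i hi => ?_, fun v => hst.inv.rep.mv v (hall v)⟩
    have := hst.inv.rep.sig i hi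
    rw [hlen] at this
    simpa using this

end Search

/-! ### The program for the two loops -/

namespace Prog

/-- Register `23` := sum of the weights in array `16`. -/
def sumWeights : Program :=
  .instr (.const 23 0) ⨾ .forUp 24 0 (.instr (.load 25 16 24) ⨾ .instr (.add 23 23 25))

/-- Register `26` := `M`, from the sum of the weights in register `23` and `k` in register `20`;
register `27` := `-k`. -/
def bigM : Program :=
  .instr (.const 26 1) ⨾ .instr (.sub 25 23 20) ⨾
  .ite 25 (.instr (.add 26 23 26)) (.instr (.add 26 20 26)) ⨾
  .instr (.const 27 0) ⨾ .instr (.sub 27 27 20)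

/-- For the vertex in register `24`: its modified weight, in arrays `11` and `17`, and zeros in
arrays `12`, …, `15`. Register `27` grows by `M`. -/
def initVertex : Program :=
  (.instr (.add 27 27 26) ⨾ .instr (.const 28 0)) ⨾
  .forClosed 24 29 30 31 (.instr (.add 28 28 26)) ⨾
  (.instr (.load 25 16 24) ⨾ .instr (.sub 28 28 25) ⨾ .instr (.store 11 24 28) ⨾
    .instr (.store 17 24 28) ⨾ .instr (.const 25 0) ⨾ .instr (.store 12 24 25) ⨾
    .instr (.store 13 24 25) ⨾ .instr (.store 14 24 25) ⨾ .instr (.store 15 24 25))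

/-- One pass of the first loop, for the index in register `24`. -/
def markVertex : Program :=
  (.instr (.load 32 9 24) ⨾ .instr (.load 28 11 32)) ⨾
  .forClosed 32 29 30 31 (.instr (.load 25 12 31) ⨾ .instr (.sub 28 28 25)) ⨾
  (.instr (.store 11 32 28) ⨾
    .ite 28
      (.instr (.const 25 1) ⨾ .instr (.store 13 32 25) ⨾ .instr (.load 33 10 32) ⨾
        .instr (.load 25 12 33) ⨾ .instr (.add 25 25 28) ⨾ .instr (.store 12 33 25))
      .skip)

/-- One pass of the second loop; register `24` counts the passes. Register `34` is the modified
weight of the chosen set, register `22` its size. -/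
def selectVertex : Program :=
  (.instr (.const 25 1) ⨾ .instr (.sub 32 0 24) ⨾ .instr (.sub 32 32 25) ⨾
    .instr (.load 32 9 32) ⨾ .instr (.load 25 13 32) ⨾ .instr (.load 33 10 32) ⨾
    .instr (.load 33 14 33) ⨾ .instr (.sub 25 25 33)) ⨾
  .ite 25
    ((.instr (.const 25 1) ⨾ .instr (.store 15 32 25) ⨾ .instr (.load 33 17 32) ⨾
        .instr (.add 34 34 33) ⨾ .instr (.add 22 22 25)) ⨾
      .forClosed 32 29 30 31 (.instr (.const 25 1) ⨾ .instr (.store 14 31 25)))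
    .skip

/-- Register `21` := `1` if the modified weight in register `34` is at least the bound in
register `27`, and `0` otherwise. -/
def decideAnswer : Program :=
  .instr (.const 21 1) ⨾ .instr (.sub 25 34 27) ⨾ .instr (.add 25 25 21) ⨾
  .ite 25 .skip (.instr (.const 21 0))

/-- The part of the algorithm after the transformation to nonnegative weights; the weights are in
array `16`, the bound is in register `20`. -/
def mainPart : Program :=
  sumWeights ⨾ bigM ⨾ .forUp 24 0 initVertex ⨾ .forUp 24 0 markVertex ⨾
  (.instr (.const 34 0) ⨾ .instr (.const 22 0)) ⨾ .forUp 24 0 selectVertex ⨾ decideAnswer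

end Prog

section MainPart

variable {n : ℕ} {G : SimpleGraph (Fin n)} [DecidableRel G.Adj] {adj : Fin n → List (Fin n)}
  {s s' s₀ : Memory}

theorem IsAdjacencyList.nbhd_eq (hadj : IsAdjacencyList G adj) (v : Fin n) :
    nbhd G v = (v :: adj v).toFinset := by
  ext y
  rw [mem_nbhd, List.mem_toFinset, hadj.mem_cons]

theorem IsAdjacencyList.card_nbhd (hadj : IsAdjacencyList G adj) (v : Fin n) :
    (nbhd G v).card = (adj v).length + 1 := by
  rw [hadj.nbhd_eq, List.toFinset_card_of_nodup (hadj.nodup_cons v), List.length_cons]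

theorem IsAdjacencyList.sum_nbhd (hadj : IsAdjacencyList G adj) (v : Fin n) (f : Fin n → ℤ) :
    ∑ y ∈ nbhd G v, f y = ((v :: adj v).map f).sum := by
  rw [hadj.nbhd_eq, List.sum_toFinset _ (hadj.nodup_cons v)]

/-- The cost of a pass whose time is linear in the degree of the vertex `τ k`. -/
def vertexCost (adj : Fin n → List (Fin n)) (τ : Fin n ≃ Fin n) (a b k : ℕ) : ℕ :=
  if h : k < n then a * ((adj (τ ⟨k, h⟩)).length + 1) + b else 0

theorem sum_vertexCost_le (τ : Fin n ≃ Fin n) (a b : ℕ) :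
    ∑ k ∈ Finset.range n, (vertexCost adj τ a b k + 4) ≤ (a + b + 4) * totalSize adj := by
  rw [Finset.sum_range]
  have : ∀ i : Fin n, vertexCost adj τ a b i + 4 ≤
      (a + b + 4) * ((adj (τ i)).length + 1) := by
    intro i
    simp only [vertexCost, i.2, dif_pos]
    nlinarith [Nat.zero_le ((b + 4) * (adj (τ i)).length)]
  calc _ ≤ ∑ i, (a + b + 4) * ((adj (τ i)).length + 1) := Finset.sum_le_sum fun i _ => this i
    _ = ∑ i, (a + b + 4) * ((adj i).length + 1) :=
        Equiv.sum_comp τ (fun i => (a + b + 4) * ((adj i).length + 1))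
    _ = _ := by rw [← Finset.mul_sum]; rfl

theorem le_totalSize (adj : Fin n → List (Fin n)) : n ≤ totalSize adj := by
  unfold totalSize
  rw [Finset.sum_add_distrib]
  simp

theorem runs_sumWeights (hn : s₀.reg 0 = (n : ℤ)) {W : Fin n → ℤ}
    (hW : ∀ v : Fin n, s₀.arr 16 ((v : ℕ) : ℤ) = W v) :
    Runs Prog.sumWeights s₀ (6 * n + 4) (fun s => s.reg 23 = ∑ v, W v) := by
  refine (Runs.seq (B₁ := 1) (B₂ := 6 * n + 3) (Runs.instr ?_)).mono (by omega) fun _ h => h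
  have hfr := (Instr.const 23 0).sameExcept s₀
  refine (Runs.forUp (N := n) (fun k s => s.reg 23 = ∑ i ∈ Finset.range k, s₀.arr 16 (i : ℤ))
    (fun _ => 2) (by decide) (by decide) (by decide) ?_ ?_ ?_ ?_).mono ?_ ?_
  · rintro k s s' hs h
    rw [hs.1 23 (by decide), h]
  · rw [hfr.1 0 (by decide), hn]
  · simp [Instr.apply]
  · rintro k hk s hsame hi h
    refine Runs.straight (by rfl) (by decide) ?_
    have h16 : s.arr 16 = s₀.arr 16 := by rw [hsame.2 16 (by decide), hfr.2 16 (by decide)]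
    rw [Finset.sum_range_succ, ← h, ← h16]
    simp [Program.run, Instr.apply, hi]
  · simp; omega
  · intro s h
    rw [h, Finset.sum_range]
    exact Finset.sum_congr rfl fun v _ => hW v

theorem runs_bigM {S k : ℤ} (hS : s.reg 23 = S) (hk : s.reg 20 = k) :
    Runs Prog.bigM s 6 (fun s => s.reg 26 = max S k + 1 ∧ s.reg 27 = -k) := by
  refine Runs.straight (by rfl) (by decide) ?_
  by_cases h : k < S
  · simp [Prog.bigM, Program.run, Instr.apply, hS, hk, h, max_eq_left h.le]
  · simp [Prog.bigM, Program.run, Instr.apply, hS, hk, h, max_eq_right (not_lt.1 h)]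

/-- The memory before the two loops, for the modified weights `ω`. -/
structure InitRep (s : Memory) (ω : Fin n → ℤ) (k : ℕ) : Prop where
  omega : ∀ v : Fin n, (v : ℕ) < k → s.arr 11 ((v : ℕ) : ℤ) = ω v
  omega' : ∀ v : Fin n, (v : ℕ) < k → s.arr 17 ((v : ℕ) : ℤ) = ω v
  zero : ∀ v : Fin n, (v : ℕ) < k → s.arr 12 ((v : ℕ) : ℤ) = 0 ∧ s.arr 13 ((v : ℕ) : ℤ) = 0 ∧
    s.arr 14 ((v : ℕ) : ℤ) = 0 ∧ s.arr 15 ((v : ℕ) : ℤ) = 0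

theorem runs_initVertex (hadj : IsAdjacencyList G adj) (hG : HasGraph adj s) {v : Fin n}
    (hv : s.reg 24 = ((v : ℕ) : ℤ)) {M k : ℤ} {W : Fin n → ℤ} (hM : s.reg 26 = M)
    (hW : s.arr 16 ((v : ℕ) : ℤ) = W v) (hk : s.reg 27 = k)
    (h : InitRep s (fun v => M * ((nbhd G v).card : ℤ) - W v) v) :
    Runs Prog.initVertex s (6 * ((adj v).length + 1) + 19) (fun s' =>
      InitRep s' (fun v => M * ((nbhd G v).card : ℤ) - W v) (v + 1) ∧ s'.reg 27 = k + M) := by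
  refine (Runs.seq (B₁ := 2) (B₂ := (6 * ((adj v).length + 1) + 8) + 9)
    (Runs.straight (by rfl) (by decide) ?_)).mono (by omega) fun _ h => h
  obtain ⟨s₁, hs₁⟩ : ∃ s₁, s₁ = (Program.instr (.add 27 27 26) ⨾ .instr (.const 28 0)).run s :=
    ⟨_, rfl⟩
  rw [← hs₁]
  have hfr1 : SameExcept [27, 28] [] s s₁ := by
    constructor <;> intro r hr <;>
      simp only [List.mem_cons, not_or, List.not_mem_nil, not_false_eq_true, and_true] at hr <;>
      simp [hs₁, Program.run, Instr.apply, hr]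
  refine Runs.seq ((Runs.forClosed (adj := adj) (x := v)
    (fun pre s => s.reg 28 = M * (pre.length : ℤ)) (fun _ => 1) (by decide) (by decide)
    (by decide) (by decide) (by decide) (by decide) ?_
    (hG.congr (hfr1.2 0 (by decide)) (hfr1.2 1 (by decide))) ?_ ?_ ?_).frame.mono ?_ ?_)
  · rintro l s s' hs h
    rw [hs.1 28 (by decide), h]
  · rw [hfr1.1 24 (by decide), hv]
  · simp [hs₁, Program.run, Instr.apply]
  · rintro pre z - s₂ hsame hz h2
    refine Runs.instr ?_
    have h26 : s₂.reg 26 = M := by rw [hsame.1 26 (by decide), hfr1.1 26 (by decide), hM]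
    simp [Instr.apply, h2, h26]
    ring
  · simp; omega
  · rintro s₂ ⟨h28, hfr2⟩
    refine Runs.straight (by rfl) (by decide) ?_
    have h24 : s₂.reg 24 = ((v : ℕ) : ℤ) := by
      rw [hfr2.1 24 (by decide), hfr1.1 24 (by decide), hv]
    have h27 : s₂.reg 27 = k + M := by
      rw [hfr2.1 27 (by decide)]
      simp [hs₁, Program.run, Instr.apply, hk, hM]
    have harr : s₂.arr = s.arr := funext fun a => by
      rw [hfr2.2 a (by simp [Program.arrs, Program.forClosed, Program.forLoop, Instr.arrs]),
        hfr1.2 a (by simp)]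
    have hlen : ((v :: adj v).length : ℤ) = ((nbhd G v).card : ℤ) := by
      rw [hadj.card_nbhd, List.length_cons]
    rw [hlen] at h28
    refine ⟨⟨fun u hu => ?_, fun u hu => ?_, fun u hu => ?_⟩, ?_⟩
    · by_cases huv : u = v
      · subst huv
        simp [Program.run, Instr.apply, h24, h28, harr, hW]
      · simp [Program.run, Instr.apply, h24, h28, harr, Fin.val_inj, huv]
        exact h.omega u (by have := Fin.val_ne_of_ne huv; omega)
    · by_cases huv : u = v
      · subst huv
        simp [Program.run, Instr.apply, h24, h28, harr, hW]
      · simp [Program.run, Instr.apply, h24, h28, harr, Fin.val_inj, huv]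
        exact h.omega' u (by have := Fin.val_ne_of_ne huv; omega)
    · by_cases huv : u = v
      · subst huv
        simp [Program.run, Instr.apply, h24]
      · simp [Program.run, Instr.apply, h24, harr, Fin.val_inj, huv]
        exact h.zero u (by have := Fin.val_ne_of_ne huv; omega)
    · simp [Program.run, Instr.apply, h27]

theorem runs_init (hadj : IsAdjacencyList G adj) (hG : HasGraph adj s₀)
    (hn : s₀.reg 0 = (n : ℤ)) {M k : ℤ} {W : Fin n → ℤ} (hM : s₀.reg 26 = M)
    (hW : ∀ v : Fin n, s₀.arr 16 ((v : ℕ) : ℤ) = W v) (hk : s₀.reg 27 = -k) :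
    Runs (.forUp 24 0 Prog.initVertex) s₀ (29 * totalSize adj + 3) (fun s' =>
      InitRep s' (fun v => M * ((nbhd G v).card : ℤ) - W v) n ∧ s'.reg 27 = M * n - k) := by
  refine (Runs.forUp (N := n) (fun i s =>
    InitRep s (fun v => M * ((nbhd G v).card : ℤ) - W v) i ∧ s.reg 27 = M * i - k)
    (vertexCost adj (Equiv.refl _) 6 19) (by decide) (by decide) (by decide) ?_ hn ?_ ?_).mono
    ?_ fun _ h => h
  · rintro i s s' hs ⟨⟨h1, h2, h3⟩, h4⟩
    have harr : s'.arr = s.arr := funext fun a => hs.2 a (by simp)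
    refine ⟨⟨?_, ?_, ?_⟩, ?_⟩
    · rw [harr]; exact h1
    · rw [harr]; exact h2
    · rw [harr]; exact h3
    · rw [hs.1 27 (by decide), h4]
  · exact ⟨⟨by simp, by simp, by simp⟩, by simp [hk]⟩
  · rintro i hi s hsame h24 ⟨h1, h2⟩
    have := runs_initVertex (v := ⟨i, hi⟩) (M := M) (W := W) hadj
      (hG.congr (hsame.2 0 (by decide)) (hsame.2 1 (by decide))) h24
      (by rw [hsame.1 26 (by decide), hM]) (by rw [hsame.2 16 (by decide), hW]) h2 h1
    refine this.mono (by simp [vertexCost, hi]) fun s' h => ⟨h.1, ?_⟩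
    rw [h.2]
    push_cast
    ring
  · have := sum_vertexCost_le (adj := adj) (Equiv.refl _) 6 19
    omega

/-- The memory during the first loop. -/
structure MarkRep (s : Memory) (st : MarkState (Fin n)) : Prop where
  omega : ∀ v : Fin n, s.arr 11 ((v : ℕ) : ℤ) = st.omega v
  omegaP : ∀ v : Fin n, s.arr 12 ((v : ℕ) : ℤ) = st.omegaP v
  marked : ∀ v : Fin n, s.arr 13 ((v : ℕ) : ℤ) = if v ∈ st.marked then 1 else 0

theorem runs_markVertex (hadj : IsAdjacencyList G adj) (hG : HasGraph adj s) {i : ℕ}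
    {v mv : Fin n} (hi : s.reg 24 = (i : ℤ)) (hv : s.arr 9 (i : ℤ) = ((v : ℕ) : ℤ))
    (hmv : s.arr 10 ((v : ℕ) : ℤ) = ((mv : ℕ) : ℤ)) {st : MarkState (Fin n)}
    (h : MarkRep s st) :
    Runs Prog.markVertex s (7 * ((adj v).length + 1) + 18)
      (fun s' => MarkRep s' (markStep G v mv st)) := by
  refine (Runs.seq (B₁ := 2) (B₂ := (7 * ((adj v).length + 1) + 8) + 8)
    (Runs.straight (by rfl) (by decide) ?_)).mono (by omega) fun _ h => h
  obtain ⟨s₁, hs₁⟩ : ∃ s₁, s₁ = (Program.instr (.load 32 9 24) ⨾ .instr (.load 28 11 32)).run s :=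
    ⟨_, rfl⟩
  rw [← hs₁]
  have hfr1 : SameExcept [32, 28] [] s s₁ := by
    constructor <;> intro r hr <;>
      simp only [List.mem_cons, not_or, List.not_mem_nil, not_false_eq_true, and_true] at hr <;>
      simp [hs₁, Program.run, Instr.apply, hr]
  have h32 : s₁.reg 32 = ((v : ℕ) : ℤ) := by simp [hs₁, Program.run, Instr.apply, hi, hv]
  refine Runs.seq ((Runs.forClosed (adj := adj) (x := v)
    (fun pre s => s.reg 28 = st.omega v - (pre.map st.omegaP).sum) (fun _ => 2) (by decide)
    (by decide) (by decide) (by decide) (by decide) (by decide) ?_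
    (hG.congr (hfr1.2 0 (by decide)) (hfr1.2 1 (by decide))) h32 ?_ ?_).frame.mono ?_ ?_)
  · rintro l s s' hs h
    rw [hs.1 28 (by decide), h]
  · simp [hs₁, Program.run, Instr.apply, hi, hv, h.omega]
  · rintro pre z - s₂ hsame hz h2
    refine Runs.straight (by rfl) (by decide) ?_
    have h12 : s₂.arr 12 = s.arr 12 := by rw [hsame.2 12 (by decide), hfr1.2 12 (by decide)]
    simp [Program.run, Instr.apply, h2, hz, h12, h.omegaP]
    ring
  · simp; omega
  · rintro s₂ ⟨h28, hfr2⟩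
    refine Runs.straight (by rfl) (by decide) ?_
    have h32' : s₂.reg 32 = ((v : ℕ) : ℤ) := by rw [hfr2.1 32 (by decide), h32]
    have harr : s₂.arr = s.arr := funext fun a => by
      rw [hfr2.2 a (by simp [Program.arrs, Program.forClosed, Program.forLoop, Instr.arrs]),
        hfr1.2 a (by simp)]
    rw [← hadj.sum_nbhd] at h28
    unfold markStep
    dsimp only
    by_cases hpos : 0 < st.omega v - ∑ y ∈ nbhd G v, st.omegaP y
    · have hpos' : ∑ y ∈ nbhd G v, st.omegaP y < st.omega v := by linarith
      rw [if_pos hpos]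
      constructor <;> intro u <;>
        simp [Program.run, Instr.apply, h32', h28, harr, hpos', hmv, Function.update_apply,
          Fin.val_inj, h.omega, h.omegaP, h.marked]
      by_cases huv : u = v <;> simp [huv]
    · have hpos' : ¬ ∑ y ∈ nbhd G v, st.omegaP y < st.omega v := by
        intro h; exact hpos (by linarith)
      rw [if_neg hpos]
      constructor <;> intro u <;>
        simp [Program.run, Instr.apply, h32', h28, harr, hpos', Function.update_apply,
          Fin.val_inj, h.omega, h.omegaP, h.marked]

theorem foldl_take_finRange_succ {α : Type*} (f : α → Fin n → α) (a : α) {k : ℕ} (hk : k < n) :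
    ((List.finRange n).take (k + 1)).foldl f a =
      f (((List.finRange n).take k).foldl f a) ⟨k, hk⟩ := by
  rw [List.take_add_one, List.foldl_append]
  simp [List.getElem?_eq_getElem (show k < (List.finRange n).length by simpa using hk)]

theorem foldl_take_reverse_finRange_succ {α : Type*} (f : α → Fin n → α) (a : α) {k : ℕ}
    (hk : k < n) :
    ((List.finRange n).reverse.take (k + 1)).foldl f a =
      f (((List.finRange n).reverse.take k).foldl f a) (Fin.rev ⟨k, hk⟩) := by
  rw [List.take_add_one, List.foldl_append,
    List.getElem?_eq_getElem (show k < (List.finRange n).reverse.length by simpa using hk)]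
  simp only [Option.toList_some, List.foldl_cons, List.foldl_nil]
  congr 1
  rw [List.getElem_reverse]
  simp [Fin.ext_iff]
  omega

variable {σ : Fin n ≃ Fin n} {m : Fin n → Fin n}

/-- Arrays `9` and `10` hold the ordering `σ` and the maximum neighbors `m`. -/
structure HasOrdering (σ : Fin n ≃ Fin n) (m : Fin n → Fin n) (s : Memory) : Prop where
  sig : ∀ i : Fin n, s.arr 9 ((i : ℕ) : ℤ) = ((σ i : ℕ) : ℤ)
  mv : ∀ i : Fin n, s.arr 10 ((σ i : ℕ) : ℤ) = ((m i : ℕ) : ℤ)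

theorem HasOrdering.congr (h : HasOrdering σ m s) (h9 : s'.arr 9 = s.arr 9)
    (h10 : s'.arr 10 = s.arr 10) : HasOrdering σ m s' :=
  ⟨by rw [h9]; exact h.sig, by rw [h10]; exact h.mv⟩

theorem runs_mark (hadj : IsAdjacencyList G adj) (hG : HasGraph adj s₀) (ho : HasOrdering σ m s₀)
    (hn : s₀.reg 0 = (n : ℤ)) {ω : Fin n → ℤ} (h : InitRep s₀ ω n) :
    Runs (.forUp 24 0 Prog.markVertex) s₀ (29 * totalSize adj + 3)
      (fun s' => MarkRep s' (markResult G σ m ω)) := by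
  refine (Runs.forUp (N := n) (fun i s => MarkRep s (((List.finRange n).take i).foldl
      (fun s i => markStep G (σ i) (m i) s) { omega := ω, omegaP := fun _ => 0, marked := ∅ }))
    (vertexCost adj σ 7 18) (by decide) (by decide) (by decide) ?_ hn ?_ ?_).mono ?_ ?_
  · rintro i s s' hs ⟨h1, h2, h3⟩
    have harr : s'.arr = s.arr := funext fun a => hs.2 a (by simp)
    constructor <;> rw [harr] <;> assumption
  · exact ⟨fun v => h.omega v v.2, fun v => (h.zero v v.2).1, fun v => by
      simp [(h.zero v v.2).2.1]⟩
  · rintro i hi s hsame h24 hrep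
    have ho' := ho.congr (hsame.2 9 (by decide)) (hsame.2 10 (by decide))
    have := runs_markVertex (adj := adj) (i := i) hadj
      (hG.congr (hsame.2 0 (by decide)) (hsame.2 1 (by decide))) h24 (ho'.sig ⟨i, hi⟩)
      (ho'.mv ⟨i, hi⟩) hrep
    refine this.mono (by simp [vertexCost, hi]) fun s' h' => ?_
    rw [foldl_take_finRange_succ _ _ hi]
    exact h'
  · have := sum_vertexCost_le (adj := adj) σ 7 18
    omega
  · intro s' h'
    rwa [List.take_of_length_le (by simp)] at h'

/-- The memory during the second loop. -/
structure SelectRep (s : Memory) (ω : Fin n → ℤ) (st : SelectState (Fin n)) : Prop where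
  chosen : ∀ v : Fin n, s.arr 15 ((v : ℕ) : ℤ) = if v ∈ st.chosen then 1 else 0
  blocked : ∀ v : Fin n, s.arr 14 ((v : ℕ) : ℤ) = if v ∈ st.blocked then 1 else 0
  weight : s.reg 34 = ∑ v ∈ st.chosen, ω v
  card : s.reg 22 = (st.chosen.card : ℤ)

theorem runs_selectVertex (hadj : IsAdjacencyList G adj) (hG : HasGraph adj s) {i : ℕ}
    {v mv : Fin n} (hi : s.reg 0 - s.reg 24 - 1 = (i : ℤ))
    (hv : s.arr 9 (i : ℤ) = ((v : ℕ) : ℤ)) (hmv : s.arr 10 ((v : ℕ) : ℤ) = ((mv : ℕ) : ℤ))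
    {ω : Fin n → ℤ} {marked : Finset (Fin n)} {st : SelectState (Fin n)} (h : SelectRep s ω st)
    (hm : ∀ v : Fin n, s.arr 13 ((v : ℕ) : ℤ) = if v ∈ marked then 1 else 0)
    (hω : ∀ v : Fin n, s.arr 17 ((v : ℕ) : ℤ) = ω v) (hvst : v ∉ st.chosen) :
    Runs Prog.selectVertex s (7 * ((adj v).length + 1) + 22)
      (fun s' => SelectRep s' ω (selectStep G marked v mv st)) := by
  refine (Runs.seq (B₁ := 8) (B₂ := (5 + (7 * ((adj v).length + 1) + 8)) + 1)
    (Runs.straight (by rfl) (by decide) ?_)).mono (by omega) fun _ h => h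
  obtain ⟨s₁, hs₁⟩ : ∃ s₁, s₁ = (Program.instr (.const 25 1) ⨾ .instr (.sub 32 0 24) ⨾
      .instr (.sub 32 32 25) ⨾ .instr (.load 32 9 32) ⨾ .instr (.load 25 13 32) ⨾
      .instr (.load 33 10 32) ⨾ .instr (.load 33 14 33) ⨾ .instr (.sub 25 25 33)).run s :=
    ⟨_, rfl⟩
  rw [← hs₁]
  have hfr1 : SameExcept [25, 32, 33] [] s s₁ := by
    constructor <;> intro r hr <;>
      simp only [List.mem_cons, not_or, List.not_mem_nil, not_false_eq_true, and_true] at hr <;>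
      simp [hs₁, Program.run, Instr.apply, hr]
  have h32 : s₁.reg 32 = ((v : ℕ) : ℤ) := by simp [hs₁, Program.run, Instr.apply, hi, hv]
  have h25 : s₁.reg 25 = (if v ∈ marked then 1 else 0) - if mv ∈ st.blocked then 1 else 0 := by
    simp [hs₁, Program.run, Instr.apply, hi, hv, hmv, hm, h.blocked]
  have hcond : 0 < s₁.reg 25 ↔ v ∈ marked ∧ mv ∉ st.blocked := by
    rw [h25]
    split_ifs <;> simp_all
  have harr1 : s₁.arr = s.arr := funext fun a => hfr1.2 a (by simp)
  refine Runs.ite (fun hpos => ?_) fun hneg => ?_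
  · rw [selectStep, if_pos (hcond.1 hpos)]
    refine Runs.seq (Runs.straight (by rfl) (by decide) ?_)
    obtain ⟨s₂, hs₂⟩ : ∃ s₂, s₂ = (Program.instr (.const 25 1) ⨾ .instr (.store 15 32 25) ⨾
        .instr (.load 33 17 32) ⨾ .instr (.add 34 34 33) ⨾ .instr (.add 22 22 25)).run s₁ :=
      ⟨_, rfl⟩
    rw [← hs₂]
    have hfr2 : SameExcept [25, 33, 34, 22] [15] s₁ s₂ := by
      constructor <;> intro r hr <;>
        simp only [List.mem_cons, not_or, List.not_mem_nil, not_false_eq_true, and_true] at hr <;>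
        simp [hs₂, Program.run, Instr.apply, hr]
    refine (Runs.forClosed (adj := adj) (x := v)
      (fun pre s => ∀ u : Fin n, s.arr 14 ((u : ℕ) : ℤ) =
        if u ∈ st.blocked ∨ u ∈ pre then 1 else 0) (fun _ => 2) (by decide)
      (by decide) (by decide) (by decide) (by decide) (by decide) ?_
      (hG.congr ?_ ?_) ?_ ?_ ?_).frame.mono ?_ ?_
    · rintro l s s' hs h
      rw [hs.2 14 (by decide)]
      exact h
    · rw [hfr2.2 0 (by decide), harr1]
    · rw [hfr2.2 1 (by decide), harr1]
    · rw [hfr2.1 32 (by decide), h32]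
    · intro u
      rw [hfr2.2 14 (by decide), harr1, h.blocked]
      simp
    · rintro pre z - s₃ hsame hz h3
      refine Runs.straight (by rfl) (by decide) ?_
      intro u
      by_cases huz : u = z
      · subst huz
        simp [Program.run, Instr.apply, hz]
      · simp [Program.run, Instr.apply, hz, Fin.val_inj, huz, h3]
    · simp; omega
    · rintro s₃ ⟨h14, hfr3⟩
      constructor
      · intro u
        rw [hfr3.2 15 (by decide)]
        simp [hs₂, Program.run, Instr.apply, h32, harr1, Function.update_apply, Fin.val_inj,
          h.chosen]
        by_cases huv : u = v <;> simp [huv]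
      · intro u
        rw [h14]
        simp only [Finset.mem_union, hadj.nbhd_eq, List.mem_toFinset]
      · rw [hfr3.1 34 (by decide), Finset.sum_insert hvst, ← hω v, ← h.weight]
        simp [hs₂, Program.run, Instr.apply, h32, harr1, hfr1.1 34 (by decide)]
        ring
      · rw [hfr3.1 22 (by decide), Finset.card_insert_of_notMem hvst]
        simp [hs₂, Program.run, Instr.apply, hfr1.1 22 (by decide), h.card]
  · rw [selectStep, if_neg fun hc => absurd (hcond.2 hc) (not_lt.2 hneg)]
    refine (Runs.skip ?_).mono (by omega) fun _ h => h
    exact ⟨by rw [harr1]; exact h.chosen, by rw [harr1]; exact h.blocked,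
      by rw [hfr1.1 34 (by decide), h.weight], by rw [hfr1.1 22 (by decide), h.card]⟩

theorem runs_select (hadj : IsAdjacencyList G adj) (hG : HasGraph adj s₀)
    (ho : HasOrdering σ m s₀) (hn : s₀.reg 0 = (n : ℤ)) {ω : Fin n → ℤ}
    {marked : Finset (Fin n)} (h : SelectRep s₀ ω { chosen := ∅, blocked := ∅ })
    (hm : ∀ v : Fin n, s₀.arr 13 ((v : ℕ) : ℤ) = if v ∈ marked then 1 else 0)
    (hω : ∀ v : Fin n, s₀.arr 17 ((v : ℕ) : ℤ) = ω v) :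
    Runs (.forUp 24 0 Prog.selectVertex) s₀ (33 * totalSize adj + 3)
      (fun s' => SelectRep s' ω (selectResult G σ m marked)) := by
  refine (Runs.forUp (N := n) (fun i s => SelectRep s ω (((List.finRange n).reverse.take i).foldl
      (fun s i => selectStep G marked (σ i) (m i) s) { chosen := ∅, blocked := ∅ }) ∧
      ∀ v ∈ (((List.finRange n).reverse.take i).foldl
      (fun s i => selectStep G marked (σ i) (m i) s) { chosen := ∅, blocked := ∅ }).chosen,
        n ≤ (σ.symm v : ℕ) + i)
    (vertexCost adj (Fin.revPerm.trans σ) 7 22) (by decide) (by decide) (by decide) ?_ hn ?_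
    ?_).mono ?_ ?_
  · rintro i s s' hs ⟨⟨h1, h2, h3, h4⟩, h5⟩
    have harr : s'.arr = s.arr := funext fun a => hs.2 a (by simp)
    exact ⟨⟨by rw [harr]; exact h1, by rw [harr]; exact h2, by rw [hs.1 34 (by decide), h3],
      by rw [hs.1 22 (by decide), h4]⟩, h5⟩
  · exact ⟨by simpa using h, by simp⟩
  · rintro i hi s hsame h24 ⟨hrep, hch⟩
    have ho' := ho.congr (hsame.2 9 (by decide)) (hsame.2 10 (by decide))
    have hnot : σ (Fin.rev ⟨i, hi⟩) ∉ (((List.finRange n).reverse.take i).foldl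
      (fun s i => selectStep G marked (σ i) (m i) s) { chosen := ∅, blocked := ∅ }).chosen := by
      intro hmem
      have := hch _ hmem
      rw [Equiv.symm_apply_apply, Fin.val_rev] at this
      simp only at this
      omega
    have := runs_selectVertex (adj := adj) (i := (Fin.rev ⟨i, hi⟩ : Fin n)) hadj
      (hG.congr (hsame.2 0 (by decide)) (hsame.2 1 (by decide)))
      (by rw [hsame.1 0 (by decide), hn, h24, Fin.val_rev]; simp only; omega)
      (ho'.sig (Fin.rev ⟨i, hi⟩))
      (ho'.mv (Fin.rev ⟨i, hi⟩)) (marked := marked) hrep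
      (by rw [hsame.2 13 (by decide)]; exact hm) (by rw [hsame.2 17 (by decide)]; exact hω) hnot
    refine this.mono (by simp [vertexCost, hi]) fun s' h' => ?_
    rw [foldl_take_reverse_finRange_succ _ _ hi]
    refine ⟨h', fun v hv => ?_⟩
    unfold selectStep at hv
    split_ifs at hv
    · rcases Finset.mem_insert.1 hv with rfl | hv
      · rw [Equiv.symm_apply_apply, Fin.val_rev]
        simp only
        omega
      · have := hch v hv
        omega
    · have := hch v hv
      omega
  · have := sum_vertexCost_le (adj := adj) (Fin.revPerm.trans σ) 7 22
    omega
  · rintro s' ⟨h', -⟩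
    rwa [List.take_of_length_le (by simp)] at h'

/-- Register `21`, array `15` and register `22` hold the answer, its vertices and its size. -/
def HoldsAnswer (s : Memory) : Option (Finset (Fin n)) → Prop
  | none => s.reg 21 = 0
  | some D => s.reg 21 = 1 ∧ (∀ v : Fin n, s.arr 15 ((v : ℕ) : ℤ) = if v ∈ D then 1 else 0) ∧
      s.reg 22 = (D.card : ℤ)

theorem runs_mainPart (hadj : IsAdjacencyList G adj) (hG : HasGraph adj s₀)
    (ho : HasOrdering σ m s₀) (hn : s₀.reg 0 = (n : ℤ)) {W : Fin n → ℤ} {k : ℤ}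
    (hW : ∀ v : Fin n, s₀.arr 16 ((v : ℕ) : ℤ) = W v) (hk : s₀.reg 20 = k) :
    Runs Prog.mainPart s₀ (97 * totalSize adj + 30)
      (fun s => HoldsAnswer s (mainPart G σ m W k)) := by
  have hle := le_totalSize adj
  set M : ℤ := max (∑ x, W x) k + 1 with hM
  set ω : Fin n → ℤ := fun v => M * ((nbhd G v).card : ℤ) - W v with hω
  refine (Runs.seq (B₁ := 6 * n + 4) (B₂ := 6 + ((29 * totalSize adj + 3) +
    ((29 * totalSize adj + 3) + (2 + ((33 * totalSize adj + 3) + 5)))))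
    ((runs_sumWeights hn hW).frame.mono le_rfl ?_)).mono (by omega) fun _ h => h
  rintro s₁ ⟨h23, hfr1⟩
  refine Runs.seq ((runs_bigM h23 (k := k) (by rw [hfr1.1 20 (by decide), hk])).frame.mono
    le_rfl ?_)
  rintro s₂ ⟨⟨h26, h27⟩, hfr2⟩
  have harr2 : s₂.arr = s₀.arr := funext fun a => by
    rw [hfr2.2 a (by simp [Prog.bigM, Program.arrs, Instr.arrs]), hfr1.2 a (by
      simp [Prog.sumWeights, Program.forUp, Program.forLoop, Program.arrs, Instr.arrs])]
  have hn2 : s₂.reg 0 = (n : ℤ) := by rw [hfr2.1 0 (by decide), hfr1.1 0 (by decide), hn]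
  refine Runs.seq ((runs_init (M := M) (k := k) (W := W) hadj
    (hG.congr (by rw [harr2]) (by rw [harr2])) hn2 h26 (by rw [harr2]; exact hW) h27).frame.mono
    le_rfl ?_)
  rintro s₃ ⟨⟨hinit, h27'⟩, hfr3⟩
  have hn3 : s₃.reg 0 = (n : ℤ) := by rw [hfr3.1 0 (by decide), hn2]
  have hG3 : HasGraph adj s₃ := hG.congr (by rw [hfr3.2 0 (by decide), harr2])
    (by rw [hfr3.2 1 (by decide), harr2])
  have ho3 : HasOrdering σ m s₃ := ho.congr (by rw [hfr3.2 9 (by decide), harr2])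
    (by rw [hfr3.2 10 (by decide), harr2])
  refine Runs.seq ((runs_mark hadj hG3 ho3 hn3 hinit).frame.mono le_rfl ?_)
  rintro s₄ ⟨hmark, hfr4⟩
  refine Runs.seq (Runs.straight (by rfl) (by decide) ?_)
  obtain ⟨s₅, hs₅⟩ : ∃ s₅, s₅ = (Program.instr (.const 34 0) ⨾ .instr (.const 22 0)).run s₄ :=
    ⟨_, rfl⟩
  rw [← hs₅]
  have hfr5 : SameExcept [34, 22] [] s₄ s₅ := by
    constructor <;> intro r hr <;>
      simp only [List.mem_cons, not_or, List.not_mem_nil, not_false_eq_true, and_true] at hr <;>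
      simp [hs₅, Program.run, Instr.apply, hr]
  refine Runs.seq ((runs_select (ω := ω) (marked := (markResult G σ m ω).marked) hadj
    (hG3.congr ?_ ?_) (ho3.congr ?_ ?_) ?_ ⟨?_, ?_, ?_, ?_⟩ ?_ ?_).frame.mono le_rfl ?_)
  · rw [hfr5.2 0 (by decide), hfr4.2 0 (by decide)]
  · rw [hfr5.2 1 (by decide), hfr4.2 1 (by decide)]
  · rw [hfr5.2 9 (by decide), hfr4.2 9 (by decide)]
  · rw [hfr5.2 10 (by decide), hfr4.2 10 (by decide)]
  · rw [hfr5.1 0 (by decide), hfr4.1 0 (by decide), hn3]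
  · intro v
    rw [hfr5.2 15 (by decide), hfr4.2 15 (by decide), (hinit.zero v v.2).2.2.2]
    simp
  · intro v
    rw [hfr5.2 14 (by decide), hfr4.2 14 (by decide), (hinit.zero v v.2).2.2.1]
    simp
  · simp [hs₅, Program.run, Instr.apply]
  · simp [hs₅, Program.run, Instr.apply]
  · rw [hfr5.2 13 (by decide)]
    exact hmark.marked
  · intro v
    rw [hfr5.2 17 (by decide), hfr4.2 17 (by decide), hinit.omega' v v.2]
  rintro s₆ ⟨hsel, hfr6⟩
  refine Runs.straight (by rfl) (by decide) ?_
  obtain ⟨s₇, hs₇⟩ : ∃ s₇, s₇ = Prog.decideAnswer.run s₆ := ⟨_, rfl⟩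
  rw [← hs₇]
  have h27'' : s₆.reg 27 = M * n - k := by
    rw [hfr6.1 27 (by decide), hfr5.1 27 (by decide), hfr4.1 27 (by decide), h27']
  have h21 : s₇.reg 21 = if M * n - k ≤
      ∑ v ∈ (selectResult G σ m (markResult G σ m ω).marked).chosen, ω v then 1 else 0 := by
    rw [hs₇, ← hsel.weight, ← h27'']
    by_cases hc : s₆.reg 27 ≤ s₆.reg 34
    · have : 0 < s₆.reg 34 - s₆.reg 27 + 1 := by omega
      simp [Prog.decideAnswer, Program.run, Instr.apply, hc, this]
    · have : ¬ 0 < s₆.reg 34 - s₆.reg 27 + 1 := by omega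
      simp [Prog.decideAnswer, Program.run, Instr.apply, hc, this]
  have hfr7 : SameExcept [21, 25] [] s₆ s₇ := by
    have : ∃ t, Exec Prog.decideAnswer s₆ t s₇ := by
      obtain ⟨t, -, ht⟩ := Program.exec_run (p := Prog.decideAnswer) (by rfl) s₆
      exact ⟨t, hs₇ ▸ ht⟩
    obtain ⟨t, ht⟩ := this
    exact ht.sameExcept.mono (by decide) (by decide)
  rw [mainPart_eq, Fintype.card_fin]
  split_ifs with hc
  · rw [if_pos hc] at h21
    refine ⟨h21, ?_, ?_⟩
    · rw [hfr7.2 15 (by decide)]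
      exact hsel.chosen
    · rw [hfr7.1 22 (by decide)]
      exact hsel.card
  · rw [if_neg hc] at h21
    exact h21

end MainPart

/-! ### The program for the whole algorithm -/

namespace Prog

/-- All weights in array `16` and the bound in register `20` := `0`. With these data the two loops
decide whether there is an efficient dominating set. -/
def zeroWeights : Program :=
  .forUp 24 0 (.instr (.const 25 0) ⨾ .instr (.store 16 24 25)) ⨾ .instr (.const 20 0)

/-- Register `35` := the amount `max 0 (-μ)` by which the weights are raised, where `μ` is the
minimum of `k` and all weights. -/
def shiftAmount : Program :=
  (.instr (.const 25 0) ⨾ .instr (.sub 35 25 1) ⨾ .ite 35 .skip (.instr (.const 35 0))) ⨾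
  .forUp 24 0
    (.instr (.load 25 2 24) ⨾ .instr (.add 25 25 35) ⨾ .instr (.const 33 0) ⨾
      .instr (.sub 25 33 25) ⨾ .ite 25 (.instr (.add 35 35 25)) .skip)

/-- Array `16` := the raised weights, register `20` := the raised bound; register `22` holds the
size of an efficient dominating set. -/
def shiftWeights : Program :=
  (.instr (.const 25 0) ⨾ .instr (.add 20 1 25)) ⨾
  .forUp 24 22 (.instr (.add 20 20 35)) ⨾
  .forUp 24 0 (.instr (.load 25 2 24) ⨾ .instr (.add 25 25 35) ⨾ .instr (.store 16 24 25))

/-- The answer of the two loops is made the output. -/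
def writeAnswer : Program :=
  .forUp 24 0 (.instr (.load 25 15 24) ⨾ .instr (.store 0 24 25)) ⨾
  .instr (.const 25 0) ⨾ .instr (.add 0 21 25)

/-- The whole algorithm. The two loops run twice: with zero weights, for the efficient domination
problem, and with the raised weights. -/
def minWED : Program :=
  search ⨾ zeroWeights ⨾ mainPart ⨾ shiftAmount ⨾
  .ite 21 (shiftWeights ⨾ mainPart ⨾ writeAnswer) (.instr (.const 0 0))

/-- Changes the sign of all weights and of the bound. -/
def negate : Program :=
  .forUp 24 0 (.instr (.const 25 0) ⨾ .instr (.load 26 2 24) ⨾ .instr (.sub 25 25 26) ⨾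
    .instr (.store 2 24 25)) ⨾
  .instr (.const 25 0) ⨾ .instr (.sub 1 25 1)

/-- Maximization is minimization with the opposite weights. -/
def maxWED : Program := negate ⨾ minWED

end Prog

/-- The memory `s` holds the instance `(G, w, k)`, with `G` given by the adjacency lists `adj`, in
the form in which `initialMemory` stores it. -/
structure HoldsInstance {n : ℕ} (adj : Fin n → List (Fin n)) (w : Fin n → ℤ) (k : ℤ) (s : Memory) :
    Prop where
  size : s.reg 0 = (n : ℤ)
  bound : s.reg 1 = k
  graph : HasGraph adj s
  weight : ∀ v : Fin n, s.arr 2 ((v : ℕ) : ℤ) = w v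
  zero : ∀ a, 3 ≤ a → ∀ i, s.arr a i = 0

/-- A loop that computes an array `a` cell by cell. -/
theorem Runs.fill {body : Program} {s₀ : Memory} {n a c : ℕ} (f : ℤ → ℤ)
    (hs : body.IsStraight = true) (hc : body.cost ≤ c) (h24 : 24 ∉ body.regs) (h0 : 0 ∉ body.regs)
    (hn : s₀.reg 0 = (n : ℤ))
    (hbody : ∀ s, SameExcept (Program.forUp 24 0 body).regs body.arrs s₀ s →
      s.arr a (s.reg 24) = s₀.arr a (s.reg 24) →
      (body.run s).arr a = Function.update (s.arr a) (s.reg 24) (f (s.reg 24))) :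
    Runs (.forUp 24 0 body) s₀ (n * (c + 4) + 3)
      (fun s => ∀ i : ℕ, i < n → s.arr a (i : ℤ) = f i) := by
  refine (Runs.forUp (N := n) (fun k s => ∀ i : ℕ, s.arr a (i : ℤ) = if i < k then f i else
    s₀.arr a (i : ℤ)) (fun _ => c) (by decide) h24 h0 ?_ hn (by simp) ?_).mono (by simp) ?_
  · intro k s s' hs h
    rw [hs.2 a (by simp)]
    exact h
  · intro k hk s hsame hi h
    refine Runs.straight hs hc fun i => ?_
    rw [hbody s hsame (by rw [hi, h, if_neg (lt_irrefl k)]), hi]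
    by_cases hik : i = k
    · simp [hik]
    · rw [Function.update_of_ne (by exact_mod_cast hik), h]
      congr 1
      rw [eq_iff_iff]
      omega
  · intro s h i hi
    rw [h, if_pos hi]

section MinWED

variable {n : ℕ} {G : SimpleGraph (Fin n)} [DecidableRel G.Adj] {adj : Fin n → List (Fin n)}
  {w : Fin n → ℤ} {k : ℤ} {s : Memory}

theorem runs_zeroWeights (hn : s.reg 0 = (n : ℤ)) :
    Runs Prog.zeroWeights s (6 * n + 4)
      (fun s' => (∀ v : Fin n, s'.arr 16 ((v : ℕ) : ℤ) = 0) ∧ s'.reg 20 = 0) := by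
  refine (Runs.seq (B₂ := 1) ((Runs.fill (c := 2) (a := 16) (fun _ => 0) (by rfl) (by decide)
    (by decide) (by decide) hn ?_).mono le_rfl ?_)).mono (by omega) fun _ h => h
  · intro s _ _
    simp [Program.run, Instr.apply]
  · intro s' h
    refine Runs.instr ⟨fun v => ?_, by simp [Instr.apply]⟩
    simpa [Instr.apply] using h v v.2

theorem runs_shiftAmount (hn : s.reg 0 = (n : ℤ)) (hk : s.reg 1 = k)
    (hw : ∀ v : Fin n, s.arr 2 ((v : ℕ) : ℤ) = w v) :
    Runs Prog.shiftAmount s (10 * n + 7)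
      (fun s' => s'.reg 35 = max 0 (-Finset.univ.fold min k w)) := by
  refine (Runs.seq (B₁ := 4) (B₂ := 10 * n + 3) (Runs.straight (by rfl) (by decide) ?_)).mono
    (by omega) fun _ h => h
  obtain ⟨s₁, hs₁⟩ : ∃ s₁, s₁ = (Program.instr (.const 25 0) ⨾ .instr (.sub 35 25 1) ⨾
    .ite 35 .skip (.instr (.const 35 0))).run s := ⟨_, rfl⟩
  rw [← hs₁]
  have hfr : SameExcept [25, 35] [] s s₁ := by
    obtain ⟨t, -, ht⟩ := Program.exec_run (p := Program.instr (.const 25 0) ⨾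
      .instr (.sub 35 25 1) ⨾ .ite 35 .skip (.instr (.const 35 0))) (by rfl) s
    rw [hs₁]
    exact ht.sameExcept.mono (by decide) (by decide)
  have h35 : s₁.reg 35 = max 0 (-k) := by
    rw [hs₁]
    by_cases h : k < 0
    · simp [Program.run, Instr.apply, hk, h]
      omega
    · simp [Program.run, Instr.apply, hk, h]
      omega
  -- Register `35` is the least upper bound of `0`, `-k` and the `-w v` seen so far.
  refine (Runs.forUp (N := n) (fun i s => ∀ b : ℤ, s.reg 35 ≤ b ↔
      0 ≤ b ∧ -k ≤ b ∧ ∀ v : Fin n, (v : ℕ) < i → -w v ≤ b) (fun _ => 6)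
    (by decide) (by decide) (by decide) ?_ ?_ ?_ ?_).mono (by simp; omega) ?_
  · intro i s s' hs h
    rw [hs.1 35 (by decide)]
    exact h
  · rw [hfr.1 0 (by decide), hn]
  · intro b
    rw [h35, max_le_iff]
    simp
  · intro i hi s' hsame hsi h
    refine Runs.straight (by rfl) (by decide) fun b => ?_
    have h2 : s'.arr 2 (i : ℤ) = w ⟨i, hi⟩ := by
      rw [hsame.2 2 (by decide), hfr.2 2 (by decide)]
      exact hw ⟨i, hi⟩
    have hstep : (∀ v : Fin n, (v : ℕ) < i + 1 → -w v ≤ b) ↔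
        (∀ v : Fin n, (v : ℕ) < i → -w v ≤ b) ∧ -w ⟨i, hi⟩ ≤ b := by
      constructor
      · exact fun h => ⟨fun v hv => h v (by omega), h ⟨i, hi⟩ (by simp)⟩
      · rintro ⟨h, h'⟩ v hv
        by_cases hvi : (v : ℕ) = i
        · have : v = ⟨i, hi⟩ := Fin.ext hvi
          rwa [this]
        · exact h v (by omega)
    have hmax : ((Program.instr (.load 25 2 24) ⨾ .instr (.add 25 25 35) ⨾
        .instr (.const 33 0) ⨾ .instr (.sub 25 33 25) ⨾
        .ite 25 (.instr (.add 35 35 25)) .skip).run s').reg 35 =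
        max (s'.reg 35) (-w ⟨i, hi⟩) := by
      by_cases hc : w ⟨i, hi⟩ < -s'.reg 35
      · simp [Program.run, Instr.apply, hsi, h2, hc]
        omega
      · simp [Program.run, Instr.apply, hsi, h2, hc]
        omega
    rw [hmax, max_le_iff, h b, hstep]
    tauto
  · intro s' h
    refine eq_of_forall_ge_iff fun b => ?_
    rw [h b, max_le_iff, neg_le (a := Finset.fold _ _ _ _), Finset.le_fold_min]
    simp [neg_le (b := b)]

theorem runs_shiftWeights {ν : ℤ} {γ : ℕ} (hn : s.reg 0 = (n : ℤ)) (hk : s.reg 1 = k)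
    (hw : ∀ v : Fin n, s.arr 2 ((v : ℕ) : ℤ) = w v) (hν : s.reg 35 = ν) (hγ : s.reg 22 = (γ : ℤ))
    (hγn : γ ≤ n) :
    Runs Prog.shiftWeights s (12 * n + 8)
      (fun s' => (∀ v : Fin n, s'.arr 16 ((v : ℕ) : ℤ) = w v + ν) ∧ s'.reg 20 = k + ν * γ) := by
  refine (Runs.seq (B₁ := 2) (B₂ := (5 * γ + 3) + (7 * n + 3))
    (Runs.straight (by rfl) (by decide) (Runs.seq ?_))).mono (by omega) fun _ h => h
  obtain ⟨s₁, hs₁⟩ : ∃ s₁, s₁ = (Program.instr (.const 25 0) ⨾ .instr (.add 20 1 25)).run s :=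
    ⟨_, rfl⟩
  rw [← hs₁]
  have hfr : SameExcept [25, 20] [] s s₁ := by
    constructor <;> intro r hr <;>
      simp only [List.mem_cons, not_or, List.not_mem_nil, not_false_eq_true, and_true] at hr <;>
      simp [hs₁, Program.run, Instr.apply, hr]
  refine ((Runs.forUp (N := γ) (fun i s => s.reg 20 = k + ν * i) (fun _ => 1)
    (by decide) (by decide) (by decide) ?_ ?_ ?_ ?_).frame).mono (by simp; omega) ?_
  · intro i s s' hs h
    rw [hs.1 20 (by decide), h]
  · rw [hfr.1 22 (by decide), hγ]
  · simp [hs₁, Program.run, Instr.apply, hk]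
  · intro i _ s' hsame _ h
    refine Runs.instr ?_
    have h35 : s'.reg 35 = ν := by rw [hsame.1 35 (by decide), hfr.1 35 (by decide), hν]
    simp [Instr.apply, h, h35]
    ring
  rintro s₂ ⟨h20, hfr2⟩
  refine ((Runs.fill (n := n) (c := 3) (a := 16) (fun i => s₂.arr 2 i + ν) (by rfl) (by decide)
    (by decide) (by decide) ?_ ?_).frame).mono (by omega) ?_
  · rw [hfr2.1 0 (by decide), hfr.1 0 (by decide), hn]
  · intro s' hsame _
    have h35 : s'.reg 35 = ν := by
      rw [hsame.1 35 (by decide), hfr2.1 35 (by decide), hfr.1 35 (by decide), hν]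
    simp [Program.run, Instr.apply, h35, hsame.2 2 (by decide)]
  · rintro s₃ ⟨h16, hfr3⟩
    refine ⟨fun v => ?_, ?_⟩
    · rw [h16 v v.2, hfr2.2 2 (by decide), hfr.2 2 (by decide), hw]
    · rw [hfr3.1 20 (by decide), h20]

theorem runs_writeAnswer {o : Option (Finset (Fin n))} (hn : s.reg 0 = (n : ℤ))
    (h : HoldsAnswer s o) :
    Runs Prog.writeAnswer s (6 * n + 5) (fun s' => output n s' = o) := by
  refine (Runs.seq (B₂ := 2) ((Runs.fill (c := 2) (a := 0) (fun i => s.arr 15 i) (by rfl)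
    (by decide) (by decide) (by decide) hn ?_).frame.mono le_rfl ?_)).mono (by omega) fun _ h => h
  · intro s' hsame _
    simp [Program.run, Instr.apply, hsame.2 15 (by decide)]
  · rintro s₁ ⟨h0, hfr⟩
    refine Runs.straight (by rfl) (by decide) ?_
    have h21 : s₁.reg 21 = s.reg 21 := hfr.1 21 (by decide)
    unfold output
    cases o with
    | none =>
      have : s.reg 21 = 0 := h
      simp [Program.run, Instr.apply, h21, this]
    | some D =>
      obtain ⟨h1, h15, -⟩ := h
      have harr : ∀ v : Fin n, s₁.arr 0 ((v : ℕ) : ℤ) = if v ∈ D then 1 else 0 := fun v => by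
        rw [h0 v v.2, h15]
      simp [Program.run, Instr.apply, h21, h1, harr]

theorem runs_minWED (hadj : IsAdjacencyList G adj) (hdc : IsDuallyChordal G)
    (h : HoldsInstance adj w k s) :
    Runs Prog.minWED s (400 * totalSize adj + 100)
      (fun s' => IsAlgorithmResult G w k (output n s')) := by
  have hle := le_totalSize adj
  refine (Runs.seq (B₁ := 155 * totalSize adj + 7) (B₂ := (6 * n + 4) +
    ((97 * totalSize adj + 30) + ((10 * n + 7) + (((12 * n + 8) + ((97 * totalSize adj + 30) +
      (6 * n + 5))) + 1))))
    ((runs_search hadj hdc h.graph h.size h.zero).frame.mono le_rfl ?_)).mono (by omega)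
    fun _ h => h
  rintro s₁ ⟨⟨L, mv, hL, hmem, hlen, h9, h10⟩, hfr1⟩
  obtain ⟨σ, m, hadm, ho1⟩ : ∃ (σ : Fin n ≃ Fin n) (m : Fin n → Fin n),
      IsAdmissible G σ m ∧ HasOrdering σ m s₁ := by
    have key : ∀ N, L.length = N → ∃ (σ : Fin N ≃ Fin n) (m : Fin N → Fin n),
        IsAdmissible G σ m ∧ (∀ i : Fin N, s₁.arr 9 ((i : ℕ) : ℤ) = ((σ i : ℕ) : ℤ)) ∧
        ∀ i : Fin N, s₁.arr 10 ((σ i : ℕ) : ℤ) = ((m i : ℕ) : ℤ) := by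
      rintro N rfl
      exact ⟨_, _, hL.isAdmissible hmem, fun i => h9 i i.2, fun i => h10 _⟩
    obtain ⟨σ, m, hadm, hσ, hm⟩ := key n hlen
    exact ⟨σ, m, hadm, hσ, hm⟩
  refine Runs.seq ((runs_zeroWeights (n := n) ?_).frame.mono le_rfl ?_)
  · rw [hfr1.1 0 (by decide), h.size]
  rintro s₂ ⟨⟨h16, h20⟩, hfr2⟩
  have hG2 : HasGraph adj s₂ := h.graph.congr
    (by rw [hfr2.2 0 (by decide), hfr1.2 0 (by decide)])
    (by rw [hfr2.2 1 (by decide), hfr1.2 1 (by decide)])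
  have ho2 : HasOrdering σ m s₂ := ho1.congr (hfr2.2 9 (by decide)) (hfr2.2 10 (by decide))
  have hn2 : s₂.reg 0 = (n : ℤ) := by
    rw [hfr2.1 0 (by decide), hfr1.1 0 (by decide), h.size]
  refine Runs.seq ((runs_mainPart (W := fun _ => 0) hadj hG2 ho2 hn2 h16 h20).frame.mono le_rfl ?_)
  rintro s₃ ⟨hans, hfr3⟩
  have hn3 : s₃.reg 0 = (n : ℤ) := by rw [hfr3.1 0 (by decide), hn2]
  have hk3 : s₃.reg 1 = k := by
    rw [hfr3.1 1 (by decide), hfr2.1 1 (by decide), hfr1.1 1 (by decide), h.bound]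
  have hw3 : ∀ v : Fin n, s₃.arr 2 ((v : ℕ) : ℤ) = w v := fun v => by
    rw [hfr3.2 2 (by decide), hfr2.2 2 (by decide), hfr1.2 2 (by decide), h.weight]
  refine Runs.seq ((runs_shiftAmount hn3 hk3 hw3).frame.mono le_rfl ?_)
  rintro s₄ ⟨hν, hfr4⟩
  -- with zero weights and bound `0`, every efficient dominating set is a solution
  have hed : IsEDAnswer G (mainPart G σ m (fun _ => 0) 0) := by
    have := mainPart_correct hadm (w := fun _ => 0) (fun _ => le_rfl) 0
    cases hc : mainPart G σ m (fun _ => 0) 0 with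
    | none =>
      rw [hc] at this
      exact fun ⟨D, hD⟩ => this ⟨D, hD, by simp⟩
    | some D =>
      rw [hc] at this
      exact this.1
  obtain ⟨hμk, hμw⟩ := univ_fold_min_le w k
  have hn4 : s₄.reg 0 = (n : ℤ) := by rw [hfr4.1 0 (by decide), hn3]
  have h21 : s₄.reg 21 = s₃.reg 21 := hfr4.1 21 (by decide)
  cases hc : mainPart G σ m (fun _ => 0) 0 with
  | none =>
    rw [hc] at hans hed
    have h21' : s₃.reg 21 = 0 := hans
    refine Runs.ite (fun hpos => absurd hpos (by omega)) fun _ =>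
      (Runs.instr ?_).mono (by omega) fun _ h => h
    refine ⟨none, n, σ, m, hed, hadm, ?_⟩
    -- even if the weights are not shifted, so that the algorithm never asks for `ed`
    have hnone : minWEDAlgorithm G none σ m w k = none := by
      have := minWEDAlgorithm_correct hadm hed w k
      cases hc' : minWEDAlgorithm G none σ m w k with
      | none => rfl
      | some D =>
        rw [hc'] at this
        exact absurd ⟨D, this.1⟩ hed
    rw [hnone]
    simp [output, Instr.apply]
  | some D₀ =>
    rw [hc] at hans hed
    obtain ⟨h21', -, h22⟩ := hans
    refine Runs.ite (fun _ => ?_) fun hneg => absurd hneg (by omega)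
    have hγ : D₀.card ≤ n := by simpa using D₀.card_le_univ
    set μ := Finset.univ.fold min k w with hμ
    refine Runs.seq ((runs_shiftWeights (w := w) (k := k) hn4 ?_ ?_ hν ?_ hγ).frame.mono le_rfl ?_)
    · rw [hfr4.1 1 (by decide), hk3]
    · intro v
      rw [hfr4.2 2 (by decide), hw3]
    · rw [hfr4.1 22 (by decide), h22]
    rintro s₅ ⟨⟨h16', h20'⟩, hfr5⟩
    have hn5 : s₅.reg 0 = (n : ℤ) := by rw [hfr5.1 0 (by decide), hn4]
    refine Runs.seq ((runs_mainPart hadj (hG2.congr ?_ ?_) (ho2.congr ?_ ?_) hn5 h16'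
      h20').frame.mono le_rfl ?_)
    · rw [hfr5.2 0 (by decide), hfr4.2 0 (by decide), hfr3.2 0 (by decide)]
    · rw [hfr5.2 1 (by decide), hfr4.2 1 (by decide), hfr3.2 1 (by decide)]
    · rw [hfr5.2 9 (by decide), hfr4.2 9 (by decide), hfr3.2 9 (by decide)]
    · rw [hfr5.2 10 (by decide), hfr4.2 10 (by decide), hfr3.2 10 (by decide)]
    rintro s₆ ⟨hans', hfr6⟩
    refine (runs_writeAnswer (by rw [hfr6.1 0 (by decide), hn5]) hans').mono le_rfl ?_
    rintro s₇ hout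
    refine ⟨some D₀, n, σ, m, hed, hadm, ?_⟩
    rw [hout]
    unfold minWEDAlgorithm
    dsimp only
    rw [← hμ]
    split_ifs with hneg
    · rw [abs_of_neg hneg, max_eq_right (by omega)]
    · rw [max_eq_left (by omega)]
      simp

theorem runs_negate (h : HoldsInstance adj w k s) :
    Runs Prog.negate s (8 * n + 5) (HoldsInstance adj (fun v => -w v) (-k)) := by
  refine (Runs.seq (B₂ := 2) ((Runs.fill (c := 4) (a := 2) (fun i => -s.arr 2 i) (by rfl)
    (by decide) (by decide) (by decide) h.size ?_).frame.mono le_rfl ?_)).mono (by omega)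
    fun _ h => h
  · intro s' _ hs
    simp [Program.run, Instr.apply, hs]
  · rintro s₁ ⟨h2, hfr⟩
    refine Runs.straight (by rfl) (by decide) ⟨?_, ?_, h.graph.congr ?_ ?_, fun v => ?_, ?_⟩
    · simp [Program.run, Instr.apply, hfr.1 0 (by decide), h.size]
    · simp [Program.run, Instr.apply, hfr.1 1 (by decide), h.bound]
    · simp [Program.run, Instr.apply, hfr.2 0 (by decide)]
    · simp [Program.run, Instr.apply, hfr.2 1 (by decide)]
    · simp [Program.run, Instr.apply, h2 v v.2, h.weight]
    · intro a ha i
      have : a ∉ ([2] : List ℕ) := by simp; omega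
      rw [← h.zero a ha i, ← hfr.2 a this]
      simp [Program.run, Instr.apply]

theorem isMaxWEDAnswer_of_neg {V : Type*} {G : SimpleGraph V} {w : V → ℤ} {k : ℤ}
    {o : Option (Finset V)} (h : IsMinWEDAnswer G (fun v => -w v) (-k) o) :
    IsMaxWEDAnswer G w k o := by
  have hiff : ∀ D : Finset V, ∑ v ∈ D, -w v ≤ -k ↔ k ≤ ∑ v ∈ D, w v := fun D => by
    rw [Finset.sum_neg_distrib, neg_le_neg_iff]
  cases o with
  | none => exact fun ⟨D, hD, hk⟩ => h ⟨D, hD, (hiff D).2 hk⟩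
  | some D => exact ⟨h.1, (hiff D).1 h.2⟩

theorem runs_maxWED (hadj : IsAdjacencyList G adj) (hdc : IsDuallyChordal G)
    (h : HoldsInstance adj w k s) :
    Runs Prog.maxWED s (408 * totalSize adj + 105)
      (fun s' => IsMaxWEDAnswer G w k (output n s')) := by
  have hle := le_totalSize adj
  refine (Runs.seq (B₁ := 8 * n + 5) (B₂ := 400 * totalSize adj + 100)
    ((runs_negate h).mono le_rfl fun s' h' => (runs_minWED hadj hdc h').mono le_rfl ?_)).mono
    (by omega) fun _ h => h
  exact fun _ hr => isMaxWEDAnswer_of_neg hr.isMinWEDAnswer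

/-! ### Linear time -/

theorem getElem?_flatten_ofFn (adj : Fin n → List (Fin n)) (v : Fin n) (j : ℕ)
    (hj : j < (adj v).length) :
    (List.ofFn adj).flatten[listOffset adj v + j]? = some (adj v)[j] := by
  have hsplit : (List.ofFn adj).flatten = ((List.ofFn adj).take v).flatten ++
      (adj v ++ ((List.ofFn adj).drop (v + 1)).flatten) := by
    conv_lhs => rw [← List.take_append_drop v (List.ofFn adj)]
    rw [List.flatten_append, List.drop_eq_getElem_cons (by simp), List.flatten_cons]
    simp
  rw [hsplit, List.getElem?_append_right (by simp [listOffset]),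
    List.getElem?_append_left (by simpa [listOffset] using hj)]
  simp [listOffset, hj]

theorem holdsInstance_initialMemory (adj : Fin n → List (Fin n)) (w : Fin n → ℤ) (k : ℤ) :
    HoldsInstance adj w k (initialMemory adj w k) where
  size := by simp [initialMemory]
  bound := by simp [initialMemory]
  graph := by
    constructor
    · intro i hi
      have : i < n + 1 := by omega
      simp [initialMemory, arrayOfList, List.getD_eq_getElem?_getD, this]
    · intro v j hj
      have h := getElem?_flatten_ofFn adj v j hj
      have h0 : (0 : ℤ) ≤ (listOffset adj v : ℤ) + j := by positivity
      have h1 : ((listOffset adj v : ℤ) + j).toNat = listOffset adj v + j := by omega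
      simp only [initialMemory, arrayOfList, one_ne_zero, if_false, if_true, if_pos h0, h1,
        List.getD_eq_getElem?_getD, List.getElem?_map, h]
      rfl
  weight v := by
    simp [initialMemory, arrayOfList, List.getD_eq_getElem?_getD]
  zero a ha i := by
    have h0 : a ≠ 0 := by omega
    have h1 : a ≠ 1 := by omega
    have h2 : a ≠ 2 := by omega
    simp [initialMemory, h0, h1, h2]

theorem totalSize_eq (hadj : IsAdjacencyList G adj) :
    totalSize adj = n + 2 * G.edgeFinset.card := by
  have hdeg : ∀ v, (adj v).length = G.degree v := fun v => by
    rw [← List.toFinset_card_of_nodup (hadj v).1, ← G.card_neighborFinset_eq_degree]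
    congr 1
    ext x
    simp [(hadj v).2]
  rw [← G.sum_degrees_eq_twice_card_edges, totalSize, Finset.sum_add_distrib]
  simp [hdeg, add_comm]

end MinWED

/-- A program whose running time is linear in the size of the adjacency lists solves its problem in
linear time. -/
theorem SolvableInLinearTime.of_runs {C : ∀ n : ℕ, SimpleGraph (Fin n) → Prop}
    {A : ∀ (n : ℕ) (G : SimpleGraph (Fin n)) [DecidableRel G.Adj],
      (Fin n → ℤ) → ℤ → Option (Finset (Fin n)) → Prop} {p : Program} {a b : ℕ}
    (h : ∀ {n : ℕ} {G : SimpleGraph (Fin n)} [DecidableRel G.Adj] {adj : Fin n → List (Fin n)}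
      {w : Fin n → ℤ} {k : ℤ} {s : Memory}, C n G → IsAdjacencyList G adj →
      HoldsInstance adj w k s →
      Runs p s (a * totalSize adj + b) (fun s' => A n G w k (output n s'))) :
    SolvableInLinearTime C A := by
  refine ⟨p, 2 * a + b, fun n G _ adj w k hC hadj => ?_⟩
  obtain ⟨t, s, he, ht, hA⟩ := h hC hadj (holdsInstance_initialMemory adj w k)
  refine ⟨t, s, he, ht.trans ?_, hA⟩
  rw [totalSize_eq hadj]
  nlinarith [Nat.zero_le (a * n), Nat.zero_le (b * (n + G.edgeFinset.card)), Nat.zero_le a]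

end WED

open WED
theorem theorem2 :
    -- every result of the algorithm on a dually chordal graph is a correct answer
    (∀ (V : Type*) [Fintype V] [DecidableEq V] (G : SimpleGraph V) [DecidableRel G.Adj]
      (w : V → ℤ) (k : ℤ) (out : Option (Finset V)),
      IsDuallyChordal G → IsAlgorithmResult G w k out → IsMinWEDAnswer G w k out) ∧
    -- the algorithm can be carried out in linear time on all dually chordal graphs
    SolvableInLinearTime (fun _ G => IsDuallyChordal G)
      (fun _ G _ w k out => IsAlgorithmResult G w k out ∧ IsMinWEDAnswer G w k out) ∧
    -- the maximization problem
    SolvableInLinearTime (fun _ G => IsDuallyChordal G)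
      (fun _ G _ w k out => IsMaxWEDAnswer G w k out) ∧
    -- strongly chordal graphs
    SolvableInLinearTime (fun _ G => IsStronglyChordal G)
      (fun _ G _ w k out => IsMinWEDAnswer G w k out) ∧
    SolvableInLinearTime (fun _ G => IsStronglyChordal G)
      (fun _ G _ w k out => IsMaxWEDAnswer G w k out) := by
  refine ⟨fun V _ _ G _ w k out _ h => h.isMinWEDAnswer,
    .of_runs fun hdc hadj hs => (runs_minWED hadj hdc hs).mono le_rfl fun _ h =>
      ⟨h, h.isMinWEDAnswer⟩,
    .of_runs fun hdc hadj hs => runs_maxWED hadj hdc hs,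
    .of_runs fun hsc hadj hs => (runs_minWED hadj hsc.isDuallyChordal hs).mono le_rfl fun _ h =>
      h.isMinWEDAnswer,
    .of_runs fun hsc hadj hs => runs_maxWED hadj hsc.isDuallyChordal hs⟩
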